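/- **Conventions.** A foliation $\mathcal F$ of degree $d$ on $\mathbb P^2_{\mathbb C}$ is given, up to a non-zero constant, by a homogeneous $1$-form $\omega=a\,dx+b\,dy+c\,dz$ whose coefficients are homogeneous polynomials of degree $d+1$ without common factor satisfying $xa+yb+zc=0$; its singular points are the common zeros of $a,b,c$, and a line is invariant if $\omega$ restricts to zero on it. Two foliations are linearly conjugate if an automorphism of $\mathbb P^2_{\mathbb C}$ maps one to the other. The Fermat foliation $\mathcal F_0^d$ ($d\ge 2$) is defined in the affine chart $z=1$ by $(x^d-x)\,dy-(y^d-y)\,dx$. $\mathcal F$ is convex if its leaves other than straight lines have no inflection points. A foliation of degree $d\ge1$ has at most $3d$ invariant lines, and it is convex if it has exactly $3d$ of them; in that case it is called reduced convex. Near a singular point $s$, let $X$ be a vector field with isolated zero at $s$ defining $\mathcal F$ in an affine chart centred at $s$, let $R_s=u\,\partial_u+v\,\partial_v$ be the radial field of that chart, and let $J^kX$ be the $k$-jet of $X$ at $s$. Let $\nu$ be the vanishing order of $X$ at $s$ and $\tau=\min\{k\ge\nu:\det(J^kX,R_s)\neq0\}$ (the tangency order of $\mathcal F$ with a generic line through $s$).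 For $n\ge1$, the point $s$ is a radial singularity of order $n$ if $\nu=1$ and $\tau=n+1$. The point $s$ is non-degenerate if the linear part of $X$ at $s$ is invertible; in that case, if $\ell\ni s$ is an invariant line, the Camacho–Sad index $\mathrm{CS}(\mathcal F,\ell,s)$ is the quotient $\lambda/\mu$ of the eigenvalue $\lambda$ of this linear part on the normal direction $T_s\mathbb P^2/T_s\ell$ by the eigenvalue $\mu$ on $T_s\ell$. Let $\mathcal{CS}(\mathcal F)$ be the set of all $\lambda\in\mathbb C\setminus\{0,1\}$ of the form $\mathrm{CS}(\mathcal F,\ell,s)$ with $\ell$ an invariant line of $\mathcal F$ and $s\in\ell$ a non-degenerate singular point of $\mathcal F$. **Theorem.** Let $\mathcal F$ be a foliation of degree $d\ge2$ on $\mathbb P^2_{\mathbb C}$. The following assertions are equivalent: 1. $\mathcal F$ is linearly conjugate to the Fermat foliation $\mathcal F_0^d$; 2. $\mathcal F$ is reduced convex and $\mathcal{CS}(\mathcal F)=\{1-d,\ \tfrac1{1-d}\}$; 3. $\mathcal F$ possesses (at least) three distinct radial singularities of order $d-1$ (the maximal possible order). Moreover, three distinct radial singularities of order $d-1$ of a foliation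 of degree $d\ge2$ are never aligned. -/

import Mathlib

open MvPolynomial

noncomputable section

namespace PlaneFoliation

/-- Polynomial `1`-forms `ω = a dx₀ + b dx₁ + c dx₂` on `ℂ³`, given by their coefficients. -/
abbrev OneForm : Type := Fin 3 → MvPolynomial (Fin 3) ℂ

/-- The projective plane over the complex numbers. -/
abbrev P2 : Type := Projectivization ℂ (Fin 3 → ℂ)

/-- The number `ω_p(v)`. -/
def OneForm.evalAt (ω : OneForm) (p v : Fin 3 → ℂ) : ℂ := ∑ i, eval p (ω i) * v i

/-- A foliation of degree `d` on the projective plane, given by a homogeneous `1`-form whose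
coefficients are homogeneous of degree `d + 1`, without common factor, and which is annihilated by
the radial vector field.  Two such forms define the same foliation if and only if they are
proportional; every notion below depends only on the foliation. -/
structure Foliation (d : ℕ) where
  form : OneForm
  homogeneous : ∀ i, (form i).IsHomogeneous (d + 1)
  euler : ∑ i, X i * form i = 0
  coprime : ∀ h : MvPolynomial (Fin 3) ℂ, (∀ i, h ∣ form i) → IsUnit h

/-- The pull-back of a `1`-form by the linear automorphism `x ↦ g x` of `ℂ³`. -/
def OneForm.pullback (g : GL (Fin 3) ℂ) (ω : OneForm) : OneForm := fun j =>
  ∑ i, C (g.val i j) * aeval (fun k => ∑ l, C (g.val k l) * X l) (ω i)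

/-- Two foliations are linearly conjugate if an automorphism of the projective plane maps one to
the other. -/
def Foliation.IsLinearlyConjugate {d : ℕ} (F G : Foliation d) : Prop :=
  ∃ (g : GL (Fin 3) ℂ) (c : ℂ), c ≠ 0 ∧ F.form.pullback g = fun i => C c * G.form i

/-- The `1`-form
`(y z^d - z y^d) dx + (z x^d - x z^d) dy + (x y^d - y x^d) dz`, which in the affine chart `z = 1`
is `(x^d - x) dy - (y^d - y) dx`. -/
def fermatForm (d : ℕ) : OneForm :=
  ![X 1 * X 2 ^ d - X 2 * X 1 ^ d, X 2 * X 0 ^ d - X 0 * X 2 ^ d, X 0 * X 1 ^ d - X 1 * X 0 ^ d]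

theorem degreeOf_eq_zero_of_dvd {i : Fin 3} {h f : MvPolynomial (Fin 3) ℂ} (hf : f ≠ 0)
    (hd : h ∣ f) (h0 : degreeOf i f = 0) : degreeOf i h = 0 := by
  obtain ⟨k, rfl⟩ := hd
  rw [degreeOf_mul_eq (left_ne_zero_of_mul hf) (right_ne_zero_of_mul hf)] at h0
  omega

theorem fermat_coeff_ne_zero {d : ℕ} (hd : 2 ≤ d) {j k : Fin 3} (hjk : j ≠ k) :
    (X j * X k ^ d - X k * X j ^ d : MvPolynomial (Fin 3) ℂ) ≠ 0 := by
  intro h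
  have h1 := congrArg (eval (fun i => if i = j then (2 : ℂ) else 1)) h
  simp only [map_sub, map_mul, map_pow, eval_X, map_zero, if_true, if_neg hjk.symm, one_pow,
    mul_one, one_mul] at h1
  have h2 : ((2 ^ d : ℕ) : ℂ) = ((2 : ℕ) : ℂ) := by push_cast; linear_combination -h1
  have h3 : 2 ^ d = 2 := by exact_mod_cast h2
  have h4 : 2 ^ 2 ≤ 2 ^ d := Nat.pow_le_pow_right (by norm_num) hd
  omega

theorem fermat_coeff_degreeOf {d : ℕ} {i j k : Fin 3} (hj : i ≠ j) (hk : i ≠ k) :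
    degreeOf i (X j * X k ^ d - X k * X j ^ d : MvPolynomial (Fin 3) ℂ) = 0 := by
  have key : ∀ a b : Fin 3, i ≠ a → i ≠ b →
      degreeOf i (X a * X b ^ d : MvPolynomial (Fin 3) ℂ) = 0 := by
    intro a b ha hb
    have h1 := degreeOf_mul_le i (X a : MvPolynomial (Fin 3) ℂ) (X b ^ d)
    have h2 := degreeOf_pow_le i (X b : MvPolynomial (Fin 3) ℂ) d
    rw [degreeOf_X_of_ne ha] at h1
    rw [degreeOf_X_of_ne hb] at h2
    omega
  have := degreeOf_sub_le i (X j * X k ^ d : MvPolynomial (Fin 3) ℂ) (X k * X j ^ d)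
  rw [key j k hj hk, key k j hk hj] at this
  simpa using this

/-- The Fermat foliation of degree `d ≥ 2`. -/
def fermat (d : ℕ) (hd : 2 ≤ d) : Foliation d where
  form := fermatForm d
  homogeneous := by
    have key : ∀ j k : Fin 3,
        (X j * X k ^ d - X k * X j ^ d : MvPolynomial (Fin 3) ℂ).IsHomogeneous (d + 1) := by
      intro j k
      rw [add_comm d 1]
      refine IsHomogeneous.sub ?_ ?_
      · simpa using (isHomogeneous_X ℂ j).mul ((isHomogeneous_X ℂ k).pow d)
      · simpa using (isHomogeneous_X ℂ k).mul ((isHomogeneous_X ℂ j).pow d)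
    intro i
    fin_cases i
    · exact key 1 2
    · exact key 2 0
    · exact key 0 1
  euler := by
    simp [Fin.sum_univ_three, fermatForm]
    ring
  coprime := by
    intro h hh
    have h0 : degreeOf 0 h = 0 := degreeOf_eq_zero_of_dvd
      (fermat_coeff_ne_zero hd (by decide)) (hh 0)
      (fermat_coeff_degreeOf (i := 0) (j := 1) (k := 2) (by decide) (by decide))
    have h1 : degreeOf 1 h = 0 := degreeOf_eq_zero_of_dvd
      (fermat_coeff_ne_zero hd (by decide)) (hh 1)
      (fermat_coeff_degreeOf (i := 1) (j := 2) (k := 0) (by decide) (by decide))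
    have h2 : degreeOf 2 h = 0 := degreeOf_eq_zero_of_dvd
      (fermat_coeff_ne_zero hd (by decide)) (hh 2)
      (fermat_coeff_degreeOf (i := 2) (j := 0) (k := 1) (by decide) (by decide))
    have hne : h ≠ 0 := by
      rintro rfl
      exact fermat_coeff_ne_zero hd (j := 1) (k := 2) (by decide) (zero_dvd_iff.mp (hh 0))
    have ht : h.totalDegree = 0 := by
      rw [totalDegree_eq_zero_iff]
      intro m hm x
      have hx : degreeOf x h = 0 := by
        fin_cases x
        · exact h0
        · exact h1
        · exact h2
      have := monomial_le_degreeOf x hm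
      omega
    rw [totalDegree_eq_zero_iff_eq_C] at ht
    rw [ht]
    refine (IsUnit.mk0 _ ?_).map C
    intro hc
    rw [hc, map_zero] at ht
    exact hne ht

/-- `ℓ` is a line of the projective plane, seen as a plane through the origin of `ℂ³`. -/
def IsLine (ℓ : Submodule ℂ (Fin 3 → ℂ)) : Prop := Module.finrank ℂ ℓ = 2

/-- The set of lines invariant by `F`: those on which the `1`-form restricts to zero. -/
def Foliation.invariantLines {d : ℕ} (F : Foliation d) : Set (Submodule ℂ (Fin 3 → ℂ)) :=
  {ℓ | IsLine ℓ ∧ ∀ p ∈ ℓ, ∀ v ∈ ℓ, F.form.evalAt p v = 0}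

/-- The homogeneous vector field `Z = curl ω`, with coefficients of degree `d`.  Together with the
radial field `R` it spans the kernel of `ω` off the singular locus, because
`R × Z = - (d + 2) ω`, see `cross_vectorField`. -/
def Foliation.vectorField {d : ℕ} (F : Foliation d) : Fin 3 → MvPolynomial (Fin 3) ℂ :=
  ![pderiv 1 (F.form 2) - pderiv 2 (F.form 1),
    pderiv 2 (F.form 0) - pderiv 0 (F.form 2),
    pderiv 0 (F.form 1) - pderiv 1 (F.form 0)]

theorem Foliation.cross_vectorField {d : ℕ} (F : Foliation d) :
    crossProduct (fun i => (X i : MvPolynomial (Fin 3) ℂ)) F.vectorField =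
      fun i => - ((d : MvPolynomial (Fin 3) ℂ) + 2) * F.form i := by
  have hE : ∀ i, ∑ j, X j * pderiv j (F.form i) = (d + 1) • F.form i :=
    fun i => (F.homogeneous i).sum_X_mul_pderiv
  have hD : ∀ i, pderiv i (∑ j, X j * F.form j) = 0 := fun i => by rw [F.euler, map_zero]
  have hE0 := hE 0
  have hE1 := hE 1
  have hE2 := hE 2
  have hD0 := hD 0
  have hD1 := hD 1
  have hD2 := hD 2
  simp [Fin.sum_univ_three, pderiv_X] at hE0 hE1 hE2 hD0 hD1 hD2
  ext1 i
  fin_cases i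
  · simp [crossProduct, Foliation.vectorField]
    linear_combination hD0 - hE0
  · simp [crossProduct, Foliation.vectorField]
    linear_combination hD1 - hE1
  · simp [crossProduct, Foliation.vectorField]
    linear_combination hD2 - hE2

/-- `p` is an inflection point of the leaf through `[p]` (for `[p]` not singular): along the
integral curve `φ` of `Z` with `φ(0) = p`, the vector `φ''(0) = (Z(Z))(p)` lies in the plane spanned
by `p` and `φ'(0) = Z(p)`, that is, the tangent line has contact of order at least three
with the leaf. -/
def Foliation.IsInflectionAt {d : ℕ} (F : Foliation d) (p : Fin 3 → ℂ) : Prop :=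
  Matrix.det ![p, fun i => eval p (F.vectorField i),
    fun i => ∑ j, eval p (F.vectorField j) * eval p (pderiv j (F.vectorField i))] = 0

/-- The foliation is convex: a leaf that has an inflection point is contained in a line. -/
def Foliation.IsConvex {d : ℕ} (F : Foliation d) : Prop :=
  ∀ p : Fin 3 → ℂ, (∃ i, eval p (F.form i) ≠ 0) → F.IsInflectionAt p →
    ∃ ℓ ∈ F.invariantLines, p ∈ ℓ

/-- Reduced convex foliations: convex, with the maximal number `3d` of invariant lines. -/
def Foliation.IsReducedConvex {d : ℕ} (F : Foliation d) : Prop :=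
  F.IsConvex ∧ F.invariantLines.encard = 3 * (d : ℕ∞)

/-- An affine chart `(u, v) ↦ [b₀ + u b₁ + v b₂]` of the plane is given by a basis `b` of `ℂ³`;
this says that the chart is centred at `s`. -/
def IsCentredAt (b : Module.Basis (Fin 3) ℂ (Fin 3 → ℂ)) (s : P2) : Prop :=
  Projectivization.mk ℂ (b 0) (b.ne_zero 0) = s

/-- The coefficient of `ω` along `b i` in the chart `b`, at the point
`b₀ + u b₁ + v b₂` with `u = X 0` and `v = X 1`; so `ω = localCoeff b 1 du + localCoeff b 2 dv`. -/
def Foliation.localCoeff {d : ℕ} (F : Foliation d) (b : Module.Basis (Fin 3) ℂ (Fin 3 → ℂ))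
    (i : Fin 3) : MvPolynomial (Fin 2) ℂ :=
  ∑ j, C (b i j) * aeval (fun k => C (b 0 k) + C (b 1 k) * X 0 + C (b 2 k) * X 1) (F.form j)

/-- The component `A` of the vector field `A ∂/∂u + B ∂/∂v` that defines `F` in the chart `b`. -/
def Foliation.fieldA {d : ℕ} (F : Foliation d) (b : Module.Basis (Fin 3) ℂ (Fin 3 → ℂ)) :
    MvPolynomial (Fin 2) ℂ := F.localCoeff b 2

/-- The component `B` of the vector field `A ∂/∂u + B ∂/∂v` that defines `F` in the chart `b`. -/
def Foliation.fieldB {d : ℕ} (F : Foliation d) (b : Module.Basis (Fin 3) ℂ (Fin 3 → ℂ)) :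
    MvPolynomial (Fin 2) ℂ := - F.localCoeff b 1

/-- The `k`-jet at the origin of a polynomial. -/
def jet (k : ℕ) (f : MvPolynomial (Fin 2) ℂ) : MvPolynomial (Fin 2) ℂ :=
  ∑ i ∈ Finset.range (k + 1), homogeneousComponent i f

/-- `ν` is the vanishing order at the origin of `A ∂/∂u + B ∂/∂v`. -/
def IsVanishingOrder (A B : MvPolynomial (Fin 2) ℂ) (ν : ℕ) : Prop :=
  IsLeast {k | homogeneousComponent k A ≠ 0 ∨ homogeneousComponent k B ≠ 0} ν

/-- `τ` is the tangency order of `A ∂/∂u + B ∂/∂v` with a generic line through the origin: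
the least `k ≥ ν` for which the determinant of the `k`-jet of the field and of the radial field
`u ∂/∂u + v ∂/∂v` is not zero. -/
def IsTangencyOrder (A B : MvPolynomial (Fin 2) ℂ) (τ : ℕ) : Prop :=
  IsLeast {k | (∃ ν, IsVanishingOrder A B ν ∧ ν ≤ k) ∧
    jet k A * X 1 - jet k B * X 0 ≠ 0} τ

/-- `s` is a radial singularity of order `n`: its vanishing order is `1` and its tangency order is
`n + 1`, in affine charts centred at `s` (the choice of the chart is immaterial). -/
def Foliation.IsRadialSingularity {d : ℕ} (F : Foliation d) (s : P2) (n : ℕ) : Prop :=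
  1 ≤ n ∧ ∀ b, IsCentredAt b s →
    IsVanishingOrder (F.fieldA b) (F.fieldB b) 1 ∧
    IsTangencyOrder (F.fieldA b) (F.fieldB b) (n + 1)

/-- The origin of the chart `b` is a non-degenerate singular point: the vector field vanishes there
and its linear part is invertible. -/
def Foliation.IsNondegenerateIn {d : ℕ} (F : Foliation d)
    (b : Module.Basis (Fin 3) ℂ (Fin 3 → ℂ)) : Prop :=
  eval 0 (F.fieldA b) = 0 ∧ eval 0 (F.fieldB b) = 0 ∧
    eval 0 (pderiv 0 (F.fieldA b)) * eval 0 (pderiv 1 (F.fieldB b))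
      - eval 0 (pderiv 1 (F.fieldA b)) * eval 0 (pderiv 0 (F.fieldB b)) ≠ 0

/-- The singular point `s` of `F` on the invariant line `ℓ` is non-degenerate and the Camacho-Sad
index `CS(F, ℓ, s)` is `lam`.  In a chart centred at `s` in which `ℓ` is `u = 0` the component `A`
is divisible by `u`, and the index is the residue at `v = 0` of `((A / u) / B)(0, v) dv`, that is, the
eigenvalue of the linear part transverse to `ℓ` divided by the one tangent to `ℓ`. -/
def Foliation.HasCamachoSadIndex {d : ℕ} (F : Foliation d) (ℓ : Submodule ℂ (Fin 3 → ℂ)) (s : P2)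
    (lam : ℂ) : Prop :=
  ∃ b, IsCentredAt b s ∧ Submodule.span ℂ {b 0, b 2} = ℓ ∧ F.IsNondegenerateIn b ∧
    lam = eval 0 (pderiv 0 (F.fieldA b)) / eval 0 (pderiv 1 (F.fieldB b))

/-- The set `CS(F)` of the Camacho-Sad indices, other than `0` and `1`, of `F` at its non-degenerate
singular points along its invariant lines. -/
def Foliation.camachoSadSet {d : ℕ} (F : Foliation d) : Set ℂ :=
  {lam | lam ≠ 0 ∧ lam ≠ 1 ∧
    ∃ ℓ ∈ F.invariantLines, ∃ s : P2, s.submodule ≤ ℓ ∧ F.HasCamachoSadIndex ℓ s lam}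

/-- Three points of the plane are aligned if they lie on a line. -/
def Aligned (s₁ s₂ s₃ : P2) : Prop :=
  ∃ ℓ, IsLine ℓ ∧ s₁.submodule ≤ ℓ ∧ s₂.submodule ≤ ℓ ∧ s₃.submodule ≤ ℓ

end PlaneFoliation

end

open MvPolynomial

noncomputable section

namespace PlaneFoliation

/-! Everything is read off two quantities: `ω_p(v)`, which is `evalAt`, and its derivative in the
base point, `polar`.

From 2 to 3. The inflection polynomial has degree `3d` and vanishes on every invariant line, so for
a reduced convex foliation it is, up to a constant, the product of the `3d` equations of these
lines. Its order at a point is then the number of invariant lines through that point. In a chart it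
is also the curvature of the field, whose order would be too large at a degenerate singularity.
Hence every singular point is non-degenerate, lies on at least two invariant lines, and has a radial
linear part as soon as it lies on three (`local_structure`). Each invariant line therefore carries
`d + 1` singular points, whose indices add up to `1` (`exists_lineData`). On a line with an index
`1/(1-d)` arithmetic leaves exactly two indices equal to `1`, and counting the `3d - 1` other lines
where they meet it puts `d + 1` lines through each of these two points. A second line of this kind
supplies a third, non-aligned point. At a point `p` on `d + 1` invariant lines, `x ↦ ω_x(p)` is a
product of linear forms vanishing at `p`, which makes `p` radial of maximal order.

From 3 to 1. Maximal order at `p` forces `ω_x(p)` to depend only on `x` modulo `p`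
(`IsRadialSingularity.invariance`). For three independent points the relation `ω_x(x) = 0` leaves
only the monomials of the Fermat form, and the constants are removed by rescaling the basis. If the
three points were aligned, additivity and homogeneity together would make their whole line singular,
against the coprimality of the coefficients.

From 1 to 2. Both properties are transported by linear maps. For the Fermat foliation the inflection
polynomial splits into `3d` explicit lines, and the indices are quotients of eigenvalues of a
diagonal matrix modulo an eigenvector. -/

/-! ### Derivatives of the form and the inflection polynomial. -/

/-- The chain rule for a polynomial along a curve. -/
theorem hasDerivAt_eval_curve {σ : Type*} [Fintype σ] [DecidableEq σ] (f : MvPolynomial σ ℂ)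
    {c : ℂ → σ → ℂ} {c' : σ → ℂ} {t₀ : ℂ} (hc : ∀ i, HasDerivAt (fun t => c t i) (c' i) t₀) :
    HasDerivAt (fun t => eval (c t) f) (∑ j, eval (c t₀) (pderiv j f) * c' j) t₀ := by
  induction f using MvPolynomial.induction_on with
  | C a => simpa using hasDerivAt_const t₀ a
  | add p q hp hq => simpa [add_mul, Finset.sum_add_distrib] using hp.fun_add hq
  | mul_X p i hp =>
    have h := hp.fun_mul (hc i)
    simp only [map_mul, eval_X]
    refine h.congr_deriv ?_
    symm
    simp only [pderiv_mul, map_add, map_mul, eval_X, add_mul, Finset.sum_add_distrib, pderiv_X,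
      Finset.sum_mul]
    congr 1
    · exact Finset.sum_congr rfl fun j _ => by ring
    · rw [Finset.sum_eq_single i]
      · simp
      · intro j _ hj
        simp [hj.symm]
      · simp

/-- The derivative at `p`, in the direction `x`, of the function `q ↦ ω_q(y)`. -/
def OneForm.polar (ω : OneForm) (p x y : Fin 3 → ℂ) : ℂ :=
  ∑ i, ∑ j, eval p (pderiv j (ω i)) * x j * y i

namespace OneForm

variable (ω : OneForm) (p x x' y y' : Fin 3 → ℂ) (r : ℂ)

theorem evalAt_add : ω.evalAt p (x + y) = ω.evalAt p x + ω.evalAt p y := by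
  simp [evalAt, mul_add, Finset.sum_add_distrib]

theorem evalAt_smul : ω.evalAt p (r • x) = r * ω.evalAt p x := by
  simp only [evalAt, Pi.smul_apply, smul_eq_mul, Finset.mul_sum]
  exact Finset.sum_congr rfl fun j _ => by ring

theorem polar_add_left : ω.polar p (x + x') y = ω.polar p x y + ω.polar p x' y := by
  simp [polar, mul_add, add_mul, Finset.sum_add_distrib]

theorem polar_add_right : ω.polar p x (y + y') = ω.polar p x y + ω.polar p x y' := by
  simp [polar, mul_add, Finset.sum_add_distrib]

theorem polar_smul_left : ω.polar p (r • x) y = r * ω.polar p x y := by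
  simp only [polar, Pi.smul_apply, smul_eq_mul, Finset.mul_sum]
  exact Finset.sum_congr rfl fun i _ => Finset.sum_congr rfl fun j _ => by ring

theorem polar_smul_right : ω.polar p x (r • y) = r * ω.polar p x y := by
  simp only [polar, Pi.smul_apply, smul_eq_mul, Finset.mul_sum]
  exact Finset.sum_congr rfl fun i _ => Finset.sum_congr rfl fun j _ => by ring

theorem hasDerivAt_evalAt_curve {c : ℂ → Fin 3 → ℂ} {c' : Fin 3 → ℂ} {t₀ : ℂ}
    (hc : ∀ i, HasDerivAt (fun t => c t i) (c' i) t₀) :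
    HasDerivAt (fun t => ω.evalAt (c t) y) (ω.polar (c t₀) c' y) t₀ := by
  unfold evalAt polar
  refine HasDerivAt.fun_sum fun i _ => ?_
  exact ((hasDerivAt_eval_curve (ω i) hc).mul_const (y i)).congr_deriv (Finset.sum_mul _ _ _)

theorem hasDerivAt_evalAt (t₀ : ℂ) :
    HasDerivAt (fun t => ω.evalAt (p + t • x) y) (ω.polar (p + t₀ • x) x y) t₀ :=
  ω.hasDerivAt_evalAt_curve y (c := fun t => p + t • x) fun i => by
    simpa using ((hasDerivAt_id t₀).mul_const (x i)).const_add (p i)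

theorem hasDerivAt_evalAt_zero :
    HasDerivAt (fun t : ℂ => ω.evalAt (p + t • x) y) (ω.polar p x y) 0 := by
  simpa using ω.hasDerivAt_evalAt p x y 0

/-- If `ω` vanishes along `y` at all points of a line, its derivative does. -/
theorem polar_eq_zero_of_evalAt (h : ∀ t : ℂ, ω.evalAt (p + t • x) y = 0) :
    ω.polar p x y = 0 := by
  have h1 := ω.hasDerivAt_evalAt_zero p x y
  rw [show (fun t : ℂ => ω.evalAt (p + t • x) y) = fun _ => 0 from funext h] at h1
  exact h1.unique (hasDerivAt_const _ _)

end OneForm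

theorem eval_smul_of_isHomogeneous {σ : Type*} {f : MvPolynomial σ ℂ} {n : ℕ}
    (hf : f.IsHomogeneous n) (r : ℂ) (p : σ → ℂ) : eval (r • p) f = r ^ n * eval p f := by
  rw [eval_eq, eval_eq, Finset.mul_sum]
  refine Finset.sum_congr rfl fun m hm => ?_
  rw [hf.degree_eq_sum_deg_support hm, ← Finset.prod_pow_eq_pow_sum]
  simp only [Pi.smul_apply, smul_eq_mul, mul_pow, Finset.prod_mul_distrib]
  ring

namespace Foliation

variable {d : ℕ} (F : Foliation d) (p x y v : Fin 3 → ℂ)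

theorem evalAt_self : F.form.evalAt p p = 0 := by
  have := congrArg (eval p) F.euler
  simp only [map_sum, map_mul, eval_X, map_zero] at this
  rw [← this, OneForm.evalAt]
  exact Finset.sum_congr rfl fun j _ => by ring

theorem evalAt_smul_base (r : ℂ) : F.form.evalAt (r • p) v = r ^ (d + 1) * F.form.evalAt p v := by
  simp only [OneForm.evalAt, Finset.mul_sum]
  refine Finset.sum_congr rfl fun i _ => ?_
  rw [eval_smul_of_isHomogeneous (F.homogeneous i)]
  ring

theorem polar_smul_base (r : ℂ) : F.form.polar (r • p) x y = r ^ d * F.form.polar p x y := by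
  simp only [OneForm.polar, Finset.mul_sum]
  refine Finset.sum_congr rfl fun i _ => Finset.sum_congr rfl fun j _ => ?_
  rw [eval_smul_of_isHomogeneous (F.homogeneous i).pderiv]
  simp
  ring

theorem polar_base_left : F.form.polar p p y = (d + 1) * F.form.evalAt p y := by
  simp only [OneForm.polar, OneForm.evalAt, Finset.mul_sum]
  refine Finset.sum_congr rfl fun i _ => ?_
  have := congrArg (eval p) (F.homogeneous i).sum_X_mul_pderiv
  simp only [map_sum, map_mul, eval_X, nsmul_eq_mul] at this
  rw [show eval p ((d + 1 : ℕ) : MvPolynomial (Fin 3) ℂ) = (d : ℂ) + 1 by simp] at this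
  rw [← mul_assoc, ← this, Finset.sum_mul]
  exact Finset.sum_congr rfl fun j _ => by ring

/-- This is the relation `ω_q(q) = 0` differentiated at `p` in the direction `x`. -/
theorem polar_base_right : F.form.polar p x p = - F.form.evalAt p x := by
  have h : ∀ j, eval p (pderiv j (∑ i, X i * F.form i)) * x j = 0 := fun j => by
    rw [F.euler]; simp
  have h0 := h 0
  have h1 := h 1
  have h2 := h 2
  simp [Fin.sum_univ_three, pderiv_X] at h0 h1 h2
  simp only [OneForm.polar, OneForm.evalAt, Fin.sum_univ_three]
  rw [← mul_eq_zero] at h0 h1 h2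
  linear_combination h0 + h1 + h2

/-- The polynomial whose zeros are the singular points and the inflection points. -/
def inflection : MvPolynomial (Fin 3) ℂ :=
  ∑ i, ∑ j, pderiv j (F.form i) * F.vectorField j * F.vectorField i

/-- The value of the homogeneous vector field at `p`. -/
def fieldAt : Fin 3 → ℂ := fun i => eval p (F.vectorField i)

theorem eval_inflection :
    eval p F.inflection = F.form.polar p (F.fieldAt p) (F.fieldAt p) := by
  simp [inflection, OneForm.polar, fieldAt]

theorem vectorField_isHomogeneous (i : Fin 3) : (F.vectorField i).IsHomogeneous d := by
  have h : ∀ i j, (pderiv j (F.form i)).IsHomogeneous d := fun i j => (F.homogeneous i).pderiv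
  fin_cases i
  · exact (h 2 1).sub (h 1 2)
  · exact (h 0 2).sub (h 2 0)
  · exact (h 1 0).sub (h 0 1)

theorem inflection_isHomogeneous : F.inflection.IsHomogeneous (3 * d) := by
  refine IsHomogeneous.sum _ _ _ fun i _ => IsHomogeneous.sum _ _ _ fun j _ => ?_
  have h := (((F.homogeneous i).pderiv (i := j)).mul (F.vectorField_isHomogeneous j)).mul
    (F.vectorField_isHomogeneous i)
  convert h using 1
  simp
  ring

theorem cross_fieldAt : crossProduct p (F.fieldAt p) =
    fun i => - ((d : ℂ) + 2) * eval p (F.form i) := by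
  ext i
  have h := congrArg (eval p) (congrFun F.cross_vectorField i)
  rw [show eval p (- ((d : MvPolynomial (Fin 3) ℂ) + 2) * F.form i)
    = - ((d : ℂ) + 2) * eval p (F.form i) by simp] at h
  rw [← h, cross_apply, cross_apply]
  fin_cases i <;> simp [fieldAt]

theorem two_add_ne_zero : (d : ℂ) + 2 ≠ 0 := by
  exact_mod_cast Nat.succ_ne_zero (d + 1)

/-- A polynomial identity: the field annihilates the form. -/
theorem sum_form_mul_vectorField : ∑ i, F.form i * F.vectorField i = 0 := by
  refine MvPolynomial.funext fun p => ?_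
  have h := F.cross_fieldAt p
  have h0 := congrFun h 0
  have h1 := congrFun h 1
  have h2 := congrFun h 2
  simp only [cross_apply, fieldAt] at h0 h1 h2
  simp at h0 h1 h2
  apply mul_left_cancel₀ (two_add_ne_zero (d := d))
  simp only [Fin.sum_univ_three, map_add, map_mul, map_zero]
  linear_combination (eval p (F.vectorField 0)) * h0 + (eval p (F.vectorField 1)) * h1
    + (eval p (F.vectorField 2)) * h2

/-- Since `p × Z = -(d + 2) ω`, the determinant is `-(d + 2) ω_p(Z(Z))`. Differentiating `ω(Z) = 0`
along `Z` turns `-ω(Z(Z))` into the derivative of `ω` along `Z`, applied to `Z`. -/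
theorem isInflectionAt_iff : F.IsInflectionAt p ↔ eval p F.inflection = 0 := by
  have h := F.cross_fieldAt p
  have h0 := congrFun h 0
  have h1 := congrFun h 1
  have h2 := congrFun h 2
  simp only [cross_apply, fieldAt] at h0 h1 h2
  simp at h0 h1 h2
  have hD : ∀ j, eval p (pderiv j (∑ i, F.form i * F.vectorField i)) = 0 := fun j => by
    rw [F.sum_form_mul_vectorField]; simp
  have hD0 := hD 0
  have hD1 := hD 1
  have hD2 := hD 2
  simp only [Fin.sum_univ_three, map_add, pderiv_mul, map_mul] at hD0 hD1 hD2
  have key : Matrix.det ![p, fun i => eval p (F.vectorField i),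
    fun i => ∑ j, eval p (F.vectorField j) * eval p (pderiv j (F.vectorField i))] =
      (d + 2) * eval p F.inflection := by
    refine (Matrix.det_fin_three _).trans ?_
    rw [inflection]
    simp only [Fin.sum_univ_three, map_add, map_mul, Matrix.cons_val_zero, Matrix.cons_val_one,
      Matrix.cons_val]
    generalize eval p (F.vectorField 0) = z0 at *
    generalize eval p (F.vectorField 1) = z1 at *
    generalize eval p (F.vectorField 2) = z2 at *
    linear_combination
      (z0 * eval p (pderiv 0 (F.vectorField 0)) + z1 * eval p (pderiv 1 (F.vectorField 0)) +
        z2 * eval p (pderiv 2 (F.vectorField 0))) * h0 +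
      (z0 * eval p (pderiv 0 (F.vectorField 1)) + z1 * eval p (pderiv 1 (F.vectorField 1)) +
        z2 * eval p (pderiv 2 (F.vectorField 1))) * h1 +
      (z0 * eval p (pderiv 0 (F.vectorField 2)) + z1 * eval p (pderiv 1 (F.vectorField 2)) +
        z2 * eval p (pderiv 2 (F.vectorField 2))) * h2
      - (d + 2) * (z0 * hD0 + z1 * hD1 + z2 * hD2)
  rw [IsInflectionAt, key, mul_eq_zero, or_iff_right two_add_ne_zero]

end Foliation

theorem exists_smul_of_cross_eq_zero {x y : Fin 3 → ℂ} (hx : x ≠ 0) (h : crossProduct x y = 0) :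
    ∃ r : ℂ, y = r • x := by
  by_contra hne
  push Not at hne
  refine (crossProduct_ne_zero_iff_linearIndependent.2 ?_) h
  rw [LinearIndependent.pair_iff' hx]
  exact fun a ha => hne a ha.symm

/-- The value of the vector field at `x` is a combination of `x` and of any vector, independent
of `x`, that is annihilated by the form. -/
theorem Foliation.exists_fieldAt_eq {d : ℕ} (F : Foliation d) {x v : Fin 3 → ℂ}
    (hxv : crossProduct x v ≠ 0) (hv : F.form.evalAt x v = 0) :
    ∃ a b : ℂ, F.fieldAt x = a • x + b • v := by
  have hx : x ≠ 0 := by rintro rfl; simp at hxv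
  -- Both `x × v` and the covector `ω_x` are orthogonal to `x` and `v`, so they are proportional;
  -- comparison with `x × Z = -(d + 2) ω` gives `Z`.
  have hN : crossProduct (crossProduct x v) (fun i => eval x (F.form i)) = 0 := by
    have h1 := hv
    have h2 := F.evalAt_self x
    simp only [OneForm.evalAt, Fin.sum_univ_three] at h1 h2
    rw [cross_apply, cross_apply]
    ext i
    fin_cases i
    · simp; linear_combination v 0 * h2 - x 0 * h1
    · simp; linear_combination v 1 * h2 - x 1 * h1
    · simp; linear_combination v 2 * h2 - x 2 * h1
  obtain ⟨k, hk⟩ := exists_smul_of_cross_eq_zero hxv hN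
  have h3 := F.cross_fieldAt x
  have h4 : crossProduct x (F.fieldAt x + ((d + 2) * k) • v) = 0 := by
    rw [map_add, h3, map_smul]
    ext i
    have := congrFun hk i
    simp only [Pi.smul_apply, smul_eq_mul] at this
    simp only [Pi.add_apply, Pi.smul_apply, smul_eq_mul, this, Pi.zero_apply]
    ring
  obtain ⟨a, ha⟩ := exists_smul_of_cross_eq_zero hx h4
  exact ⟨a, -((d + 2) * k), by rw [← ha, neg_smul]; abel⟩

/-- The terms containing `x` reduce to `ω_x(x)` or `ω_x(v)`, which vanish. On the kernel of `ω_x`,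
the quadratic form thus depends only on the direction modulo `x`. -/
theorem Foliation.polar_combination {d : ℕ} (F : Foliation d) {x v : Fin 3 → ℂ}
    (hv : F.form.evalAt x v = 0) (a b : ℂ) :
    F.form.polar x (a • x + b • v) (a • x + b • v) = b ^ 2 * F.form.polar x v v := by
  simp only [OneForm.polar_add_left, OneForm.polar_add_right, OneForm.polar_smul_left,
    OneForm.polar_smul_right, F.polar_base_left, F.polar_base_right, OneForm.evalAt_add,
    OneForm.evalAt_smul, F.evalAt_self, hv]
  ring

theorem Foliation.eval_inflection_eq_zero {d : ℕ} (F : Foliation d) {x v : Fin 3 → ℂ}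
    (hxv : crossProduct x v ≠ 0) (hv : F.form.evalAt x v = 0) (h : F.form.polar x v v = 0) :
    eval x F.inflection = 0 := by
  obtain ⟨a, b, hab⟩ := F.exists_fieldAt_eq hxv hv
  rw [F.eval_inflection, hab, F.polar_combination hv, h, mul_zero]

/-- A description of inflection without the curl: it needs only the form and its derivative, which
linear maps visibly transport. -/
theorem Foliation.isInflectionAt_iff_forall {d : ℕ} (F : Foliation d) {x : Fin 3 → ℂ}
    (hx : ∃ i, eval x (F.form i) ≠ 0) :
    F.IsInflectionAt x ↔ ∀ v, F.form.evalAt x v = 0 → F.form.polar x v v = 0 := by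
  have hx0 : crossProduct x (F.fieldAt x) ≠ 0 := by
    obtain ⟨i, hi⟩ := hx
    rw [F.cross_fieldAt]
    intro h
    have := congrFun h i
    simp only [Pi.zero_apply, mul_eq_zero, neg_eq_zero] at this
    rcases this with h | h
    · exact two_add_ne_zero h
    · exact hi h
  rw [F.isInflectionAt_iff]
  constructor
  · intro h v hv
    by_cases hxv : crossProduct x v = 0
    · have hxne : x ≠ 0 := by rintro rfl; simp at hx0
      obtain ⟨r, rfl⟩ := exists_smul_of_cross_eq_zero hxne hxv
      rw [OneForm.polar_smul_left, F.polar_base_left, OneForm.evalAt_smul, F.evalAt_self]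
      ring
    · obtain ⟨a, b, hab⟩ := F.exists_fieldAt_eq hxv hv
      rw [F.eval_inflection, hab, F.polar_combination hv] at h
      rcases mul_eq_zero.1 h with h | h
      · exfalso
        apply hx0
        rw [hab, pow_eq_zero_iff (by norm_num) |>.1 h]
        simp
      · exact h
  · intro h
    rw [F.eval_inflection]
    refine h _ ?_
    have := congrArg (eval x) F.sum_form_mul_vectorField
    simpa [OneForm.evalAt, fieldAt] using this

/-! ### Affine charts. -/

/-- The point of `ℂ³` with coordinates `w` in the affine chart `b`. -/
def chartPoint (b : Module.Basis (Fin 3) ℂ (Fin 3 → ℂ)) (w : Fin 2 → ℂ) : Fin 3 → ℂ :=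
  b 0 + w 0 • b 1 + w 1 • b 2

theorem chartPoint_zero (b : Module.Basis (Fin 3) ℂ (Fin 3 → ℂ)) : chartPoint b 0 = b 0 := by
  simp [chartPoint]

namespace Foliation

variable {d : ℕ} (F : Foliation d) (b : Module.Basis (Fin 3) ℂ (Fin 3 → ℂ))

theorem eval_localCoeff (i : Fin 3) (w : Fin 2 → ℂ) :
    eval w (F.localCoeff b i) = F.form.evalAt (chartPoint b w) (b i) := by
  have h : ∀ f : MvPolynomial (Fin 3) ℂ,
      eval w (aeval (fun k => C (b 0 k) + C (b 1 k) * X 0 + C (b 2 k) * X 1) f)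
        = eval (chartPoint b w) f := by
    intro f
    rw [← aeval_eq_eval, ← aeval_eq_eval,
      ← AlgHom.comp_apply]
    congr 1
    ext k
    simp [chartPoint, mul_comm]
  simp only [localCoeff, map_sum, map_mul, eval_C, h, OneForm.evalAt]
  exact Finset.sum_congr rfl fun j _ => mul_comm _ _

theorem eval_pderiv_localCoeff (i : Fin 3) (j : Fin 2) (w : Fin 2 → ℂ) :
    eval w (pderiv j (F.localCoeff b i)) = F.form.polar (chartPoint b w) (b j.succ) (b i) := by
  have h1 := hasDerivAt_eval_curve (F.localCoeff b i) (c := fun t => w + t • Pi.single j 1)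
    (c' := Pi.single j 1) (t₀ := 0) (fun k => by
      simpa using ((hasDerivAt_id (0 : ℂ)).mul_const ((Pi.single j 1 : Fin 2 → ℂ) k)).const_add
        (w k))
  simp only [eval_localCoeff] at h1
  have h2 := F.form.hasDerivAt_evalAt_zero (chartPoint b w) (b j.succ) (b i)
  have h3 : (fun t : ℂ => F.form.evalAt (chartPoint b (w + t • Pi.single j 1)) (b i)) =
      fun t : ℂ => F.form.evalAt (chartPoint b w + t • b j.succ) (b i) := by
    funext t
    congr 1
    unfold chartPoint
    fin_cases j
    · simp [add_smul]; abel
    · simp [add_smul]; abel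
  rw [h3] at h1
  have h4 := h1.unique h2
  rw [← h4]
  simp [Pi.single_apply]

/-- The determinant of the chart field with the radial field is, by this relation, minus the
coefficient along `b 0`. The order of that coefficient thus measures how close the field is to being
radial. -/
theorem localCoeff_euler :
    F.localCoeff b 0 + X 0 * F.localCoeff b 1 + X 1 * F.localCoeff b 2 = 0 := by
  refine MvPolynomial.funext fun w => ?_
  simp only [map_add, map_mul, eval_localCoeff, eval_X, map_zero]
  rw [← F.evalAt_self (chartPoint b w), ← OneForm.evalAt_smul, ← OneForm.evalAt_smul,
    ← OneForm.evalAt_add, ← OneForm.evalAt_add, chartPoint]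

end Foliation

/-! ### Lines, their equations, and divisibility by them. -/

/-- The linear form with coefficients `n`. -/
def linForm (n : Fin 3 → ℂ) : MvPolynomial (Fin 3) ℂ := ∑ i, C (n i) * X i

theorem eval_linForm (n p : Fin 3 → ℂ) : eval p (linForm n) = n ⬝ᵥ p := by
  simp [linForm, dotProduct]

theorem linForm_isHomogeneous (n : Fin 3 → ℂ) : (linForm n).IsHomogeneous 1 :=
  IsHomogeneous.sum _ _ _ fun _ _ => isHomogeneous_C_mul_X _ _

theorem linForm_ne_zero {n : Fin 3 → ℂ} (hn : n ≠ 0) : linForm n ≠ 0 := by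
  obtain ⟨i, hi⟩ := Function.ne_iff.1 hn
  intro h
  have := eval_linForm n (Pi.single i 1)
  rw [h] at this
  simp at this
  exact hi this.symm

/-- The substitution that projects the space on the plane `n ⬝ᵥ x = 0` along `e`. -/
def projectAlong (n e : Fin 3 → ℂ) : MvPolynomial (Fin 3) ℂ →ₐ[ℂ] MvPolynomial (Fin 3) ℂ :=
  aeval fun i => X i - C (e i) * linForm n

theorem eval_projectAlong (n e p : Fin 3 → ℂ) (f : MvPolynomial (Fin 3) ℂ) :
    eval p (projectAlong n e f) = eval (p - (n ⬝ᵥ p) • e) f := by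
  rw [projectAlong, ← aeval_eq_eval, ← aeval_eq_eval,
    ← AlgHom.comp_apply]
  congr 1
  ext k
  simp [aeval_eq_eval, eval_linForm, mul_comm]

theorem linForm_dvd_sub_projectAlong (n e : Fin 3 → ℂ) (f : MvPolynomial (Fin 3) ℂ) :
    linForm n ∣ f - projectAlong n e f := by
  induction f using MvPolynomial.induction_on with
  | C a => simp [projectAlong]
  | add p q hp hq =>
    rw [map_add, show p + q - (projectAlong n e p + projectAlong n e q) =
      (p - projectAlong n e p) + (q - projectAlong n e q) by ring]
    exact dvd_add hp hq
  | mul_X p i hp =>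
    rw [map_mul, show p * X i - projectAlong n e p * projectAlong n e (X i) =
      (p - projectAlong n e p) * X i + projectAlong n e p * (X i - projectAlong n e (X i)) by ring]
    refine dvd_add (hp.mul_right _) (Dvd.dvd.mul_left ?_ _)
    rw [projectAlong, aeval_X, sub_sub_cancel]
    exact dvd_mul_left _ _

theorem exists_dotProduct_eq_one {n : Fin 3 → ℂ} (hn : n ≠ 0) : ∃ e, n ⬝ᵥ e = 1 := by
  obtain ⟨i, hi⟩ := Function.ne_iff.1 hn
  exact ⟨Pi.single i (n i)⁻¹, by simpa using mul_inv_cancel₀ hi⟩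

/-- Modulo the linear form, `f` equals its composition with the projection onto the plane along a
vector `e` with `n ⬝ᵥ e = 1`. -/
theorem linForm_dvd_iff {n : Fin 3 → ℂ} (hn : n ≠ 0) (f : MvPolynomial (Fin 3) ℂ) :
    linForm n ∣ f ↔ ∀ p, n ⬝ᵥ p = 0 → eval p f = 0 := by
  constructor
  · rintro ⟨g, rfl⟩ p hp
    rw [map_mul, eval_linForm, hp, zero_mul]
  · intro h
    obtain ⟨e, he⟩ := exists_dotProduct_eq_one hn
    have h1 := linForm_dvd_sub_projectAlong n e f
    rwa [show projectAlong n e f = 0 from MvPolynomial.funext fun p => ?_, sub_zero] at h1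
    rw [eval_projectAlong, map_zero]
    apply h
    rw [dotProduct_sub, dotProduct_smul, he]
    simp

/-- The multiples of the linear form are the kernel of `projectAlong n e`, a morphism to a domain.
-/
theorem linForm_prime {n : Fin 3 → ℂ} (hn : n ≠ 0) : Prime (linForm n) := by
  refine ⟨linForm_ne_zero hn, ?_, ?_⟩
  · intro h
    have h1 := (MvPolynomial.isUnit_iff_totalDegree_of_isReduced.1 h).2
    rw [(linForm_isHomogeneous n).totalDegree (linForm_ne_zero hn)] at h1
    exact one_ne_zero h1
  · intro f g hfg
    obtain ⟨e, he⟩ := exists_dotProduct_eq_one hn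
    have h0 : ∀ f, linForm n ∣ f → projectAlong n e f = 0 := by
      rintro _ ⟨k, rfl⟩
      rw [map_mul, show projectAlong n e (linForm n) = 0 from ?_, zero_mul]
      refine MvPolynomial.funext fun p => ?_
      rw [eval_projectAlong, eval_linForm, dotProduct_sub, dotProduct_smul, he]
      simp
    have h1 := h0 _ hfg
    rw [map_mul, mul_eq_zero] at h1
    refine h1.imp (fun h => ?_) fun h => ?_
    · simpa [h] using linForm_dvd_sub_projectAlong n e f
    · simpa [h] using linForm_dvd_sub_projectAlong n e g

theorem IsLine.exists_normal {ℓ : Submodule ℂ (Fin 3 → ℂ)} (hℓ : IsLine ℓ) :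
    ∃ n : Fin 3 → ℂ, n ≠ 0 ∧ ∀ x, x ∈ ℓ ↔ n ⬝ᵥ x = 0 := by
  have hlt : ℓ < ⊤ := by
    refine lt_top_iff_ne_top.2 ?_
    rintro rfl
    rw [IsLine, finrank_top] at hℓ
    simp at hℓ
  obtain ⟨f, hf, hle⟩ := Submodule.exists_le_ker_of_lt_top ℓ hlt
  have hker : Module.finrank ℂ (LinearMap.ker f) = 2 := by
    have h1 := f.finrank_range_add_finrank_ker
    have h2 : LinearMap.range f = ⊤ := LinearMap.range_eq_top.2 (LinearMap.surjective hf)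
    rw [h2] at h1
    simp at h1
    omega
  have heq : ℓ = LinearMap.ker f :=
    Submodule.eq_of_le_of_finrank_eq hle (by rw [hker]; exact hℓ)
  have hfx : ∀ x, f x = (fun i => f (Pi.single i 1)) ⬝ᵥ x := by
    intro x
    conv_lhs => rw [LinearMap.pi_apply_eq_sum_univ f x]
    simp only [dotProduct, smul_eq_mul]
    refine Finset.sum_congr rfl fun i _ => ?_
    rw [mul_comm]
    congr 2
    ext j
    simp [Pi.single_apply, eq_comm]
  refine ⟨fun i => f (Pi.single i 1), ?_, fun x => ?_⟩
  · rintro h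
    apply hf
    ext x
    simp only [LinearMap.comp_apply]
    exact congrFun h _
  · rw [heq, LinearMap.mem_ker, hfx]

/-- The coefficients of an equation of a line. -/
def normal (ℓ : Submodule ℂ (Fin 3 → ℂ)) : Fin 3 → ℂ :=
  open Classical in if h : IsLine ℓ then h.exists_normal.choose else 0

theorem IsLine.normal_ne_zero {ℓ : Submodule ℂ (Fin 3 → ℂ)} (hℓ : IsLine ℓ) : normal ℓ ≠ 0 := by
  rw [normal, dif_pos hℓ]
  exact hℓ.exists_normal.choose_spec.1

theorem IsLine.mem_iff {ℓ : Submodule ℂ (Fin 3 → ℂ)} (hℓ : IsLine ℓ) (x : Fin 3 → ℂ) :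
    x ∈ ℓ ↔ normal ℓ ⬝ᵥ x = 0 := by
  rw [normal, dif_pos hℓ]
  exact hℓ.exists_normal.choose_spec.2 x

theorem IsLine.eq_of_le {ℓ ℓ' : Submodule ℂ (Fin 3 → ℂ)} (hℓ : IsLine ℓ) (hℓ' : IsLine ℓ')
    (h : ℓ ≤ ℓ') : ℓ = ℓ' :=
  Submodule.eq_of_le_of_finrank_eq h (hℓ.trans hℓ'.symm)

theorem IsLine.linForm_normal_dvd_iff {ℓ : Submodule ℂ (Fin 3 → ℂ)} (hℓ : IsLine ℓ)
    (f : MvPolynomial (Fin 3) ℂ) : linForm (normal ℓ) ∣ f ↔ ∀ p ∈ ℓ, eval p f = 0 := by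
  rw [linForm_dvd_iff hℓ.normal_ne_zero]
  simp only [hℓ.mem_iff]

/-- A polynomial that vanishes on finitely many lines is divisible by the product of their
equations. -/
theorem prod_linForm_dvd {S : Finset (Submodule ℂ (Fin 3 → ℂ))} (hS : ∀ ℓ ∈ S, IsLine ℓ)
    {f : MvPolynomial (Fin 3) ℂ} (hf : ∀ ℓ ∈ S, ∀ p ∈ ℓ, eval p f = 0) :
    ∏ ℓ ∈ S, linForm (normal ℓ) ∣ f := by
  classical
  induction S using Finset.induction_on generalizing f with
  | empty => simp
  | insert ℓ S hℓS ih =>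
    have hℓ := hS ℓ (Finset.mem_insert_self _ _)
    obtain ⟨g, rfl⟩ := (hℓ.linForm_normal_dvd_iff f).2 (hf ℓ (Finset.mem_insert_self _ _))
    rw [Finset.prod_insert hℓS]
    refine mul_dvd_mul_left _ (ih (fun k hk => hS k (Finset.mem_insert_of_mem hk)) ?_)
    intro k hk
    have hk' := hS k (Finset.mem_insert_of_mem hk)
    rw [← hk'.linForm_normal_dvd_iff]
    have h1 := (hk'.linForm_normal_dvd_iff _).2 (hf k (Finset.mem_insert_of_mem hk))
    -- The equation of `k` cannot divide that of `ℓ`, since two distinct lines do not contain one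
    -- another; being prime, it divides the cofactor `g`.
    refine ((linForm_prime hk'.normal_ne_zero).dvd_or_dvd h1).resolve_left fun h2 => ?_
    rw [hk'.linForm_normal_dvd_iff] at h2
    refine hℓS ?_
    rwa [← hk'.eq_of_le hℓ fun p hp => ?_]
    rw [hℓ.mem_iff, ← eval_linForm]
    exact h2 p hp

/-! ### Order of vanishing at the origin and the curvature of a plane field. -/

/-- The maximal ideal of the origin of the plane. -/
abbrev originIdeal : Ideal (MvPolynomial (Fin 2) ℂ) := idealOfVars (Fin 2) ℂ

local notation "𝔪" => originIdeal

theorem X_mem_originIdeal (i : Fin 2) : (X i : MvPolynomial (Fin 2) ℂ) ∈ 𝔪 :=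
  Ideal.subset_span ⟨i, rfl⟩

theorem originIdeal_eq_span :
    𝔪 = Ideal.span {(X 0 : MvPolynomial (Fin 2) ℂ), X 1} := by
  rw [originIdeal, idealOfVars]
  congr 1
  ext f
  simp [Fin.exists_fin_two, eq_comm]

theorem mem_originIdeal_iff (f : MvPolynomial (Fin 2) ℂ) : f ∈ 𝔪 ↔ eval 0 f = 0 := by
  have := mem_pow_idealOfVars_iff' (σ := Fin 2) (R := ℂ) 1 f
  rw [pow_one] at this
  rw [this, eval_zero, constantCoeff_eq]
  constructor
  · exact fun h => h 0 (by simp)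
  · intro h x hx
    rw [Nat.lt_one_iff, Finsupp.degree_eq_zero_iff] at hx
    rw [hx, h]

theorem exists_of_mem_originIdeal_pow_succ {f : MvPolynomial (Fin 2) ℂ} {k : ℕ}
    (hf : f ∈ 𝔪 ^ (k + 1)) : ∃ g ∈ 𝔪 ^ k, ∃ h ∈ 𝔪 ^ k, f = X 0 * g + X 1 * h := by
  rw [pow_succ] at hf
  refine Submodule.mul_induction_on hf ?_ ?_
  · intro m hm n hn
    rw [originIdeal_eq_span, Ideal.mem_span_pair] at hn
    obtain ⟨a, b, rfl⟩ := hn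
    exact ⟨_, Ideal.mul_mem_left _ a hm, _, Ideal.mul_mem_left _ b hm, by ring⟩
  · rintro _ _ ⟨g, hg, h, hh, rfl⟩ ⟨g', hg', h', hh', rfl⟩
    exact ⟨_, add_mem hg hg', _, add_mem hh hh', by ring⟩

theorem mem_pow_of_X_mul_mem_pow_succ {f : MvPolynomial (Fin 2) ℂ} {k : ℕ} (i : Fin 2)
    (hf : X i * f ∈ 𝔪 ^ (k + 1)) : f ∈ 𝔪 ^ k := by
  rw [mem_pow_idealOfVars_iff'] at hf ⊢
  intro x hx
  have := hf (Finsupp.single i 1 + x) (by simp [map_add]; omega)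
  rwa [coeff_X_mul] at this

theorem mul_mem_pow_add {f g : MvPolynomial (Fin 2) ℂ} {k l : ℕ} (hf : f ∈ 𝔪 ^ k)
    (hg : g ∈ 𝔪 ^ l) : f * g ∈ 𝔪 ^ (k + l) := by
  rw [pow_add]
  exact Ideal.mul_mem_mul hf hg

theorem pderiv_mem_pow {k : ℕ} {f : MvPolynomial (Fin 2) ℂ} (hf : f ∈ 𝔪 ^ (k + 1)) (i : Fin 2) :
    pderiv i f ∈ 𝔪 ^ k := by
  rw [mem_pow_idealOfVars_iff'] at hf ⊢
  intro x hx
  rw [coeff_pderiv, hf _ (by simp [map_add]; omega)]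
  simp

theorem mem_originIdeal_sq {f : MvPolynomial (Fin 2) ℂ} (h : eval 0 f = 0)
    (h' : ∀ i, eval 0 (pderiv i f) = 0) : f ∈ 𝔪 ^ 2 := by
  rw [← mem_originIdeal_iff, originIdeal_eq_span, Ideal.mem_span_pair] at h
  obtain ⟨a, b, rfl⟩ := h
  have h0 := h' 0
  have h1 := h' 1
  simp only [map_add, pderiv_mul, pderiv_X_self, map_mul, eval_X, Pi.zero_apply, mul_zero,
    pderiv_X_of_ne (show (0 : Fin 2) ≠ 1 by decide), mul_one, zero_add, add_zero,
    pderiv_X_of_ne (show (1 : Fin 2) ≠ 0 by decide)] at h0 h1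
  rw [← mem_originIdeal_iff] at h0 h1
  rw [pow_two]
  exact add_mem (Ideal.mul_mem_mul h0 (X_mem_originIdeal 0))
    (Ideal.mul_mem_mul h1 (X_mem_originIdeal 1))

/-- The derivation `c ∂/∂u - b ∂/∂v`. -/
def planeField (b c : MvPolynomial (Fin 2) ℂ) :
    Derivation ℂ (MvPolynomial (Fin 2) ℂ) (MvPolynomial (Fin 2) ℂ) :=
  c • pderiv 0 - b • pderiv 1

variable {b c : MvPolynomial (Fin 2) ℂ}

theorem planeField_apply (f : MvPolynomial (Fin 2) ℂ) :
    planeField b c f = c * pderiv 0 f - b * pderiv 1 f := rfl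

theorem planeField_X_zero : planeField b c (X 0) = c := by
  simp [planeField_apply, pderiv_X]

theorem planeField_X_one : planeField b c (X 1) = -b := by
  simp [planeField_apply, pderiv_X]

theorem planeField_mem {e k : ℕ} (hb : b ∈ 𝔪 ^ e) (hc : c ∈ 𝔪 ^ e)
    {f : MvPolynomial (Fin 2) ℂ} (hf : f ∈ 𝔪 ^ (k + 1)) : planeField b c f ∈ 𝔪 ^ (k + e) := by
  rw [planeField_apply, add_comm]
  exact sub_mem (mul_mem_pow_add hc (pderiv_mem_pow hf 0))
    (mul_mem_pow_add hb (pderiv_mem_pow hf 1))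

/-- The curvature of the field `c ∂/∂u - b ∂/∂v`, which vanishes at the inflection points. -/
def planeInflection (b c : MvPolynomial (Fin 2) ℂ) : MvPolynomial (Fin 2) ℂ :=
  c * planeField b c b - b * planeField b c c

theorem planeInflection_mem_sq (hb : b ∈ 𝔪) (hc : c ∈ 𝔪) : planeInflection b c ∈ 𝔪 ^ 2 := by
  rw [← pow_one 𝔪] at hb hc
  have h : ∀ f ∈ 𝔪 ^ 1, planeField b c f ∈ 𝔪 ^ 1 := fun f hf =>
    planeField_mem (e := 1) (k := 0) hb hc hf
  exact sub_mem (mul_mem_pow_add (k := 1) (l := 1) hc (h _ hb))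
    (mul_mem_pow_add (k := 1) (l := 1) hb (h _ hc))

/-- The syzygies of the two coordinates are generated by the Koszul one. -/
theorem X_zero_dvd_of_mul_X_one {f g : MvPolynomial (Fin 2) ℂ} (h : X 0 * f + X 1 * g = 0) :
    ∃ k, g = X 0 * k ∧ f = - (X 1 * k) := by
  have h1 : (X 0 : MvPolynomial (Fin 2) ℂ) ∣ X 1 * g := ⟨-f, by linear_combination h⟩
  have hX : ¬ (X 0 : MvPolynomial (Fin 2) ℂ) ∣ X 1 := by
    rintro ⟨q, hq⟩
    have := congrArg (eval ![0, 1]) hq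
    simp at this
  obtain ⟨k, rfl⟩ := ((X_prime (R := ℂ) (i := (0 : Fin 2))).dvd_or_dvd h1).resolve_left hX
  refine ⟨k, rfl, mul_left_cancel₀ (X_ne_zero (0 : Fin 2)) ?_⟩
  linear_combination h

/-- The field is `H` times the radial field plus terms `b'`, `c'` of order `N - 1`. Lines through
the origin have no curvature, so the radial part contributes only `(X 0 * b + X 1 * c)` times the
derivative of `H`. -/
theorem planeInflection_mem_of_order_two {N : ℕ} (hb : b ∈ 𝔪 ^ 2) (hc : c ∈ 𝔪 ^ 2) (hN : 3 ≤ N)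
    (h : X 0 * b + X 1 * c ∈ 𝔪 ^ N) : planeInflection b c ∈ 𝔪 ^ (N + 2) := by
  obtain ⟨t, rfl⟩ : ∃ t, N = t + 3 := ⟨N - 3, by omega⟩
  obtain ⟨b', hb', c', hc', heq⟩ := exists_of_mem_originIdeal_pow_succ h
  obtain ⟨H, hcH, hbH⟩ := X_zero_dvd_of_mul_X_one (f := b - b') (g := c - c')
    (by linear_combination heq)
  have hle : 𝔪 ^ (t + 2) ≤ 𝔪 ^ 2 := Ideal.pow_le_pow_right (by omega)
  have hH : H ∈ 𝔪 ^ 1 := mem_pow_of_X_mul_mem_pow_succ 0 (hcH ▸ sub_mem hc (hle hc'))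
  have hDb : planeField b c b' ∈ 𝔪 ^ (t + 1 + 2) := planeField_mem hb hc hb'
  have hDc : planeField b c c' ∈ 𝔪 ^ (t + 1 + 2) := planeField_mem hb hc hc'
  have hDH : planeField b c H ∈ 𝔪 ^ (0 + 2) := planeField_mem hb hc hH
  have e1 : planeField b c b = planeField b c b' + b * H - X 1 * planeField b c H := by
    have : b = b' - X 1 * H := by linear_combination hbH
    conv_lhs => rw [show planeField b c b = planeField b c (b' - X 1 * H) by rw [← this]]
    rw [map_sub, Derivation.leibniz, planeField_X_one]
    simp only [smul_eq_mul]
    ring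
  have e2 : planeField b c c = planeField b c c' + c * H + X 0 * planeField b c H := by
    have : c = c' + X 0 * H := by linear_combination hcH
    conv_lhs => rw [show planeField b c c = planeField b c (c' + X 0 * H) by rw [← this]]
    rw [map_add, Derivation.leibniz, planeField_X_zero]
    simp only [smul_eq_mul]
    ring
  have e3 : planeInflection b c = c * planeField b c b' - b * planeField b c c'
      - (X 0 * b + X 1 * c) * planeField b c H := by
    rw [planeInflection, e1, e2]
    ring
  rw [e3]
  have h1 := mul_mem_pow_add hc hDb
  have h2 := mul_mem_pow_add hb hDc
  have h3 := mul_mem_pow_add h hDH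
  rw [show t + 3 + 2 = 2 + (t + 1 + 2) by omega]
  refine sub_mem (sub_mem h1 h2) ?_
  rwa [show 2 + (t + 1 + 2) = t + 3 + (0 + 2) by omega]

/-- If the linear part of the field is degenerate, the curvature has order at least three. -/
theorem planeInflection_mem_of_degenerate (hb : b ∈ 𝔪) (hc : c ∈ 𝔪)
    (h : eval 0 (pderiv 0 b) * eval 0 (pderiv 1 c)
      - eval 0 (pderiv 1 b) * eval 0 (pderiv 0 c) = 0) : planeInflection b c ∈ 𝔪 ^ 3 := by
  rw [originIdeal_eq_span, Ideal.mem_span_pair] at hb hc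
  obtain ⟨b₀, b₁, hb⟩ := hb
  obtain ⟨c₀, c₁, hc⟩ := hc
  have hdet : b₀ * c₁ - b₁ * c₀ ∈ 𝔪 := by
    rw [mem_originIdeal_iff]
    rw [← hb, ← hc] at h
    simpa [pderiv_mul, pderiv_X] using h
  have hX : ∀ i : Fin 2, (X i : MvPolynomial (Fin 2) ℂ) ∈ 𝔪 ^ 1 := fun i => by
    rw [pow_one]; exact X_mem_originIdeal i
  have hb1 : b ∈ 𝔪 ^ 1 := by
    rw [← hb]
    exact add_mem (Ideal.mul_mem_left _ _ (hX 0)) (Ideal.mul_mem_left _ _ (hX 1))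
  have hc1 : c ∈ 𝔪 ^ 1 := by
    rw [← hc]
    exact add_mem (Ideal.mul_mem_left _ _ (hX 0)) (Ideal.mul_mem_left _ _ (hX 1))
  have hD : ∀ f, planeField b c f ∈ 𝔪 ^ 1 := fun f =>
    sub_mem (Ideal.mul_mem_right _ _ hc1) (Ideal.mul_mem_right _ _ hb1)
  have e1 : planeField b c b = b₀ * c - b₁ * b + (X 0 * planeField b c b₀
      + X 1 * planeField b c b₁) := by
    conv_lhs => rw [show planeField b c b = planeField b c (b₀ * X 0 + b₁ * X 1) by rw [hb]]
    rw [map_add, Derivation.leibniz, Derivation.leibniz, planeField_X_zero, planeField_X_one]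
    simp only [smul_eq_mul]
    ring
  have e2 : planeField b c c = c₀ * c - c₁ * b + (X 0 * planeField b c c₀
      + X 1 * planeField b c c₁) := by
    conv_lhs => rw [show planeField b c c = planeField b c (c₀ * X 0 + c₁ * X 1) by rw [hc]]
    rw [map_add, Derivation.leibniz, Derivation.leibniz, planeField_X_zero, planeField_X_one]
    simp only [smul_eq_mul]
    ring
  have hq : ∀ f g, X 0 * planeField b c f + X 1 * planeField b c g ∈ 𝔪 ^ 2 := fun f g =>
    add_mem (mul_mem_pow_add (k := 1) (l := 1) (hX 0) (hD f))
      (mul_mem_pow_add (k := 1) (l := 1) (hX 1) (hD g))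
  -- Inserting `b = b₀ u + b₁ v` and `c = c₀ u + c₁ v` into `b₀ c² - (b₁ + c₀) b c + c₁ b²` factors
  -- out the determinant of the linear part, which vanishes at the origin.
  have e3 : planeInflection b c = (b₀ * c₁ - b₁ * c₀) * (b * X 0 + c * X 1)
      + (c * (X 0 * planeField b c b₀ + X 1 * planeField b c b₁)
      - b * (X 0 * planeField b c c₀ + X 1 * planeField b c c₁)) := by
    rw [planeInflection, e1, e2]
    linear_combination (c * c₀ - b * c₁) * hb + (b * b₁ - c * b₀) * hc
  rw [e3]
  refine add_mem ?_ (sub_mem (mul_mem_pow_add (k := 1) (l := 2) hc1 (hq _ _))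
    (mul_mem_pow_add (k := 1) (l := 2) hb1 (hq _ _)))
  rw [← pow_one 𝔪] at hdet
  exact mul_mem_pow_add (k := 1) (l := 2) hdet
    (add_mem (mul_mem_pow_add (k := 1) (l := 1) hb1 (hX 0))
      (mul_mem_pow_add (k := 1) (l := 1) hc1 (hX 1)))

/-! ### Comparison of the chart curvature with the inflection polynomial; orders of products of
lines. -/

theorem basis_det_ne_zero (b : Module.Basis (Fin 3) ℂ (Fin 3 → ℂ)) :
    Matrix.det (Matrix.of ![b 0, b 1, b 2]) ≠ 0 := by
  have h : Matrix.of ![b 0, b 1, b 2] = Matrix.of (fun i => b i) := by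
    ext i j
    fin_cases i <;> rfl
  rw [h]
  have := (Matrix.linearIndependent_rows_iff_isUnit (A := Matrix.of (fun i => b i))).1
    b.linearIndependent
  rw [Matrix.isUnit_iff_isUnit_det] at this
  exact this.ne_zero

theorem chartPoint_ne_zero (b : Module.Basis (Fin 3) ℂ (Fin 3 → ℂ)) (w : Fin 2 → ℂ) :
    chartPoint b w ≠ 0 := by
  intro h
  have h1 := congrArg (fun x => b.repr x 0) h
  simp [chartPoint] at h1

/-- The lift of the chart field to `ℂ³` and the curl field have proportional cross products with the
point, so they are proportional modulo the point. -/
theorem cross_chartField {d : ℕ} (F : Foliation d) (b : Module.Basis (Fin 3) ℂ (Fin 3 → ℂ))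
    (w : Fin 2 → ℂ) :
    crossProduct (chartPoint b w) (F.form.evalAt (chartPoint b w) (b 2) • b 1
      - F.form.evalAt (chartPoint b w) (b 1) • b 2) =
    Matrix.det (Matrix.of ![b 0, b 1, b 2]) • fun i => eval (chartPoint b w) (F.form i) := by
  have h := F.evalAt_self (chartPoint b w)
  conv at h => lhs; arg 3; rw [chartPoint]
  rw [OneForm.evalAt_add, OneForm.evalAt_add, OneForm.evalAt_smul, OneForm.evalAt_smul] at h
  obtain ⟨f, hf⟩ : ∃ f : Fin 3 → ℂ, ∀ i, eval (chartPoint b w) (F.form i) = f i :=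
    ⟨_, fun _ => rfl⟩
  simp only [OneForm.evalAt, Fin.sum_univ_three, hf] at h ⊢
  rw [cross_apply, Matrix.det_fin_three]
  ext i
  fin_cases i
  · simp [chartPoint]
    linear_combination - (b 1 1 * b 2 2 - b 1 2 * b 2 1) * h
  · simp [chartPoint]
    linear_combination - (b 1 2 * b 2 0 - b 1 0 * b 2 2) * h
  · simp [chartPoint]
    linear_combination - (b 1 0 * b 2 1 - b 1 1 * b 2 0) * h

/-- The curvature is `polar` evaluated twice on the lifted chart field. That field is a multiple of
the curl field up to the radial direction, which `polar_combination` discards. -/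
theorem Foliation.eval_planeInflection {d : ℕ} (F : Foliation d)
    (b : Module.Basis (Fin 3) ℂ (Fin 3 → ℂ)) (w : Fin 2 → ℂ) :
    eval w (planeInflection (F.localCoeff b 1) (F.localCoeff b 2)) =
      (Matrix.det (Matrix.of ![b 0, b 1, b 2]) / (d + 2)) ^ 2 *
        eval (chartPoint b w) F.inflection := by
  have h1 : eval w (planeInflection (F.localCoeff b 1) (F.localCoeff b 2)) =
      F.form.polar (chartPoint b w) (F.form.evalAt (chartPoint b w) (b 2) • b 1
      + (- F.form.evalAt (chartPoint b w) (b 1)) • b 2)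
      (F.form.evalAt (chartPoint b w) (b 2) • b 1
      + (- F.form.evalAt (chartPoint b w) (b 1)) • b 2) := by
    simp only [planeInflection, planeField_apply, map_sub, map_mul, F.eval_localCoeff,
      F.eval_pderiv_localCoeff, OneForm.polar_add_left, OneForm.polar_add_right,
      OneForm.polar_smul_left, OneForm.polar_smul_right]
    simp only [Fin.succ_zero_eq_one, Fin.succ_one_eq_two]
    ring
  have h2 := cross_chartField F b w
  obtain ⟨r, hr⟩ := exists_smul_of_cross_eq_zero (chartPoint_ne_zero b w)
    (y := F.form.evalAt (chartPoint b w) (b 2) • b 1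
      - F.form.evalAt (chartPoint b w) (b 1) • b 2
      + (Matrix.det (Matrix.of ![b 0, b 1, b 2]) / (d + 2)) • F.fieldAt (chartPoint b w)) (by
    rw [map_add, h2, map_smul, F.cross_fieldAt]
    ext i
    simp only [Pi.add_apply, Pi.smul_apply, smul_eq_mul, Pi.zero_apply]
    field_simp [Foliation.two_add_ne_zero (d := d)]
    ring)
  have h3 : F.form.evalAt (chartPoint b w) (b 2) • b 1
      + (- F.form.evalAt (chartPoint b w) (b 1)) • b 2 = r • chartPoint b w
      + (- (Matrix.det (Matrix.of ![b 0, b 1, b 2]) / (d + 2))) • F.fieldAt (chartPoint b w) := by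
    rw [← hr]
    module
  have h4 : F.form.evalAt (chartPoint b w) (F.fieldAt (chartPoint b w)) = 0 := by
    have := congrArg (eval (chartPoint b w)) F.sum_form_mul_vectorField
    simpa [OneForm.evalAt, Foliation.fieldAt] using this
  rw [h1, h3, F.polar_combination h4, F.eval_inflection]
  ring

/-- The polynomial `q ↦ ω_q(v)`. -/
def OneForm.contraction (ω : OneForm) (v : Fin 3 → ℂ) : MvPolynomial (Fin 3) ℂ :=
  ∑ i, C (v i) * ω i

theorem OneForm.eval_contraction (ω : OneForm) (v p : Fin 3 → ℂ) :
    eval p (ω.contraction v) = ω.evalAt p v := by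
  simp [contraction, evalAt, mul_comm]

theorem Foliation.contraction_isHomogeneous {d : ℕ} (F : Foliation d) (v : Fin 3 → ℂ) :
    (F.form.contraction v).IsHomogeneous (d + 1) :=
  IsHomogeneous.sum _ _ _ fun i _ => (F.homogeneous i).C_mul _

/-- Restriction of polynomials to an affine chart. -/
def chartHom (b : Module.Basis (Fin 3) ℂ (Fin 3 → ℂ)) :
    MvPolynomial (Fin 3) ℂ →ₐ[ℂ] MvPolynomial (Fin 2) ℂ :=
  aeval fun k => C (b 0 k) + C (b 1 k) * X 0 + C (b 2 k) * X 1

theorem eval_chartHom (b : Module.Basis (Fin 3) ℂ (Fin 3 → ℂ)) (w : Fin 2 → ℂ)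
    (f : MvPolynomial (Fin 3) ℂ) : eval w (chartHom b f) = eval (chartPoint b w) f := by
  rw [chartHom, ← aeval_eq_eval, ← aeval_eq_eval, ← AlgHom.comp_apply]
  congr 1
  ext k
  simp [chartPoint, mul_comm]

theorem Foliation.localCoeff_eq_chartHom {d : ℕ} (F : Foliation d)
    (b : Module.Basis (Fin 3) ℂ (Fin 3 → ℂ)) (i : Fin 3) :
    F.localCoeff b i = chartHom b (F.form.contraction (b i)) :=
  MvPolynomial.funext fun w => by
    rw [eval_chartHom, F.eval_localCoeff, OneForm.eval_contraction]

theorem chartHom_linForm (b : Module.Basis (Fin 3) ℂ (Fin 3 → ℂ)) (n : Fin 3 → ℂ) :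
    chartHom b (linForm n) = C (n ⬝ᵥ b 0) + C (n ⬝ᵥ b 1) * X 0 + C (n ⬝ᵥ b 2) * X 1 :=
  MvPolynomial.funext fun w => by
    rw [eval_chartHom, eval_linForm, chartPoint]
    simp [dotProduct_add]
    ring

theorem chartHom_prod_mem {S : Finset (Submodule ℂ (Fin 3 → ℂ))} (hS : ∀ ℓ ∈ S, IsLine ℓ)
    (b : Module.Basis (Fin 3) ℂ (Fin 3 → ℂ)) (hb : ∀ ℓ ∈ S, b 0 ∈ ℓ) :
    chartHom b (∏ ℓ ∈ S, linForm (normal ℓ)) ∈ 𝔪 ^ S.card := by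
  rw [map_prod, ← Finset.prod_const]
  refine Ideal.prod_mem_prod fun ℓ hℓ => ?_
  rw [chartHom_linForm, ((hS ℓ hℓ).mem_iff _).1 (hb ℓ hℓ), map_zero, zero_add]
  exact add_mem (Ideal.mul_mem_left _ _ (X_mem_originIdeal 0))
    (Ideal.mul_mem_left _ _ (X_mem_originIdeal 1))

/-- The restriction of polynomials in two variables to a line through the origin. -/
def restrictToDirection (c : Fin 2 → ℂ) : MvPolynomial (Fin 2) ℂ →ₐ[ℂ] Polynomial ℂ :=
  aeval fun i => Polynomial.C (c i) * Polynomial.X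

theorem X_pow_dvd_restrictToDirection (c : Fin 2 → ℂ) {N : ℕ} {f : MvPolynomial (Fin 2) ℂ}
    (hf : f ∈ 𝔪 ^ N) : Polynomial.X ^ N ∣ restrictToDirection c f := by
  have hle : Ideal.map (restrictToDirection c) 𝔪 ≤ Ideal.span {Polynomial.X} := by
    rw [Ideal.map_le_iff_le_comap, originIdeal, idealOfVars, Ideal.span_le]
    rintro _ ⟨i, rfl⟩
    simp only [SetLike.mem_coe, Ideal.mem_comap, Ideal.mem_span_singleton, restrictToDirection,
      aeval_X]
    exact dvd_mul_left _ _
  rw [← Ideal.mem_span_singleton, ← Ideal.span_singleton_pow]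
  refine Ideal.pow_right_mono hle _ ?_
  rw [← Ideal.map_pow]
  exact Ideal.mem_map_of_mem _ hf

theorem eval_restrictToDirection (c : Fin 2 → ℂ) (f : MvPolynomial (Fin 2) ℂ) (t : ℂ) :
    (restrictToDirection c f).eval t = eval (t • c) f := by
  rw [restrictToDirection, ← Polynomial.coe_aeval_eq_eval, ← aeval_eq_eval, ← AlgHom.comp_apply]
  congr 1
  ext i
  rw [AlgHom.comp_apply, aeval_X, aeval_X, map_mul, Polynomial.aeval_C, Polynomial.aeval_X,
    mul_comm]
  rfl

open Classical in
/-- The order at a point of a product of equations of lines is at most the number of lines through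
this point. -/
theorem chartHom_prod_notMem {S : Finset (Submodule ℂ (Fin 3 → ℂ))} (hS : ∀ ℓ ∈ S, IsLine ℓ)
    (b : Module.Basis (Fin 3) ℂ (Fin 3 → ℂ)) :
    chartHom b (∏ ℓ ∈ S, linForm (normal ℓ)) ∉ 𝔪 ^ ((S.filter (b 0 ∈ ·)).card + 1) := by
  intro hmem
  have hne : ∏ ℓ ∈ S.filter (b 0 ∈ ·), linForm (normal ℓ) ≠ 0 :=
    Finset.prod_ne_zero_iff.2 fun ℓ hℓ =>
      linForm_ne_zero (hS ℓ (Finset.mem_filter.1 hℓ).1).normal_ne_zero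
  -- Restrict to a direction `q` outside all the lines through `b 0`: each of these lines then
  -- contributes a non-zero multiple of the parameter, and each remaining line a factor with
  -- non-zero constant term.
  obtain ⟨q, hq⟩ : ∃ q, eval q (∏ ℓ ∈ S.filter (b 0 ∈ ·), linForm (normal ℓ)) ≠ 0 := by
    by_contra! h
    exact hne (MvPolynomial.funext fun q => by rw [h q, map_zero])
  rw [map_prod, Finset.prod_ne_zero_iff] at hq
  set φ := restrictToDirection fun i => b.repr q i.succ with hφ
  have hdvd := X_pow_dvd_restrictToDirection (fun i => b.repr q i.succ) hmem
  rw [← hφ] at hdvd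
  have hlin : ∀ n, φ (chartHom b (linForm n)) = Polynomial.C (n ⬝ᵥ b 0) +
      Polynomial.C (b.repr q 1 * (n ⬝ᵥ b 1) + b.repr q 2 * (n ⬝ᵥ b 2)) * Polynomial.X := by
    intro n
    rw [chartHom_linForm]
    simp [hφ, restrictToDirection, ← algebraMap_eq]
    ring
  have hq' : ∀ n, n ⬝ᵥ b 0 = 0 →
      n ⬝ᵥ q = b.repr q 1 * (n ⬝ᵥ b 1) + b.repr q 2 * (n ⬝ᵥ b 2) := by
    intro n hn
    have h := congrArg (n ⬝ᵥ ·) (b.sum_repr q)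
    simp only [Fin.sum_univ_three, dotProduct_add, dotProduct_smul, hn, smul_eq_mul] at h
    rw [← h]
    ring
  rw [← Finset.prod_filter_mul_prod_filter_not S (b 0 ∈ ·), map_mul, map_mul, map_prod, map_prod,
    Finset.prod_congr rfl (g := fun ℓ => Polynomial.C (normal ℓ ⬝ᵥ q) * Polynomial.X),
    Finset.prod_mul_distrib, Finset.prod_const, pow_succ] at hdvd
  · rw [mul_comm (∏ _ ∈ _, _) (_ ^ _), mul_assoc,
      mul_dvd_mul_iff_left (pow_ne_zero _ Polynomial.X_ne_zero), Polynomial.X_dvd_iff,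
      Polynomial.mul_coeff_zero, mul_eq_zero] at hdvd
    rcases hdvd with h | h
    · rw [← map_prod, Polynomial.coeff_C_zero, Finset.prod_eq_zero_iff] at h
      obtain ⟨ℓ, hℓ, h⟩ := h
      exact hq ℓ hℓ (by rw [eval_linForm, h])
    · rw [map_prod, map_prod, Polynomial.coeff_zero_eq_eval_zero, Polynomial.eval_prod,
        Finset.prod_eq_zero_iff] at h
      obtain ⟨ℓ, hℓ, h⟩ := h
      rw [Finset.mem_filter] at hℓ
      refine hℓ.2 (((hS ℓ hℓ.1).mem_iff _).2 ?_)
      simpa [hlin] using h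
  · intro ℓ hℓ
    rw [Finset.mem_filter] at hℓ
    have h0 := ((hS ℓ hℓ.1).mem_iff _).1 hℓ.2
    rw [hlin, h0, hq' _ h0]
    simp

theorem IsLine.exists_cross_ne_zero {ℓ : Submodule ℂ (Fin 3 → ℂ)} (hℓ : IsLine ℓ) (x : Fin 3 → ℂ)
    (hx : x ≠ 0) : ∃ v ∈ ℓ, crossProduct x v ≠ 0 := by
  by_contra! h
  have hle : ℓ ≤ Submodule.span ℂ {x} := by
    intro v hv
    obtain ⟨r, rfl⟩ := exists_smul_of_cross_eq_zero hx (h v hv)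
    exact Submodule.smul_mem _ _ (Submodule.mem_span_singleton_self x)
  have h1 := Submodule.finrank_mono hle
  rw [finrank_span_singleton hx, hℓ] at h1
  omega

theorem exists_eval_ne_zero {σ : Type*} {f : MvPolynomial σ ℂ} (hf : f ≠ 0) :
    ∃ p, eval p f ≠ 0 := by
  by_contra! h
  exact hf (MvPolynomial.funext fun q => by rw [h q, map_zero])

/-! ### The arrangement of invariant lines and the singular points of a reduced convex foliation. -/

namespace Foliation

variable {d : ℕ} (F : Foliation d)

variable {F} in
theorem polar_eq_zero_of_mem {ℓ : Submodule ℂ (Fin 3 → ℂ)} (hℓ : ℓ ∈ F.invariantLines)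
    {p x y : Fin 3 → ℂ} (hp : p ∈ ℓ) (hx : x ∈ ℓ) (hy : y ∈ ℓ) : F.form.polar p x y = 0 :=
  OneForm.polar_eq_zero_of_evalAt _ _ _ _ fun _ =>
    hℓ.2 _ (add_mem hp (Submodule.smul_mem _ _ hx)) _ hy

/-- An invariant line is its own tangent at each of its points. The bound on `d` serves only at the
origin of `ℂ³`, where a form of degree `3d` must vanish. -/
theorem eval_inflection_of_mem (hd : 1 ≤ d) {ℓ : Submodule ℂ (Fin 3 → ℂ)}
    (hℓ : ℓ ∈ F.invariantLines) {p : Fin 3 → ℂ} (hp : p ∈ ℓ) : eval p F.inflection = 0 := by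
  by_cases h0 : p = 0
  · have h := eval_smul_of_isHomogeneous F.inflection_isHomogeneous 0 p
    rw [zero_smul, zero_pow (by omega), zero_mul] at h
    rwa [h0]
  · obtain ⟨v, hv, hpv⟩ := hℓ.1.exists_cross_ne_zero p h0
    exact F.eval_inflection_eq_zero hpv (hℓ.2 p hp v hv) (polar_eq_zero_of_mem hℓ hp hv hv)

theorem exists_form_ne_zero : ∃ i, F.form i ≠ 0 := by
  by_contra! h
  exact not_isUnit_zero (F.coprime 0 fun i => by rw [h i])

/-- `S` is the set of the invariant lines of `F`; there are `3 d` of them and the product of their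
equations is the equation of the inflection points. -/
structure IsArrangement (S : Finset (Submodule ℂ (Fin 3 → ℂ))) (k : ℂ) : Prop where
  mem_iff : ∀ ℓ, ℓ ∈ S ↔ ℓ ∈ F.invariantLines
  card : S.card = 3 * d
  ne_zero : k ≠ 0
  inflection_eq : F.inflection = C k * ∏ ℓ ∈ S, linForm (normal ℓ)

variable {F}

/-- Otherwise every non-singular point would be an inflection point, and convexity would put it on
one of finitely many lines. -/
theorem IsReducedConvex.inflection_ne_zero (hF : F.IsReducedConvex)
    {S : Finset (Submodule ℂ (Fin 3 → ℂ))} (hS : ∀ ℓ, ℓ ∈ S ↔ ℓ ∈ F.invariantLines) :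
    F.inflection ≠ 0 := by
  intro h0
  obtain ⟨i, hi⟩ := F.exists_form_ne_zero
  have hprod : ∏ ℓ ∈ S, linForm (normal ℓ) ≠ 0 :=
    Finset.prod_ne_zero_iff.2 fun ℓ hℓ => linForm_ne_zero ((hS ℓ).1 hℓ).1.normal_ne_zero
  obtain ⟨p, hp⟩ := exists_eval_ne_zero (mul_ne_zero hi hprod)
  rw [map_mul, map_prod] at hp
  obtain ⟨ℓ, hℓ, hpℓ⟩ := hF.1 p ⟨i, left_ne_zero_of_mul hp⟩
    ((F.isInflectionAt_iff p).2 (by rw [h0, map_zero]))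
  refine Finset.prod_ne_zero_iff.1 (right_ne_zero_of_mul hp) ℓ ((hS ℓ).2 hℓ) ?_
  rw [eval_linForm]
  exact (hℓ.1.mem_iff p).1 hpℓ

theorem isHomogeneous_prod_linForm (S : Finset (Submodule ℂ (Fin 3 → ℂ))) :
    (∏ ℓ ∈ S, linForm (normal ℓ)).IsHomogeneous S.card := by
  simpa using IsHomogeneous.prod S (fun ℓ => linForm (normal ℓ)) (fun _ => 1)
    fun ℓ _ => linForm_isHomogeneous (normal ℓ)

/-- A homogeneous polynomial divisible by another one of the same degree is a multiple of it. -/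
theorem exists_eq_C_mul {f g : MvPolynomial (Fin 3) ℂ} {n : ℕ} (hf : f.IsHomogeneous n)
    (hg : g.IsHomogeneous n) (hf0 : f ≠ 0) (h : g ∣ f) : ∃ k : ℂ, k ≠ 0 ∧ f = C k * g := by
  obtain ⟨q, rfl⟩ := h
  have h1 := left_ne_zero_of_mul hf0
  have h2 := right_ne_zero_of_mul hf0
  have h3 := totalDegree_mul_of_isDomain h1 h2
  rw [hf.totalDegree hf0, hg.totalDegree h1] at h3
  have h4 : q.totalDegree = 0 := by omega
  rw [totalDegree_eq_zero_iff_eq_C] at h4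
  refine ⟨coeff 0 q, fun hc => h2 ?_, by rw [mul_comm g, ← h4]⟩
  rw [h4, hc, map_zero]

/-- The product of the `3d` equations divides the inflection polynomial, which is non-zero of the
same degree. -/
theorem IsReducedConvex.exists_isArrangement (hF : F.IsReducedConvex) (hd : 1 ≤ d) :
    ∃ S k, F.IsArrangement S k := by
  have hfin : F.invariantLines.Finite := by
    rw [← Set.encard_ne_top_iff, hF.2]
    exact ENat.natCast_ne_top (3 * d)
  have hS : ∀ ℓ, ℓ ∈ hfin.toFinset ↔ ℓ ∈ F.invariantLines := fun ℓ => hfin.mem_toFinset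
  have hcard : hfin.toFinset.card = 3 * d := by
    have := hF.2
    rw [hfin.encard_eq_coe_toFinset_card] at this
    exact_mod_cast this
  have hhom := isHomogeneous_prod_linForm hfin.toFinset
  rw [hcard] at hhom
  obtain ⟨k, hk, h⟩ := exists_eq_C_mul F.inflection_isHomogeneous hhom
    (hF.inflection_ne_zero hS) (prod_linForm_dvd (fun ℓ hℓ => ((hS ℓ).1 hℓ).1)
      fun ℓ hℓ p hp => F.eval_inflection_of_mem hd ((hS ℓ).1 hℓ) hp)
  exact ⟨_, k, hS, hcard, hk, h⟩

open Classical in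
/-- The number of lines of `S` through `p`. -/
def multiplicity (S : Finset (Submodule ℂ (Fin 3 → ℂ))) (p : Fin 3 → ℂ) : ℕ :=
  (S.filter (p ∈ ·)).card

variable {S : Finset (Submodule ℂ (Fin 3 → ℂ))} {k : ℂ}

namespace IsArrangement

variable (hS : F.IsArrangement S k)
include hS

/-- Up to a non-zero constant the curvature is the product of the equations of the lines, and those
that miss `b 0` are units there. -/
theorem planeInflection_notMem (b : Module.Basis (Fin 3) ℂ (Fin 3 → ℂ)) :
    planeInflection (F.localCoeff b 1) (F.localCoeff b 2) ∉ 𝔪 ^ (multiplicity S (b 0) + 1) := by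
  have h : planeInflection (F.localCoeff b 1) (F.localCoeff b 2) =
      C ((Matrix.det (Matrix.of ![b 0, b 1, b 2]) / (d + 2)) ^ 2 * k) *
        chartHom b (∏ ℓ ∈ S, linForm (normal ℓ)) := by
    refine MvPolynomial.funext fun w => ?_
    rw [F.eval_planeInflection, hS.inflection_eq, map_mul, map_mul, eval_chartHom, eval_C, eval_C]
    ring
  rw [h]
  intro hmem
  have hu : ((Matrix.det (Matrix.of ![b 0, b 1, b 2]) / ((d : ℂ) + 2)) ^ 2 * k) ≠ 0 :=
    mul_ne_zero (pow_ne_zero _ (div_ne_zero (basis_det_ne_zero b) two_add_ne_zero)) hS.ne_zero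
  refine chartHom_prod_notMem (fun ℓ hℓ => ((hS.mem_iff ℓ).1 hℓ).1) b ?_
  have := Ideal.mul_mem_left _ (C ((Matrix.det (Matrix.of ![b 0, b 1, b 2]) / (d + 2)) ^ 2 * k)⁻¹)
    hmem
  rw [← mul_assoc, ← C_mul, inv_mul_cancel₀ hu, C_1, one_mul] at this
  exact this

-- At a point of an invariant line through `p`, the vector `p` is tangent to this line.
open Classical in
theorem prod_dvd_contraction (p : Fin 3 → ℂ) :
    ∏ ℓ ∈ S.filter (p ∈ ·), linForm (normal ℓ) ∣ F.form.contraction p := by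
  refine prod_linForm_dvd (fun ℓ hℓ => ((hS.mem_iff ℓ).1 (Finset.mem_filter.1 hℓ).1).1) ?_
  intro ℓ hℓ q hq
  rw [Finset.mem_filter] at hℓ
  rw [OneForm.eval_contraction]
  exact ((hS.mem_iff ℓ).1 hℓ.1).2 q hq p hℓ.2

theorem localCoeff_zero_mem (b : Module.Basis (Fin 3) ℂ (Fin 3 → ℂ)) :
    F.localCoeff b 0 ∈ 𝔪 ^ multiplicity S (b 0) := by
  classical
  rw [F.localCoeff_eq_chartHom]
  obtain ⟨g, hg⟩ := hS.prod_dvd_contraction (b 0)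
  rw [hg, map_mul]
  exact Ideal.mul_mem_right _ _ (chartHom_prod_mem
    (fun ℓ hℓ => ((hS.mem_iff ℓ).1 (Finset.mem_filter.1 hℓ).1).1) b
    fun ℓ hℓ => (Finset.mem_filter.1 hℓ).2)

/-- Otherwise the foliation would be the pencil of lines through `p`, all of whose points are
inflection points or singular, and the inflection polynomial would vanish. -/
theorem contraction_ne_zero {p : Fin 3 → ℂ} (hp : p ≠ 0) : F.form.contraction p ≠ 0 := by
  intro h0
  have hev : ∀ x, F.form.evalAt x p = 0 := fun x => by
    rw [← OneForm.eval_contraction, h0, map_zero]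
  have hI : F.inflection ≠ 0 := by
    rw [hS.inflection_eq]
    refine mul_ne_zero (by simpa using hS.ne_zero) (Finset.prod_ne_zero_iff.2 fun ℓ hℓ =>
      linForm_ne_zero ((hS.mem_iff ℓ).1 hℓ).1.normal_ne_zero)
  -- The linear form of `n` vanishes at `p`; a point where it does not is independent of `p`.
  obtain ⟨n, hn, hnp⟩ : ∃ n : Fin 3 → ℂ, n ≠ 0 ∧ n ⬝ᵥ p = 0 := by
    have : Nontrivial (Fin 3) := inferInstance
    by_contra! h
    have h1 := h ![p 1, - p 0, 0]
    have h2 := h ![p 2, 0, - p 0]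
    have h3 := h ![0, p 2, - p 1]
    simp [dotProduct, Fin.sum_univ_three] at h1 h2 h3
    apply hp
    ext i
    fin_cases i
    · by_contra h4
      exact h1 (by intro _; exact h4) (by ring)
    · by_contra h4
      exact h1 (by intro h5; exact absurd h5 h4) (by ring)
    · by_contra h4
      exact h2 (by intro h5; exact absurd h5 h4) (by ring)
  obtain ⟨x, hx⟩ := exists_eval_ne_zero (mul_ne_zero hI (linForm_ne_zero hn))
  rw [map_mul] at hx
  refine left_ne_zero_of_mul hx (F.eval_inflection_eq_zero (v := p) ?_ (hev x)
    (OneForm.polar_eq_zero_of_evalAt _ _ _ _ fun t => hev _))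
  intro hc
  obtain ⟨r, rfl⟩ := exists_smul_of_cross_eq_zero hp (y := x)
    (by rw [← cross_anticomm, hc, neg_zero])
  refine right_ne_zero_of_mul hx ?_
  rw [eval_linForm, dotProduct_smul, hnp, smul_zero]

theorem multiplicity_le {p : Fin 3 → ℂ} (hp : p ≠ 0) : multiplicity S p ≤ d + 1 := by
  classical
  have h0 := hS.contraction_ne_zero hp
  obtain ⟨g, hg⟩ := hS.prod_dvd_contraction p
  have h1 := (F.contraction_isHomogeneous p).totalDegree h0
  rw [hg] at h0 h1
  rw [totalDegree_mul_of_isDomain (left_ne_zero_of_mul h0) (right_ne_zero_of_mul h0),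
    (isHomogeneous_prod_linForm _).totalDegree (left_ne_zero_of_mul h0)] at h1
  rw [multiplicity]
  omega

open Classical in
theorem contraction_eq {p : Fin 3 → ℂ} (hp : p ≠ 0) (hm : multiplicity S p = d + 1) :
    ∃ c : ℂ, F.form.contraction p = C c * ∏ ℓ ∈ S.filter (p ∈ ·), linForm (normal ℓ) := by
  have hh := isHomogeneous_prod_linForm (S.filter (p ∈ ·))
  rw [show (S.filter (p ∈ ·)).card = d + 1 from hm] at hh
  obtain ⟨c, -, hc⟩ := exists_eq_C_mul (F.contraction_isHomogeneous p) hh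
    (hS.contraction_ne_zero hp) (hS.prod_dvd_contraction p)
  exact ⟨c, hc⟩

/-- With `d + 1` lines through `p` there is no room for another factor: `x ↦ ω_x(p)` is a constant
times linear forms that vanish at `p`. This invariance is what radiality of maximal order amounts
to. -/
theorem evalAt_add_of_multiplicity_eq {p : Fin 3 → ℂ} (hp : p ≠ 0)
    (hm : multiplicity S p = d + 1) (x : Fin 3 → ℂ) (t : ℂ) :
    F.form.evalAt (x + t • p) p = F.form.evalAt x p := by
  classical
  obtain ⟨c, hc⟩ := hS.contraction_eq hp hm
  rw [← OneForm.eval_contraction, ← OneForm.eval_contraction, hc, map_mul, map_mul, map_prod,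
    map_prod, eval_C, eval_C]
  congr 1
  refine Finset.prod_congr rfl fun ℓ hℓ => ?_
  rw [Finset.mem_filter] at hℓ
  rw [eval_linForm, eval_linForm, dotProduct_add, dotProduct_smul,
    (((hS.mem_iff ℓ).1 hℓ.1).1.mem_iff p).1 hℓ.2]
  simp

/-- The local structure of a reduced convex foliation at a singular point. -/
theorem local_structure (b : Module.Basis (Fin 3) ℂ (Fin 3 → ℂ))
    (hsing : ∀ v, F.form.evalAt (b 0) v = 0) :
    2 ≤ multiplicity S (b 0) ∧
    F.form.polar (b 0) (b 1) (b 1) * F.form.polar (b 0) (b 2) (b 2)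
      - F.form.polar (b 0) (b 2) (b 1) * F.form.polar (b 0) (b 1) (b 2) ≠ 0 ∧
    (3 ≤ multiplicity S (b 0) → F.form.polar (b 0) (b 1) (b 1) = 0 ∧
      F.form.polar (b 0) (b 2) (b 2) = 0 ∧
      F.form.polar (b 0) (b 2) (b 1) = - F.form.polar (b 0) (b 1) (b 2)) := by
  have hJ := hS.planeInflection_notMem b
  have ha := hS.localCoeff_zero_mem b
  have hb1 : F.localCoeff b 1 ∈ 𝔪 := by
    rw [mem_originIdeal_iff, F.eval_localCoeff, chartPoint_zero, hsing]
  have hc1 : F.localCoeff b 2 ∈ 𝔪 := by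
    rw [mem_originIdeal_iff, F.eval_localCoeff, chartPoint_zero, hsing]
  have hu : X 0 * F.localCoeff b 1 + X 1 * F.localCoeff b 2 = - F.localCoeff b 0 := by
    linear_combination F.localCoeff_euler b
  have hP : ∀ i j, eval 0 (pderiv j (F.localCoeff b i)) = F.form.polar (b 0) (b j.succ) (b i) :=
    fun i j => by rw [F.eval_pderiv_localCoeff, chartPoint_zero]
  have hM2 : 2 ≤ multiplicity S (b 0) := by
    by_contra! h
    exact hJ (Ideal.pow_le_pow_right (by omega) (planeInflection_mem_sq hb1 hc1))
  -- A field of order at least two would have a curvature of order greater than the number of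
  -- invariant lines through the point.
  have hnot : ¬ (F.localCoeff b 1 ∈ 𝔪 ^ 2 ∧ F.localCoeff b 2 ∈ 𝔪 ^ 2) := by
    rintro ⟨h1, h2⟩
    -- The maximum with `3` covers a point on only two lines, where the bound comes from the order
    -- of the field itself.
    have h3 : X 0 * F.localCoeff b 1 + X 1 * F.localCoeff b 2 ∈
        𝔪 ^ (max (multiplicity S (b 0)) 3) := by
      rcases le_total 3 (multiplicity S (b 0)) with h | h
      · rw [max_eq_left h, hu]
        exact neg_mem ha
      · rw [max_eq_right h]
        have hX : ∀ i : Fin 2, (X i : MvPolynomial (Fin 2) ℂ) ∈ 𝔪 ^ 1 := fun i => by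
          rw [pow_one]; exact X_mem_originIdeal i
        exact add_mem (mul_mem_pow_add (k := 1) (l := 2) (hX 0) h1)
          (mul_mem_pow_add (k := 1) (l := 2) (hX 1) h2)
    refine hJ (Ideal.pow_le_pow_right ?_
      (planeInflection_mem_of_order_two h1 h2 (le_max_right _ _) h3))
    have := le_max_left (multiplicity S (b 0)) 3
    omega
  -- With three lines, `u b + v c` has order at least three. Its quadratic coefficients are
  -- combinations of the entries of the linear part, so this part is a multiple of the radial one.
  have h3 : 3 ≤ multiplicity S (b 0) → F.form.polar (b 0) (b 1) (b 1) = 0 ∧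
      F.form.polar (b 0) (b 2) (b 2) = 0 ∧
      F.form.polar (b 0) (b 2) (b 1) = - F.form.polar (b 0) (b 1) (b 2) := by
    intro hM
    have hmem : X 0 * F.localCoeff b 1 + X 1 * F.localCoeff b 2 ∈ 𝔪 ^ 3 := by
      rw [hu]
      exact neg_mem (Ideal.pow_le_pow_right hM ha)
    have hd2 : ∀ i j, eval 0 (pderiv i (pderiv j
        (X 0 * F.localCoeff b 1 + X 1 * F.localCoeff b 2))) = 0 := by
      intro i j
      rw [← mem_originIdeal_iff, ← pow_one 𝔪]
      exact pderiv_mem_pow (pderiv_mem_pow hmem j) i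
    have h00 := hd2 0 0
    have h01 := hd2 0 1
    have h11 := hd2 1 1
    simp only [map_add, pderiv_mul, pderiv_X_self, map_mul, eval_X, Pi.zero_apply, map_zero,
      pderiv_X_of_ne (show (0 : Fin 2) ≠ 1 by decide), pderiv_one, map_one,
      pderiv_X_of_ne (show (1 : Fin 2) ≠ 0 by decide), hP, Fin.succ_zero_eq_one,
      Fin.succ_one_eq_two] at h00 h01 h11
    refine ⟨?_, ?_, ?_⟩
    · linear_combination h00 / 2
    · linear_combination h11 / 2
    · linear_combination h01
  refine ⟨hM2, ?_, h3⟩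
  intro hdet
  -- With at least three lines a degenerate linear part, being scalar, is zero, which `hnot`
  -- excludes. With two lines it would give the curvature order three.
  rcases hM2.lt_or_eq with hM | hM
  · obtain ⟨e1, e2, e3⟩ := h3 hM
    rw [e1, e2, e3] at hdet
    have e4 : F.form.polar (b 0) (b 1) (b 2) = 0 := by
      have : F.form.polar (b 0) (b 1) (b 2) ^ 2 = 0 := by linear_combination hdet
      exact pow_eq_zero_iff (by norm_num) |>.1 this
    rw [e4, neg_zero] at e3
    rw [mem_originIdeal_iff] at hb1 hc1
    refine hnot ⟨mem_originIdeal_sq hb1 fun i => ?_, mem_originIdeal_sq hc1 fun i => ?_⟩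
    · rw [hP]
      fin_cases i
      · exact e1
      · exact e3
    · rw [hP]
      fin_cases i
      · exact e4
      · exact e2
  · rw [← hM] at hJ
    exact hJ (planeInflection_mem_of_degenerate hb1 hc1 (by simp only [hP]; exact hdet))

end IsArrangement

end Foliation

/-! ### Bases adapted to a line and incidence of lines. -/

theorem exists_basis_of_det_ne_zero {p n w : Fin 3 → ℂ}
    (h : Matrix.det (Matrix.of ![p, n, w]) ≠ 0) :
    ∃ b : Module.Basis (Fin 3) ℂ (Fin 3 → ℂ), b 0 = p ∧ b 1 = n ∧ b 2 = w := by
  have hli : LinearIndependent ℂ (Matrix.of ![p, n, w]).row :=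
    Matrix.linearIndependent_rows_iff_isUnit.2
      ((Matrix.isUnit_iff_isUnit_det _).2 (isUnit_iff_ne_zero.2 h))
  refine ⟨basisOfLinearIndependentOfCardEqFinrank hli (by simp), ?_, ?_, ?_⟩ <;>
  · rw [coe_basisOfLinearIndependentOfCardEqFinrank]
    rfl

theorem exists_basis_of_linearIndependent {p n w : Fin 3 → ℂ}
    (h : LinearIndependent ℂ ![p, n, w]) :
    ∃ b : Module.Basis (Fin 3) ℂ (Fin 3 → ℂ), b 0 = p ∧ b 1 = n ∧ b 2 = w := by
  refine ⟨basisOfLinearIndependentOfCardEqFinrank h (by simp), ?_, ?_, ?_⟩ <;>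
  · rw [coe_basisOfLinearIndependentOfCardEqFinrank]
    rfl

namespace IsLine

variable {ℓ ℓ' : Submodule ℂ (Fin 3 → ℂ)}

theorem exists_notMem (hℓ : IsLine ℓ) : ∃ n, n ∉ ℓ := by
  obtain ⟨e, he⟩ := exists_dotProduct_eq_one hℓ.normal_ne_zero
  exact ⟨e, fun h => by rw [hℓ.mem_iff, he] at h; exact one_ne_zero h⟩

theorem exists_basis (hℓ : IsLine ℓ) {p n w : Fin 3 → ℂ} (hp : p ∈ ℓ) (hw : w ∈ ℓ)
    (hpw : crossProduct p w ≠ 0) (hn : n ∉ ℓ) :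
    ∃ b : Module.Basis (Fin 3) ℂ (Fin 3 → ℂ), b 0 = p ∧ b 1 = n ∧ b 2 = w := by
  apply exists_basis_of_linearIndependent
  rw [crossProduct_ne_zero_iff_linearIndependent, LinearIndependent.pair_iff] at hpw
  rw [Fintype.linearIndependent_iff]
  intro g hg
  simp only [Fin.sum_univ_three, Matrix.cons_val_zero, Matrix.cons_val_one, Matrix.cons_val] at hg
  rw [hℓ.mem_iff] at hp hw hn
  have h1 : g 1 = 0 := by
    have := congrArg (normal ℓ ⬝ᵥ ·) hg
    simp only [dotProduct_add, dotProduct_smul, hp, hw, mul_zero, zero_add, add_zero,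
      dotProduct_zero, smul_eq_mul] at this
    exact (mul_eq_zero.1 this).resolve_right hn
  rw [h1, zero_smul, add_zero] at hg
  obtain ⟨h0, h2⟩ := hpw _ _ hg
  intro i
  fin_cases i
  · exact h0
  · exact h1
  · exact h2

theorem span_pair_eq (hℓ : IsLine ℓ) (b : Module.Basis (Fin 3) ℂ (Fin 3 → ℂ)) (h0 : b 0 ∈ ℓ)
    (h2 : b 2 ∈ ℓ) : Submodule.span ℂ {b 0, b 2} = ℓ := by
  apply Submodule.eq_of_le_of_finrank_eq
  · rw [Submodule.span_le]
    rintro x (rfl | rfl)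
    · exact h0
    · exact h2
  · have hli : LinearIndependent ℂ ![b 0, b 2] := by
      have := b.linearIndependent.comp ![0, 2] (by decide)
      convert this using 1
      ext i
      fin_cases i <;> rfl
    have := finrank_span_eq_card hli
    rw [Matrix.range_cons, Matrix.range_cons, Matrix.range_empty, Set.union_empty,
      Set.singleton_union] at this
    rw [this, hℓ]
    rfl

theorem exists_mem_inf (hℓ : IsLine ℓ) (hℓ' : IsLine ℓ') : ∃ p ≠ 0, p ∈ ℓ ∧ p ∈ ℓ' := by
  have h1 := Submodule.finrank_sup_add_finrank_inf_eq ℓ ℓ'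
  have h2 := Submodule.finrank_le (ℓ ⊔ ℓ')
  rw [hℓ, hℓ'] at h1
  simp only [Module.finrank_fintype_fun_eq_card, Fintype.card_fin] at h2
  have hne : ℓ ⊓ ℓ' ≠ ⊥ := by
    intro h
    rw [h, finrank_bot] at h1
    omega
  obtain ⟨p, hp, hp0⟩ := Submodule.exists_mem_ne_zero_of_ne_bot hne
  exact ⟨p, hp0, hp.1, hp.2⟩

theorem sup_eq_top (hℓ : IsLine ℓ) (hℓ' : IsLine ℓ') (hne : ℓ ≠ ℓ') : ℓ ⊔ ℓ' = ⊤ := by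
  have hlt : ℓ < ℓ ⊔ ℓ' := by
    refine lt_of_le_of_ne le_sup_left fun h => hne ?_
    exact (hℓ'.eq_of_le hℓ (by rw [h]; exact le_sup_right)).symm
  have h1 := Submodule.finrank_lt_finrank_of_lt hlt
  have h2 := Submodule.finrank_le (ℓ ⊔ ℓ')
  rw [hℓ] at h1
  apply Submodule.eq_top_of_finrank_eq
  simp only [Module.finrank_fintype_fun_eq_card, Fintype.card_fin] at h2 ⊢
  omega

theorem eq_of_cross_ne_zero (hℓ : IsLine ℓ) (hℓ' : IsLine ℓ') {p q : Fin 3 → ℂ} (hp : p ∈ ℓ)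
    (hq : q ∈ ℓ) (hp' : p ∈ ℓ') (hq' : q ∈ ℓ') (hpq : crossProduct p q ≠ 0) : ℓ = ℓ' := by
  obtain ⟨n, hn⟩ := hℓ.exists_notMem
  obtain ⟨b, rfl, -, rfl⟩ := hℓ.exists_basis hp hq hpq hn
  refine hℓ.eq_of_le hℓ' ?_
  rw [← hℓ.span_pair_eq b hp hq, Submodule.span_le]
  rintro x (rfl | rfl)
  · exact hp'
  · exact hq'

end IsLine

/-! ### Singular points and Camacho-Sad indices without charts. -/

namespace Foliation

variable {d : ℕ} (F : Foliation d)

/-- `p` is a representative of a singular point. -/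
def IsSingularAt (p : Fin 3 → ℂ) : Prop := ∀ v, F.form.evalAt p v = 0

/-- The chart-free form of the statement that the Camacho-Sad index at `p` is `lam`. -/
def CSIndex (ℓ : Submodule ℂ (Fin 3 → ℂ)) (p : Fin 3 → ℂ) (lam : ℂ) : Prop :=
  ∀ n, ∀ w ∈ ℓ, F.form.polar p n w = - lam * F.form.polar p w n

variable {F}

theorem isSingularAt_of_basis {b : Module.Basis (Fin 3) ℂ (Fin 3 → ℂ)}
    (h1 : F.form.evalAt (b 0) (b 1) = 0) (h2 : F.form.evalAt (b 0) (b 2) = 0) :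
    F.IsSingularAt (b 0) := by
  intro v
  rw [← b.sum_repr v, Fin.sum_univ_three]
  simp only [OneForm.evalAt_add, OneForm.evalAt_smul, h1, h2, F.evalAt_self]
  ring

theorem IsSingularAt.smul {p : Fin 3 → ℂ} (hp : F.IsSingularAt p) (r : ℂ) :
    F.IsSingularAt (r • p) := fun v => by
  rw [F.evalAt_smul_base, hp, mul_zero]

theorem IsSingularAt.polar_left {p : Fin 3 → ℂ} (hp : F.IsSingularAt p) (y : Fin 3 → ℂ) :
    F.form.polar p p y = 0 := by rw [F.polar_base_left, hp, mul_zero]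

theorem IsSingularAt.polar_right {p : Fin 3 → ℂ} (hp : F.IsSingularAt p) (x : Fin 3 → ℂ) :
    F.form.polar p x p = 0 := by rw [F.polar_base_right, hp, neg_zero]

/-- At a singular point the derivative of the form depends only on the directions modulo the
point. -/
theorem IsSingularAt.polar_basis {b : Module.Basis (Fin 3) ℂ (Fin 3 → ℂ)}
    (hp : F.IsSingularAt (b 0)) (x y : Fin 3 → ℂ) :
    F.form.polar (b 0) x y =
      b.repr x 1 * b.repr y 1 * F.form.polar (b 0) (b 1) (b 1) +
      b.repr x 1 * b.repr y 2 * F.form.polar (b 0) (b 1) (b 2) +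
      b.repr x 2 * b.repr y 1 * F.form.polar (b 0) (b 2) (b 1) +
      b.repr x 2 * b.repr y 2 * F.form.polar (b 0) (b 2) (b 2) := by
  conv_lhs => rw [← b.sum_repr x, ← b.sum_repr y]
  simp only [Fin.sum_univ_three, OneForm.polar_add_left, OneForm.polar_add_right,
    OneForm.polar_smul_left, OneForm.polar_smul_right, hp.polar_left, hp.polar_right]
  ring

variable {ℓ ℓ' : Submodule ℂ (Fin 3 → ℂ)}

theorem isSingularAt_of_mem_of_mem (hℓ : ℓ ∈ F.invariantLines) (hℓ' : ℓ' ∈ F.invariantLines)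
    (hne : ℓ ≠ ℓ') {p : Fin 3 → ℂ} (hp : p ∈ ℓ) (hp' : p ∈ ℓ') : F.IsSingularAt p := by
  intro v
  have hv : v ∈ ℓ ⊔ ℓ' := by rw [hℓ.1.sup_eq_top hℓ'.1 hne]; trivial
  obtain ⟨x, hx, y, hy, rfl⟩ := Submodule.mem_sup.1 hv
  rw [OneForm.evalAt_add, hℓ.2 p hp x hx, hℓ'.2 p hp' y hy, add_zero]

/-- In the chart field the transverse eigenvalue is `polar (b 0) (b 1) (b 2)` and the tangent one is
`- polar (b 0) (b 2) (b 1)`, whence the sign. The relation extends from the basis to all vectors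
because `polar` ignores `b 0` and vanishes on the line. -/
theorem csIndex_of_basis (hℓ : ℓ ∈ F.invariantLines) {b : Module.Basis (Fin 3) ℂ (Fin 3 → ℂ)}
    (hp : F.IsSingularAt (b 0)) (h0 : b 0 ∈ ℓ) (h2 : b 2 ∈ ℓ) {lam : ℂ}
    (h : F.form.polar (b 0) (b 1) (b 2) = - lam * F.form.polar (b 0) (b 2) (b 1)) :
    F.CSIndex ℓ (b 0) lam := by
  intro n w hw
  have h22 := polar_eq_zero_of_mem hℓ h0 h2 h2
  rw [← hℓ.1.span_pair_eq b h0 h2, Submodule.mem_span_pair] at hw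
  obtain ⟨s, t, rfl⟩ := hw
  rw [← b.sum_repr n, Fin.sum_univ_three]
  simp only [OneForm.polar_add_left, OneForm.polar_add_right,
    OneForm.polar_smul_left, OneForm.polar_smul_right, hp.polar_left, hp.polar_right, h22, h]
  ring

theorem CSIndex.smul {p : Fin 3 → ℂ} {lam : ℂ} (h : F.CSIndex ℓ p lam) (r : ℂ) :
    F.CSIndex ℓ (r • p) lam := by
  intro n w hw
  rw [F.polar_smul_base, F.polar_smul_base, h n w hw]
  ring

theorem isNondegenerateIn_iff (b : Module.Basis (Fin 3) ℂ (Fin 3 → ℂ)) :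
    F.IsNondegenerateIn b ↔ F.IsSingularAt (b 0) ∧
      F.form.polar (b 0) (b 1) (b 1) * F.form.polar (b 0) (b 2) (b 2)
      - F.form.polar (b 0) (b 2) (b 1) * F.form.polar (b 0) (b 1) (b 2) ≠ 0 := by
  simp only [IsNondegenerateIn, fieldA, fieldB, map_neg, F.eval_localCoeff,
    F.eval_pderiv_localCoeff, chartPoint_zero, neg_eq_zero, Fin.succ_zero_eq_one,
    Fin.succ_one_eq_two, ← and_assoc]
  refine and_congr ⟨fun h => isSingularAt_of_basis h.2 h.1, fun h => ⟨h _, h _⟩⟩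
    (not_congr ?_)
  constructor <;> intro h <;> linear_combination h

theorem hasCamachoSadIndex_iff (s : P2) (lam : ℂ) :
    F.HasCamachoSadIndex ℓ s lam ↔ ∃ b : Module.Basis (Fin 3) ℂ (Fin 3 → ℂ), IsCentredAt b s ∧
      Submodule.span ℂ {b 0, b 2} = ℓ ∧ F.IsSingularAt (b 0) ∧
      F.form.polar (b 0) (b 1) (b 1) * F.form.polar (b 0) (b 2) (b 2)
      - F.form.polar (b 0) (b 2) (b 1) * F.form.polar (b 0) (b 1) (b 2) ≠ 0 ∧
      lam = - (F.form.polar (b 0) (b 1) (b 2) / F.form.polar (b 0) (b 2) (b 1)) := by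
  simp only [HasCamachoSadIndex, isNondegenerateIn_iff, fieldA, fieldB, map_neg,
    F.eval_pderiv_localCoeff, chartPoint_zero, Fin.succ_zero_eq_one,
    Fin.succ_one_eq_two, and_assoc, div_neg]

theorem HasCamachoSadIndex.exists_csIndex (hℓ : ℓ ∈ F.invariantLines) {s : P2} {lam : ℂ}
    (h : F.HasCamachoSadIndex ℓ s lam) :
    ∃ p ≠ 0, p ∈ ℓ ∧ F.IsSingularAt p ∧ F.CSIndex ℓ p lam := by
  obtain ⟨b, -, hspan, hsing, hdet, rfl⟩ := (hasCamachoSadIndex_iff s lam).1 h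
  have h0 : b 0 ∈ ℓ := hspan ▸ Submodule.subset_span (by simp)
  have h2 : b 2 ∈ ℓ := hspan ▸ Submodule.subset_span (by simp)
  have h22 := polar_eq_zero_of_mem hℓ h0 h2 h2
  rw [h22, mul_zero, zero_sub, neg_ne_zero] at hdet
  refine ⟨b 0, b.ne_zero 0, h0, hsing, csIndex_of_basis hℓ hsing h0 h2 ?_⟩
  rw [neg_neg, div_mul_cancel₀ _ (left_ne_zero_of_mul hdet)]

theorem hasCamachoSadIndex_of_basis (hℓ : ℓ ∈ F.invariantLines)
    {b : Module.Basis (Fin 3) ℂ (Fin 3 → ℂ)}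
    (hp : F.IsSingularAt (b 0)) (h0 : b 0 ∈ ℓ) (h2 : b 2 ∈ ℓ) {lam : ℂ}
    (hdet : F.form.polar (b 0) (b 1) (b 1) * F.form.polar (b 0) (b 2) (b 2)
      - F.form.polar (b 0) (b 2) (b 1) * F.form.polar (b 0) (b 1) (b 2) ≠ 0)
    (h : F.form.polar (b 0) (b 1) (b 2) = - lam * F.form.polar (b 0) (b 2) (b 1)) :
    F.HasCamachoSadIndex ℓ (Projectivization.mk ℂ (b 0) (b.ne_zero 0)) lam := by
  refine (hasCamachoSadIndex_iff _ lam).2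
    ⟨b, rfl, hℓ.1.span_pair_eq b h0 h2, hp, hdet, ?_⟩
  rw [polar_eq_zero_of_mem hℓ h0 h2 h2, mul_zero, zero_sub, neg_ne_zero] at hdet
  rw [h]
  field_simp [left_ne_zero_of_mul hdet]

theorem csIndex_of_polar (hℓ : ℓ ∈ F.invariantLines) {p n w : Fin 3 → ℂ} (hs : F.IsSingularAt p)
    (hp : p ∈ ℓ) (hw : w ∈ ℓ) (hpw : crossProduct p w ≠ 0) (hn : n ∉ ℓ) {lam : ℂ}
    (h : F.form.polar p n w = - lam * F.form.polar p w n) : F.CSIndex ℓ p lam := by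
  obtain ⟨b, rfl, rfl, rfl⟩ := hℓ.1.exists_basis hp hw hpw hn
  exact csIndex_of_basis hℓ hs hp hw h

theorem hasCamachoSadIndex_of_polar (hℓ : ℓ ∈ F.invariantLines) {p n w : Fin 3 → ℂ}
    (hs : F.IsSingularAt p) (hp0 : p ≠ 0)
    (hp : p ∈ ℓ) (hw : w ∈ ℓ) (hpw : crossProduct p w ≠ 0) (hn : n ∉ ℓ) {lam : ℂ}
    (hdet : F.form.polar p w n * F.form.polar p n w ≠ 0)
    (h : F.form.polar p n w = - lam * F.form.polar p w n) :
    F.HasCamachoSadIndex ℓ (Projectivization.mk ℂ p hp0) lam := by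
  obtain ⟨b, rfl, rfl, rfl⟩ := hℓ.1.exists_basis hp hw hpw hn
  refine hasCamachoSadIndex_of_basis hℓ hs hp hw ?_ h
  rwa [polar_eq_zero_of_mem hℓ hp hw hw, mul_zero, zero_sub, neg_ne_zero]

end Foliation

/-! ### The Camacho-Sad formula on an invariant line. -/

/-- The sum over the simple roots of `g` of the residues of `h / g`. -/
theorem sum_residues {g h : Polynomial ℂ} {N : ℕ} (hg : g.natDegree = N + 1)
    (hroots : ∀ t, g.eval t = 0 → g.derivative.eval t ≠ 0) (hh : h.natDegree ≤ N) :
    g.roots.toFinset.card = N + 1 ∧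
    ∑ t ∈ g.roots.toFinset, h.eval t / g.derivative.eval t = h.coeff N / g.leadingCoeff := by
  have hg0 : g ≠ 0 := by rintro rfl; simp at hg
  have hnd : g.roots.Nodup := by
    rw [Multiset.nodup_iff_count_le_one]
    intro t
    rw [Polynomial.count_roots]
    by_contra! hlt
    have := (Polynomial.one_lt_rootMultiplicity_iff_isRoot hg0).1 hlt
    exact hroots t this.1 this.2
  have hsp := IsAlgClosed.splits g
  have hcard : g.roots.toFinset.card = N + 1 := by
    rw [Multiset.toFinset_card_of_nodup hnd, ← hg]
    exact (Polynomial.splits_iff_card_roots.1 hsp)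
  have hprod : g = Polynomial.C g.leadingCoeff * Lagrange.nodal g.roots.toFinset id := by
    conv_lhs => rw [hsp.eq_prod_roots]
    rw [Lagrange.nodal_eq, Finset.prod_multiset_map_count, Finset.prod_congr rfl]
    intro t ht
    rw [Multiset.count_eq_one_of_mem hnd (Multiset.mem_toFinset.1 ht), pow_one]
    rfl
  refine ⟨hcard, ?_⟩
  -- Lagrange interpolation of `h` at the roots of `g`, read in degree `N`; the denominators are the
  -- values of the derivative of `g` divided by its leading coefficient.
  have hL := Lagrange.coeff_eq_sum (s := g.roots.toFinset) (v := id) Function.injective_id.injOn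
    (P := h) (by
      rw [hcard]
      exact lt_of_le_of_lt (Polynomial.degree_le_of_natDegree_le hh) (by exact_mod_cast N.lt_succ_self))
  rw [hcard, Nat.add_sub_cancel] at hL
  rw [hL, Finset.sum_div]
  refine Finset.sum_congr rfl fun t ht => ?_
  have hd : g.derivative.eval t =
      g.leadingCoeff * ∏ j ∈ g.roots.toFinset.erase t, (id t - id j) := by
    conv_lhs => rw [hprod]
    rw [Polynomial.derivative_C_mul, Polynomial.eval_C_mul]
    congr 1
    have := Lagrange.eval_nodal_derivative_eval_node_eq (v := (id : ℂ → ℂ)) ht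
    rw [id] at this
    rw [this, Lagrange.eval_nodal]
    rfl
  rw [hd, div_div, mul_comm]
  rfl

/-- The restriction of polynomials to the affine line `t ↦ e + t f`. -/
def restrictToLine (e f : Fin 3 → ℂ) : MvPolynomial (Fin 3) ℂ →ₐ[ℂ] Polynomial ℂ :=
  aeval fun k => Polynomial.C (e k) + Polynomial.C (f k) * Polynomial.X

theorem eval_restrictToLine (e f : Fin 3 → ℂ) (t : ℂ) (φ : MvPolynomial (Fin 3) ℂ) :
    (restrictToLine e f φ).eval t = eval (e + t • f) φ := by
  rw [restrictToLine, ← Polynomial.coe_aeval_eq_eval, ← aeval_eq_eval,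
    ← AlgHom.comp_apply]
  congr 1
  ext k
  rw [AlgHom.comp_apply, aeval_X, aeval_X, map_add, map_mul, Polynomial.aeval_C, Polynomial.aeval_C,
    Polynomial.aeval_X, mul_comm]
  rfl

theorem restrictToLine_degree {φ : MvPolynomial (Fin 3) ℂ} {n : ℕ} (hφ : φ.IsHomogeneous n)
    (e f : Fin 3 → ℂ) :
    (restrictToLine e f φ).natDegree ≤ n ∧ (restrictToLine e f φ).coeff n = eval f φ := by
  have hlin : ∀ k, (Polynomial.C (e k) + Polynomial.C (f k) * Polynomial.X).natDegree ≤ 1 :=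
    fun k => by
      rw [add_comm]
      exact Polynomial.natDegree_linear_le
  have hpow : ∀ k j, ((Polynomial.C (e k) + Polynomial.C (f k) * Polynomial.X) ^ j).natDegree ≤ j :=
    fun k j => by simpa using Polynomial.natDegree_pow_le_of_le j (hlin k)
  have hcoeff : ∀ k j, ((Polynomial.C (e k) + Polynomial.C (f k) * Polynomial.X) ^ j).coeff j =
      f k ^ j := fun k j => by
    have := Polynomial.coeff_pow_of_natDegree_le (m := j) (hlin k)
    rw [mul_one] at this
    rw [this]
    simp
  have hmon : ∀ m ∈ φ.support, ∀ a : ℂ, (restrictToLine e f (monomial m a)).natDegree ≤ n ∧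
      (restrictToLine e f (monomial m a)).coeff n = eval f (monomial m a) := by
    intro m hm a
    have hdeg := hφ.degree_eq_sum_deg_support hm
    have hsum : n = m 0 + m 1 + m 2 := by
      rw [hdeg, ← Fin.sum_univ_three]
      exact Finset.sum_subset (Finset.subset_univ _) fun i _ hi => Finsupp.notMem_support_iff.1 hi
    rw [restrictToLine, aeval_monomial, Finsupp.prod_fintype _ _ (by simp), Fin.prod_univ_three,
      Polynomial.algebraMap_eq, hsum, eval_monomial, Finsupp.prod_fintype _ _ (by simp),
      Fin.prod_univ_three]
    have h01 := Polynomial.natDegree_mul_le_of_le (hpow 0 (m 0)) (hpow 1 (m 1))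
    refine ⟨(Polynomial.natDegree_C_mul_le _ _).trans
      (Polynomial.natDegree_mul_le_of_le h01 (hpow 2 (m 2))), ?_⟩
    rw [Polynomial.coeff_C_mul, Polynomial.coeff_mul_add_eq_of_natDegree_le h01 (hpow 2 (m 2)),
      Polynomial.coeff_mul_add_eq_of_natDegree_le (hpow 0 (m 0)) (hpow 1 (m 1)), hcoeff, hcoeff, hcoeff]
  rw [φ.as_sum, map_sum, map_sum, Polynomial.finsetSum_coeff]
  exact ⟨Polynomial.natDegree_sum_le_of_forall_le _ _ fun m hm => (hmon m hm _).1,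
    Finset.sum_congr rfl fun m hm => (hmon m hm _).2⟩

/-- The polynomial `q ↦ (∂_x ω)_q(y)`. -/
def OneForm.polarPoly (ω : OneForm) (x y : Fin 3 → ℂ) : MvPolynomial (Fin 3) ℂ :=
  ∑ i, ∑ j, C (x j * y i) * pderiv j (ω i)

theorem OneForm.eval_polarPoly (ω : OneForm) (p x y : Fin 3 → ℂ) :
    eval p (ω.polarPoly x y) = ω.polar p x y := by
  simp only [polarPoly, map_sum, map_mul, eval_C, polar]
  exact Finset.sum_congr rfl fun i _ => Finset.sum_congr rfl fun j _ => by ring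

theorem Foliation.polarPoly_isHomogeneous {d : ℕ} (F : Foliation d) (x y : Fin 3 → ℂ) :
    (F.form.polarPoly x y).IsHomogeneous d :=
  IsHomogeneous.sum _ _ _ fun i _ => IsHomogeneous.sum _ _ _ fun _ _ =>
    (F.homogeneous i).pderiv.C_mul _

namespace Foliation

variable {d : ℕ} {F : Foliation d} {ℓ ℓ' : Submodule ℂ (Fin 3 → ℂ)}

/-- A line of singular points would give a common factor of the coefficients of the form. -/
theorem exists_not_isSingularAt_of_isLine (F : Foliation d) (hℓ : IsLine ℓ) :
    ∃ f ∈ ℓ, ¬ F.IsSingularAt f := by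
  by_contra! h
  refine (linForm_prime hℓ.normal_ne_zero).not_isUnit (F.coprime _ fun i => ?_)
  rw [hℓ.linForm_normal_dvd_iff]
  intro p hp
  simpa [OneForm.evalAt, Pi.single_apply] using h p hp (Pi.single i 1)

/-- The singular points of a reduced convex foliation on an invariant line. -/
structure LineData (F : Foliation d) (ℓ : Submodule ℂ (Fin 3 → ℂ)) (T : Finset ℂ)
    (P : ℂ → Fin 3 → ℂ) (cs : ℂ → ℂ) : Prop where
  card : T.card = d + 1
  sum_cs : ∑ t ∈ T, cs t = 1
  ne_zero : ∀ t, P t ≠ 0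
  mem : ∀ t, P t ∈ ℓ
  cross : ∀ t t', t ≠ t' → crossProduct (P t) (P t') ≠ 0
  sing : ∀ t ∈ T, F.IsSingularAt (P t)
  index : ∀ t ∈ T, F.CSIndex ℓ (P t) (cs t)
  cs_ne_zero : ∀ t ∈ T, cs t ≠ 0
  hasIndex : ∀ t ∈ T, F.HasCamachoSadIndex ℓ (Projectivization.mk ℂ (P t) (ne_zero t)) (cs t)
  exists_eq : ∀ p ∈ ℓ, p ≠ 0 → F.IsSingularAt p → ∃ t ∈ T, ∃ r : ℂ, r ≠ 0 ∧ p = r • P t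

/-- Parametrize the line as `e + t f` with the point at infinity `f` not singular, so that no
singular point is lost. The singular points are the roots of `g(t) = ω(n)`, which are simple by
`local_structure`. The index at a root is `-h/g'`, where `h` is the derivative of `ω(f)` in the
direction `n`. The coefficients of `g` in degree `d + 1` and of `h` in degree `d` are opposite, so
`sum_residues` gives the total `1`. -/
theorem IsArrangement.exists_lineData {S : Finset (Submodule ℂ (Fin 3 → ℂ))} {k : ℂ}
    (hS : F.IsArrangement S k) (hℓ : ℓ ∈ F.invariantLines) :
    ∃ T P cs, F.LineData ℓ T P cs := by
  obtain ⟨f, hf, hfs⟩ := F.exists_not_isSingularAt_of_isLine hℓ.1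
  have hf0 : f ≠ 0 := by
    rintro rfl
    refine hfs fun v => ?_
    have := F.evalAt_smul_base 0 v 0
    rwa [zero_smul, zero_pow (by omega), zero_mul] at this
  obtain ⟨e, he, hfe⟩ := hℓ.1.exists_cross_ne_zero f hf0
  obtain ⟨n, hn⟩ := hℓ.1.exists_notMem
  have hcross : ∀ t t' : ℂ, crossProduct (e + t • f) (e + t' • f) = (t - t') • crossProduct f e := by
    intro t t'
    simp only [map_add, map_smul, LinearMap.add_apply, LinearMap.smul_apply, cross_self]
    rw [← cross_anticomm e f]
    module
  have hcf : ∀ t : ℂ, crossProduct (e + t • f) f ≠ 0 := by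
    intro t
    simp only [map_add, map_smul, LinearMap.add_apply, LinearMap.smul_apply, cross_self]
    rw [smul_zero, add_zero, ← neg_ne_zero, cross_anticomm]
    exact hfe
  have hmem : ∀ t : ℂ, e + t • f ∈ ℓ := fun t => add_mem he (Submodule.smul_mem _ _ hf)
  have hne0 : ∀ t : ℂ, e + t • f ≠ 0 := fun t h => hcf t (by simp [h])
  have hbasis := fun t : ℂ => hℓ.1.exists_basis (hmem t) hf (hcf t) hn
  have hsing_iff : ∀ t : ℂ, F.form.evalAt (e + t • f) n = 0 → F.IsSingularAt (e + t • f) := by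
    intro t ht
    obtain ⟨b, hb0, hb1, hb2⟩ := hbasis t
    rw [← hb0]
    refine isSingularAt_of_basis ?_ ?_
    · rw [hb0, hb1, ht]
    · rw [hb0, hb2]
      exact hℓ.2 _ (hmem t) _ hf
  have hfn : F.form.evalAt f n ≠ 0 := by
    intro h
    obtain ⟨b, hb0, hb1, hb2⟩ := hℓ.1.exists_basis hf he hfe hn
    apply hfs
    rw [← hb0]
    refine isSingularAt_of_basis ?_ ?_
    · rw [hb0, hb1, h]
    · rw [hb0, hb2]
      exact hℓ.2 _ hf _ he
  set g := restrictToLine e f (F.form.contraction n) with hg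
  set h := restrictToLine e f (F.form.polarPoly n f) with hh
  have hgev : ∀ t, g.eval t = F.form.evalAt (e + t • f) n := fun t => by
    rw [hg, eval_restrictToLine, OneForm.eval_contraction]
  have hhev : ∀ t, h.eval t = F.form.polar (e + t • f) n f := fun t => by
    rw [hh, eval_restrictToLine, OneForm.eval_polarPoly]
  obtain ⟨hgd, hgc⟩ := restrictToLine_degree (F.contraction_isHomogeneous n) e f
  obtain ⟨hhd, hhc⟩ := restrictToLine_degree (F.polarPoly_isHomogeneous n f) e f
  rw [← hg] at hgd hgc
  rw [← hh] at hhd hhc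
  rw [OneForm.eval_contraction] at hgc
  rw [OneForm.eval_polarPoly, F.polar_base_right] at hhc
  have hgdeg : g.natDegree = d + 1 :=
    le_antisymm hgd (Polynomial.le_natDegree_of_ne_zero (by rwa [hgc]))
  have hg' : ∀ t, g.derivative.eval t = F.form.polar (e + t • f) f n := fun t => by
    have h1 := g.hasDerivAt t
    simp only [hgev] at h1
    exact h1.unique (F.form.hasDerivAt_evalAt e f n t)
  have hloc : ∀ t : ℂ, g.eval t = 0 →
      F.form.polar (e + t • f) f n * F.form.polar (e + t • f) n f ≠ 0 := by
    intro t ht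
    rw [hgev] at ht
    have hs := hsing_iff t ht
    obtain ⟨b, hb0, hb1, hb2⟩ := hbasis t
    rw [← hb0] at hs
    have := (hS.local_structure b hs).2.1
    rwa [hb0, hb1, hb2, polar_eq_zero_of_mem hℓ (hmem t) hf hf, mul_zero, zero_sub,
      neg_ne_zero] at this
  obtain ⟨hcard, hsum⟩ := sum_residues hgdeg
    (fun t ht => by rw [hg']; exact left_ne_zero_of_mul (hloc t ht)) hhd
  have hroot : ∀ t ∈ g.roots.toFinset, g.eval t = 0 := fun t ht =>
    (Polynomial.mem_roots'.1 (Multiset.mem_toFinset.1 ht)).2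
  have hidx : ∀ t ∈ g.roots.toFinset, F.form.polar (e + t • f) n f =
      - (- (h.eval t / g.derivative.eval t)) * F.form.polar (e + t • f) f n := by
    intro t ht
    rw [neg_neg, hhev, hg', div_mul_cancel₀ _ (left_ne_zero_of_mul (hloc t (hroot t ht)))]
  refine ⟨g.roots.toFinset, fun t => e + t • f, fun t => - (h.eval t / g.derivative.eval t),
    hcard, ?_, hne0, hmem, ?_, fun t ht => hsing_iff t (hgev t ▸ hroot t ht), ?_, ?_, ?_, ?_⟩
  · rw [Finset.sum_neg_distrib, hsum, hhc, Polynomial.leadingCoeff, hgdeg, hgc]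
    field_simp
  · intro t t' htt'
    rw [hcross]
    exact smul_ne_zero (sub_ne_zero.2 htt') hfe
  · intro t ht
    exact csIndex_of_polar hℓ (hsing_iff t (hgev t ▸ hroot t ht)) (hmem t) hf (hcf t) hn
      (hidx t ht)
  · intro t ht
    rw [neg_ne_zero, hhev, hg']
    have := hloc t (hroot t ht)
    exact div_ne_zero (right_ne_zero_of_mul this) (left_ne_zero_of_mul this)
  · intro t ht
    exact hasCamachoSadIndex_of_polar hℓ (hsing_iff t (hgev t ▸ hroot t ht)) _ (hmem t) hf
      (hcf t) hn (hloc t (hroot t ht)) (hidx t ht)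
  · intro p hp hp0 hps
    obtain ⟨b, hb0, -, hb2⟩ := hℓ.1.exists_basis hf he hfe hn
    rw [← hℓ.1.span_pair_eq b (hb0 ▸ hf) (hb2 ▸ he), hb0, hb2, Submodule.mem_span_pair] at hp
    obtain ⟨s, r, rfl⟩ := hp
    have hr : r ≠ 0 := by
      rintro rfl
      rw [zero_smul, add_zero] at hps hp0
      have hs0 : s ≠ 0 := by rintro rfl; simp at hp0
      apply hfs
      have := hps.smul s⁻¹
      rwa [smul_smul, inv_mul_cancel₀ hs0, one_smul] at this
    have heq : s • f + r • e = r • (e + (s / r) • f) := by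
      rw [smul_add, smul_smul, mul_div_cancel₀ _ hr]
      abel
    refine ⟨s / r, ?_, r, hr, heq⟩
    rw [Multiset.mem_toFinset, Polynomial.mem_roots', Polynomial.IsRoot, hgev]
    refine ⟨by rintro h0; rw [h0] at hgdeg; simp at hgdeg, ?_⟩
    have := hps.smul r⁻¹
    rw [heq, smul_smul, inv_mul_cancel₀ hr, one_smul] at this
    exact this n

end Foliation

/-! ### Counting lines and indices: three points on `d + 1` invariant lines each. -/

namespace Foliation

variable {d : ℕ} {F : Foliation d} {ℓ ℓ' : Submodule ℂ (Fin 3 → ℂ)}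
  {S : Finset (Submodule ℂ (Fin 3 → ℂ))} {k : ℂ}

theorem multiplicity_smul (p : Fin 3 → ℂ) {r : ℂ} (hr : r ≠ 0) :
    multiplicity S (r • p) = multiplicity S p := by
  classical
  simp only [multiplicity, Submodule.smul_mem_iff _ hr]

theorem exists_ne_of_two_le_multiplicity {p : Fin 3 → ℂ} (h : 2 ≤ multiplicity S p)
    (ℓ : Submodule ℂ (Fin 3 → ℂ)) : ∃ ℓ' ∈ S, ℓ' ≠ ℓ ∧ p ∈ ℓ' := by
  classical
  obtain ⟨ℓ', h1, h2⟩ := Finset.exists_mem_ne (s := S.filter (p ∈ ·)) h ℓ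
  rw [Finset.mem_filter] at h1
  exact ⟨ℓ', h1.1, h2, h1.2⟩

namespace IsArrangement

variable (hS : F.IsArrangement S k)
include hS

theorem exists_polar_ne_zero (hℓ : ℓ ∈ F.invariantLines) {p : Fin 3 → ℂ} (hp0 : p ≠ 0)
    (hp : p ∈ ℓ) (hs : F.IsSingularAt p) : ∃ n, ∃ w ∈ ℓ, F.form.polar p w n ≠ 0 ∧
      (3 ≤ multiplicity S p → F.form.polar p n w = - F.form.polar p w n) := by
  obtain ⟨w, hw, hpw⟩ := hℓ.1.exists_cross_ne_zero p hp0
  obtain ⟨n, hn⟩ := hℓ.1.exists_notMem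
  obtain ⟨b, rfl, rfl, rfl⟩ := hℓ.1.exists_basis hp hw hpw hn
  obtain ⟨-, h2, h3⟩ := hS.local_structure b hs
  rw [polar_eq_zero_of_mem hℓ hp hw hw, mul_zero, zero_sub, neg_ne_zero] at h2
  refine ⟨b 1, b 2, hw, left_ne_zero_of_mul h2, fun h => ?_⟩
  rw [(h3 h).2.2, neg_neg]

theorem csIndex_unique (hℓ : ℓ ∈ F.invariantLines) {p : Fin 3 → ℂ} (hp0 : p ≠ 0)
    (hp : p ∈ ℓ) (hs : F.IsSingularAt p) {lam lam' : ℂ} (h : F.CSIndex ℓ p lam)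
    (h' : F.CSIndex ℓ p lam') : lam = lam' := by
  obtain ⟨n, w, hw, hne, -⟩ := hS.exists_polar_ne_zero hℓ hp0 hp hs
  have h1 := h n w hw
  rw [h' n w hw] at h1
  exact (neg_injective (mul_right_cancel₀ hne h1)).symm

/-- Three lines through the point would make the linear part radial and the index `1`. -/
theorem multiplicity_le_two (hℓ : ℓ ∈ F.invariantLines) {p : Fin 3 → ℂ} (hp0 : p ≠ 0)
    (hp : p ∈ ℓ) (hs : F.IsSingularAt p) {lam : ℂ} (h : F.CSIndex ℓ p lam) (hlam : lam ≠ 1) :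
    multiplicity S p ≤ 2 := by
  by_contra! h3
  obtain ⟨n, w, hw, hne, h4⟩ := hS.exists_polar_ne_zero hℓ hp0 hp hs
  have h1 := h n w hw
  rw [h4 h3] at h1
  refine hlam (mul_right_cancel₀ hne ?_)
  linear_combination h1

theorem two_le_multiplicity (hℓ : ℓ ∈ F.invariantLines) {p : Fin 3 → ℂ} (hp0 : p ≠ 0)
    (hp : p ∈ ℓ) (hs : F.IsSingularAt p) : 2 ≤ multiplicity S p := by
  obtain ⟨w, hw, hpw⟩ := hℓ.1.exists_cross_ne_zero p hp0
  obtain ⟨n, hn⟩ := hℓ.1.exists_notMem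
  obtain ⟨b, rfl, -, -⟩ := hℓ.1.exists_basis hp hw hpw hn
  exact (hS.local_structure b hs).1

/-- Every invariant line other than `ℓ` meets `ℓ` at a singular point. -/
theorem le_sum_multiplicity (hℓ : ℓ ∈ F.invariantLines) {T : Finset ℂ} {P : ℂ → Fin 3 → ℂ}
    {cs : ℂ → ℂ} (hT : F.LineData ℓ T P cs) :
    3 * d - 1 ≤ ∑ t ∈ T, (multiplicity S (P t) - 1) := by
  classical
  have hmem := (hS.mem_iff ℓ).2 hℓ
  have hsub : S.erase ℓ ⊆ T.biUnion fun t => (S.filter (P t ∈ ·)).erase ℓ := by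
    intro ℓ' hℓ'
    rw [Finset.mem_erase] at hℓ'
    have hinv := (hS.mem_iff ℓ').1 hℓ'.2
    obtain ⟨p, hp0, hp, hp'⟩ := hℓ.1.exists_mem_inf hinv.1
    obtain ⟨t, ht, r, hr, rfl⟩ := hT.exists_eq p hp hp0
      (isSingularAt_of_mem_of_mem hℓ hinv (Ne.symm hℓ'.1) hp hp')
    rw [Submodule.smul_mem_iff _ hr] at hp'
    exact Finset.mem_biUnion.2 ⟨t, ht, Finset.mem_erase.2
      ⟨hℓ'.1, Finset.mem_filter.2 ⟨hℓ'.2, hp'⟩⟩⟩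
  rw [← hS.card, ← Finset.card_erase_of_mem hmem]
  refine (Finset.card_le_card hsub).trans (Finset.card_biUnion_le.trans (le_of_eq ?_))
  refine Finset.sum_congr rfl fun t _ => ?_
  rw [Finset.card_erase_of_mem (Finset.mem_filter.2 ⟨hmem, hT.mem t⟩), multiplicity]

end IsArrangement

variable (F) in
/-- The invariant line `ℓ` contains a singular point of index `1 / (1 - d)`. -/
def HasInverseIndex (ℓ : Submodule ℂ (Fin 3 → ℂ)) : Prop :=
  ∃ p ≠ 0, p ∈ ℓ ∧ F.IsSingularAt p ∧ F.CSIndex ℓ p (1 - (d : ℂ))⁻¹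

theorem LineData.cs_mem (hF : F.camachoSadSet = {(1 - (d : ℂ)), (1 - (d : ℂ))⁻¹})
    (hℓ : ℓ ∈ F.invariantLines) {T : Finset ℂ} {P : ℂ → Fin 3 → ℂ} {cs : ℂ → ℂ}
    (hT : F.LineData ℓ T P cs) {t : ℂ} (ht : t ∈ T) (h1 : cs t ≠ 1) :
    cs t = 1 - (d : ℂ) ∨ cs t = (1 - (d : ℂ))⁻¹ := by
  have : cs t ∈ F.camachoSadSet := by
    refine ⟨hT.cs_ne_zero t ht, h1, ℓ, hℓ, _, ?_, hT.hasIndex t ht⟩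
    rw [Projectivization.submodule_mk, Submodule.span_singleton_le_iff_mem]
    exact hT.mem t
  rwa [hF] at this

/-- Let `k0`, `k1`, `k2` count the indices `1`, `1-d`, `1/(1-d)`. The total number and the total
index give `k0 = 2 + k1 (d - 2)` and `k2 = (d - 1)(1 - k1)`, so `k2 ≥ 1` forces `k1 = 0`. For `d =
2` the last two values coincide and are all counted in `k2`. -/
theorem card_eq_two_of_sum {d : ℕ} (hd : 2 ≤ d) {T : Finset ℂ} {cs : ℂ → ℂ}
    (hcard : T.card = d + 1) (hsum : ∑ t ∈ T, cs t = 1)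
    (hcs : ∀ t ∈ T, cs t ≠ 1 → cs t = 1 - (d : ℂ) ∨ cs t = (1 - (d : ℂ))⁻¹)
    {t₀ : ℂ} (ht₀ : t₀ ∈ T) (h₀ : cs t₀ = (1 - (d : ℂ))⁻¹) :
    (T.filter (cs · = 1)).card = 2 := by
  classical
  have hd1 : (1 - (d : ℂ)) ≠ 0 := by
    rw [sub_ne_zero]
    exact_mod_cast (by omega : 1 ≠ d)
  have hne : (1 - (d : ℂ))⁻¹ ≠ 1 := by
    rw [ne_eq, inv_eq_one, sub_eq_self]
    exact_mod_cast (by omega : d ≠ 0)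
  have hc1 := Finset.card_filter_add_card_filter_not (s := T) (fun t => cs t = 1)
  have hc2 := Finset.card_filter_add_card_filter_not
    (s := T.filter fun t => ¬ cs t = 1) (fun t => cs t = (1 - (d : ℂ))⁻¹)
  have hs1 := Finset.sum_filter_add_sum_filter_not T (fun t => cs t = 1) cs
  have hs2 := Finset.sum_filter_add_sum_filter_not
    (T.filter fun t => ¬ cs t = 1) (fun t => cs t = (1 - (d : ℂ))⁻¹) cs
  have hk2 : 1 ≤ ((T.filter fun t => ¬ cs t = 1).filter
      fun t => cs t = (1 - (d : ℂ))⁻¹).card :=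
    Finset.card_pos.2 ⟨t₀, by simp [ht₀, h₀, hne]⟩
  have e0 : ∑ t ∈ T.filter (cs · = 1), cs t = (T.filter (cs · = 1)).card := by
    rw [Finset.sum_congr rfl fun t ht => (Finset.mem_filter.1 ht).2]
    simp
  have e2 : ∑ t ∈ (T.filter fun t => ¬ cs t = 1).filter fun t => cs t = (1 - (d : ℂ))⁻¹, cs t =
      ((T.filter fun t => ¬ cs t = 1).filter fun t => cs t = (1 - (d : ℂ))⁻¹).card
        * (1 - (d : ℂ))⁻¹ := by
    rw [Finset.sum_congr rfl fun t ht => (Finset.mem_filter.1 ht).2]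
    simp
  have e1 : ∑ t ∈ (T.filter fun t => ¬ cs t = 1).filter fun t => ¬ cs t = (1 - (d : ℂ))⁻¹, cs t =
      ((T.filter fun t => ¬ cs t = 1).filter fun t => ¬ cs t = (1 - (d : ℂ))⁻¹).card
        * (1 - (d : ℂ)) := by
    rw [Finset.sum_congr rfl fun t ht => ?_, Finset.sum_const, nsmul_eq_mul]
    rw [Finset.mem_filter, Finset.mem_filter] at ht
    exact (hcs t ht.1.1 ht.1.2).resolve_right ht.2
  rw [← hs2, e0, e1, e2, hsum] at hs1
  generalize (T.filter (cs · = 1)).card = k0 at *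
  generalize (T.filter fun t => ¬ cs t = 1).card = k12 at *
  generalize ((T.filter fun t => ¬ cs t = 1).filter fun t => cs t = (1 - (d : ℂ))⁻¹).card = k2 at *
  generalize ((T.filter fun t => ¬ cs t = 1).filter fun t => ¬ cs t = (1 - (d : ℂ))⁻¹).card = k1 at *
  have hZ : (k0 : ℤ) * (1 - d) + k2 + k1 * (1 - d) ^ 2 = 1 - d := by
    have : (k0 : ℂ) * (1 - d) + k2 + k1 * (1 - d) ^ 2 = 1 - d := by
      have h := congrArg (· * (1 - (d : ℂ))) hs1
      simp only [add_mul, mul_assoc, inv_mul_cancel₀ hd1, one_mul, mul_one] at h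
      linear_combination h
    exact_mod_cast this
  have hk : (k0 : ℤ) + k1 + k2 = d + 1 := by exact_mod_cast (by omega : k0 + k1 + k2 = d + 1)
  have hk0 : (d : ℤ) * k0 = d * (2 + k1 * (d - 2)) := by linear_combination hk - hZ
  have hk0' : (k0 : ℤ) = 2 + k1 * (d - 2) :=
    mul_left_cancel₀ (by exact_mod_cast (by omega : d ≠ 0)) hk0
  have hk2' : (k2 : ℤ) = (d - 1) * (1 - k1) := by linear_combination hk - hk0'
  have hk1 : k1 = 0 := by
    by_contra h
    have h1 : (1 : ℤ) ≤ k1 := by exact_mod_cast (by omega : 1 ≤ k1)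
    have h2 : (2 : ℤ) ≤ d := by exact_mod_cast hd
    have h3 : (1 : ℤ) ≤ k2 := by exact_mod_cast hk2
    nlinarith
  rw [hk1] at hk0'
  push_cast at hk0'
  omega

namespace IsArrangement

variable (hS : F.IsArrangement S k) (hd : 2 ≤ d)
  (hF : F.camachoSadSet = {(1 - (d : ℂ)), (1 - (d : ℂ))⁻¹})
include hS hd hF

/-- The `d - 1` points of index different from `1` each account for at most one further line. The
two points of index `1` must then account for the remaining `2d` of the `3d - 1` other lines, and
neither can exceed `d`. -/
theorem exists_pair_of_hasInverseIndex (hℓ : ℓ ∈ F.invariantLines) (h : F.HasInverseIndex ℓ) :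
    ∃ p ∈ ℓ, ∃ q ∈ ℓ, crossProduct p q ≠ 0 ∧ multiplicity S p = d + 1 ∧
      multiplicity S q = d + 1 := by
  classical
  obtain ⟨T, P, cs, hT⟩ := hS.exists_lineData hℓ
  obtain ⟨p, hp0, hp, hs, hi⟩ := h
  obtain ⟨t₀, ht₀, r, hr, rfl⟩ := hT.exists_eq p hp hp0 hs
  have h0 : cs t₀ = (1 - (d : ℂ))⁻¹ :=
    hS.csIndex_unique hℓ hp0 hp hs ((hT.index t₀ ht₀).smul r) hi
  have h2 := card_eq_two_of_sum hd hT.card hT.sum_cs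
    (fun t ht h1 => hT.cs_mem hF hℓ ht h1) ht₀ h0
  have hsum := hS.le_sum_multiplicity hℓ hT
  rw [← Finset.sum_filter_add_sum_filter_not T (cs · = 1)] at hsum
  have hc := Finset.card_filter_add_card_filter_not (s := T) (fun t => cs t = 1)
  rw [h2, hT.card] at hc
  have hle : ∑ t ∈ T.filter (¬ cs · = 1), (multiplicity S (P t) - 1) ≤
      (T.filter (¬ cs · = 1)).card • 1 := by
    refine Finset.sum_le_card_nsmul _ _ _ fun t ht => ?_
    rw [Finset.mem_filter] at ht
    have := hS.multiplicity_le_two hℓ (hT.ne_zero t) (hT.mem t) (hT.sing t ht.1)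
      (hT.index t ht.1) ht.2
    omega
  obtain ⟨t₁, t₂, hne, heq⟩ := Finset.card_eq_two.1 h2
  rw [heq, Finset.sum_pair hne] at hsum
  have m1 := hS.multiplicity_le (hT.ne_zero t₁)
  have m2 := hS.multiplicity_le (hT.ne_zero t₂)
  rw [smul_eq_mul, mul_one] at hle
  exact ⟨P t₁, hT.mem t₁, P t₂, hT.mem t₂, hT.cross t₁ t₂ hne, by omega, by omega⟩

/-- Not all `d + 1` indices can be `1`, as their sum is `1`; so one of them is `1 - d`. Along the
other invariant line through that point the two eigenvalues exchange roles and the index is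
inverted. -/
theorem exists_of_not_hasInverseIndex (hℓ : ℓ ∈ F.invariantLines) (h : ¬ F.HasInverseIndex ℓ) :
    ∃ p ≠ 0, p ∈ ℓ ∧ multiplicity S p ≤ 2 ∧
      ∃ ℓ' ∈ F.invariantLines, p ∈ ℓ' ∧ F.HasInverseIndex ℓ' := by
  obtain ⟨T, P, cs, hT⟩ := hS.exists_lineData hℓ
  obtain ⟨t, ht, h1⟩ : ∃ t ∈ T, cs t ≠ 1 := by
    by_contra! h1
    have h2 := hT.sum_cs
    rw [Finset.sum_congr rfl h1, Finset.sum_const, hT.card, nsmul_eq_mul, mul_one] at h2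
    have h3 : d + 1 = 1 := by exact_mod_cast h2
    omega
  have hi := hT.index t ht
  have hs := hT.sing t ht
  have hp0 := hT.ne_zero t
  have hp := hT.mem t
  rcases hT.cs_mem hF hℓ ht h1 with h2 | h2
  · rw [h2] at hi h1
    refine ⟨P t, hp0, hp, hS.multiplicity_le_two hℓ hp0 hp hs hi h1, ?_⟩
    obtain ⟨ℓ', hℓ', hne, hp'⟩ := exists_ne_of_two_le_multiplicity
      (hS.two_le_multiplicity hℓ hp0 hp hs) ℓ
    have hinv := (hS.mem_iff ℓ').1 hℓ'
    refine ⟨ℓ', hinv, hp', P t, hp0, hp', hs, ?_⟩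
    obtain ⟨w, hw, hpw⟩ := hℓ.1.exists_cross_ne_zero _ hp0
    obtain ⟨w', hw', hpw'⟩ := hinv.1.exists_cross_ne_zero _ hp0
    have hwn : w ∉ ℓ' := fun hmem =>
      hne (hℓ.1.eq_of_cross_ne_zero hinv.1 hp hw hp' hmem hpw).symm
    refine csIndex_of_polar hinv hs hp' hw' hpw' hwn ?_
    rw [hi w' w hw]
    have hd1 : (1 - (d : ℂ)) ≠ 0 := by
      rw [sub_ne_zero]
      exact_mod_cast (by omega : 1 ≠ d)
    field_simp
  · exact absurd ⟨P t, hp0, hp, hs, h2 ▸ hi⟩ h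

/-- A reduced convex foliation whose Camacho-Sad set is that of the Fermat foliation has three
non-aligned singular points, each of which is on `d + 1` invariant lines. -/
theorem exists_three_points : ∃ p₁ p₂ p₃ : Fin 3 → ℂ, crossProduct p₁ p₂ ≠ 0 ∧
    crossProduct p₁ p₃ ≠ 0 ∧ crossProduct p₂ p₃ ≠ 0 ∧
    ∀ p, p = p₁ ∨ p = p₂ ∨ p = p₃ → multiplicity S p = d + 1 := by
  have hmem : (1 - (d : ℂ))⁻¹ ∈ F.camachoSadSet := by rw [hF]; simp
  obtain ⟨-, -, ℓ₁, hℓ₁, s, -, hcs⟩ := hmem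
  have ht₁ : F.HasInverseIndex ℓ₁ := hcs.exists_csIndex hℓ₁
  obtain ⟨p, hp, q, hq, hpq, hmp, hmq⟩ := hS.exists_pair_of_hasInverseIndex hd hF hℓ₁ ht₁
  have hp0 : p ≠ 0 := by rintro rfl; simp at hpq
  -- Take another invariant line `ℓ` through `p`. If it has no index `1/(1-d)`, it meets a line that
  -- has one at a point `x` on at most two invariant lines; were this line `ℓ₁`, `x` would be `p`,
  -- which lies on `d + 1`.
  obtain ⟨ℓ₂, hℓ₂, hne, ht₂⟩ : ∃ ℓ₂ ∈ F.invariantLines, ℓ₁ ≠ ℓ₂ ∧ F.HasInverseIndex ℓ₂ := by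
    obtain ⟨ℓ, hℓS, hne, hpℓ⟩ := exists_ne_of_two_le_multiplicity
      (by omega : 2 ≤ multiplicity S p) ℓ₁
    have hℓ := (hS.mem_iff ℓ).1 hℓS
    by_cases ht : F.HasInverseIndex ℓ
    · exact ⟨ℓ, hℓ, hne.symm, ht⟩
    obtain ⟨x, hx0, hx, hmx, ℓ', hℓ', hx', ht'⟩ :=
      hS.exists_of_not_hasInverseIndex hd hF hℓ ht
    refine ⟨ℓ', hℓ', ?_, ht'⟩
    rintro rfl
    have hc : crossProduct p x = 0 := by
      by_contra hc
      exact hne (hℓ.1.eq_of_cross_ne_zero hℓ₁.1 hpℓ hx hp hx' hc)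
    obtain ⟨r, rfl⟩ := exists_smul_of_cross_eq_zero hp0 hc
    have hr : r ≠ 0 := by rintro rfl; simp at hx0
    rw [multiplicity_smul p hr] at hmx
    omega
  obtain ⟨x, hx, y, hy, hxy, hmx, hmy⟩ := hS.exists_pair_of_hasInverseIndex hd hF hℓ₂ ht₂
  -- At most one of `x`, `y` lies on `ℓ₁`, since both lie on `ℓ₂`.
  obtain ⟨z, hz, hmz⟩ : ∃ z, z ∉ ℓ₁ ∧ multiplicity S z = d + 1 := by
    by_cases hx1 : x ∈ ℓ₁
    · refine ⟨y, fun hy1 => hne ?_, hmy⟩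
      exact (hℓ₂.1.eq_of_cross_ne_zero hℓ₁.1 hx hy hx1 hy1 hxy).symm
    · exact ⟨x, hx1, hmx⟩
  have hcross : ∀ u ∈ ℓ₁, u ≠ 0 → crossProduct u z ≠ 0 := by
    intro u hu hu0 hc
    obtain ⟨r, rfl⟩ := exists_smul_of_cross_eq_zero hu0 hc
    exact hz (Submodule.smul_mem _ _ hu)
  have hq0 : q ≠ 0 := by rintro rfl; simp at hpq
  refine ⟨p, q, z, hpq, hcross p hp hp0, hcross q hq hq0, ?_⟩
  rintro _ (rfl | rfl | rfl) <;> assumption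

end IsArrangement

end Foliation

/-! ### Jets and radial singularities of maximal order. -/

theorem coeff_jet (k : ℕ) (f : MvPolynomial (Fin 2) ℂ) (m : Fin 2 →₀ ℕ) :
    coeff m (jet k f) = if m.degree ≤ k then coeff m f else 0 := by
  simp [jet, coeff_sum, coeff_homogeneousComponent]

theorem jet_mul_X (k : ℕ) (f : MvPolynomial (Fin 2) ℂ) (j : Fin 2) :
    jet k f * X j = jet (k + 1) (f * X j) := by
  ext m
  rw [coeff_jet, coeff_mul_X', coeff_mul_X', coeff_jet]
  by_cases hj : j ∈ m.support
  · have h : m = (m - Finsupp.single j 1) + Finsupp.single j 1 := by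
      rw [tsub_add_cancel_of_le]
      exact Finsupp.single_le_iff.2 (Nat.one_le_iff_ne_zero.2 (Finsupp.mem_support_iff.1 hj))
    have h1 := congrArg Finsupp.degree h
    rw [map_add, Finsupp.degree_single] at h1
    simp only [hj, if_true, h1, Nat.add_le_add_iff_right]
  · simp [hj]

theorem jet_sub (k : ℕ) (f g : MvPolynomial (Fin 2) ℂ) : jet k (f - g) = jet k f - jet k g := by
  simp [jet]

theorem coeff_single_eq_eval_pderiv (f : MvPolynomial (Fin 2) ℂ) (i : Fin 2) :
    coeff (Finsupp.single i 1) f = eval 0 (pderiv i f) := by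
  rw [eval_zero, constantCoeff_eq, coeff_pderiv]
  simp

theorem homogeneousComponent_one_eq_zero_iff (f : MvPolynomial (Fin 2) ℂ) :
    homogeneousComponent 1 f = 0 ↔ ∀ i, eval 0 (pderiv i f) = 0 := by
  simp only [← coeff_single_eq_eval_pderiv]
  constructor
  · intro h i
    have := congrArg (coeff (Finsupp.single i 1)) h
    rwa [coeff_homogeneousComponent, if_pos (Finsupp.degree_single _ _), coeff_zero] at this
  · intro h
    ext m
    rw [coeff_homogeneousComponent, coeff_zero]
    split_ifs with hm
    · rw [Finsupp.degree_eq_sum, Fin.sum_univ_two] at hm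
      have : m = Finsupp.single 0 1 ∨ m = Finsupp.single 1 1 := by
        rcases Nat.eq_zero_or_pos (m 0) with h0 | h0
        · right; ext i; fin_cases i <;> simp <;> omega
        · left; ext i; fin_cases i <;> simp <;> omega
      rcases this with rfl | rfl
      · exact h 0
      · exact h 1
    · rfl

theorem isVanishingOrder_one_iff (A B : MvPolynomial (Fin 2) ℂ) :
    IsVanishingOrder A B 1 ↔ (eval 0 A = 0 ∧ eval 0 B = 0) ∧
      ¬ ((∀ i, eval 0 (pderiv i A) = 0) ∧ ∀ i, eval 0 (pderiv i B) = 0) := by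
  rw [IsVanishingOrder, ← homogeneousComponent_one_eq_zero_iff,
    ← homogeneousComponent_one_eq_zero_iff]
  have h0 : ∀ f : MvPolynomial (Fin 2) ℂ, homogeneousComponent 0 f = 0 ↔ eval 0 f = 0 := by
    intro f
    rw [homogeneousComponent_zero, C_eq_zero, eval_zero, constantCoeff_eq]
  constructor
  · rintro ⟨h1, h2⟩
    have h3 : ¬ (homogeneousComponent 0 A ≠ 0 ∨ homogeneousComponent 0 B ≠ 0) := fun h =>
      absurd (h2 h) (by norm_num)
    push Not at h3
    rw [h0, h0] at h3
    refine ⟨h3, fun h => ?_⟩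
    rcases h1 with h1 | h1
    · exact h1 h.1
    · exact h1 h.2
  · rintro ⟨⟨hA, hB⟩, h1⟩
    refine ⟨?_, fun k hk => ?_⟩
    · by_contra h
      simp only [Set.mem_ofPred_eq] at h
      push Not at h
      exact h1 h
    · by_contra! hk0
      obtain rfl : k = 0 := by omega
      rw [Set.mem_ofPred_eq] at hk
      rcases hk with hk | hk
      · exact hk ((h0 A).2 hA)
      · exact hk ((h0 B).2 hB)

theorem IsVanishingOrder.unique {A B : MvPolynomial (Fin 2) ℂ} {k l : ℕ}
    (h : IsVanishingOrder A B k) (h' : IsVanishingOrder A B l) : k = l :=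
  IsLeast.unique h h'

namespace Foliation

variable {d : ℕ} (F : Foliation d)

/-- Multiplication by a coordinate shifts jets by one, and by `localCoeff_euler` the determinant of
the full field with the radial one is `- F.localCoeff b 0`. Tangency orders are thereby read on a
single coefficient. -/
theorem jet_field (b : Module.Basis (Fin 3) ℂ (Fin 3 → ℂ)) (k : ℕ) :
    jet k (F.fieldA b) * X 1 - jet k (F.fieldB b) * X 0 = jet (k + 1) (- F.localCoeff b 0) := by
  rw [jet_mul_X, jet_mul_X, ← jet_sub]
  congr 1
  rw [fieldA, fieldB]
  linear_combination F.localCoeff_euler b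

theorem isTangencyOrder_iff (b : Module.Basis (Fin 3) ℂ (Fin 3 → ℂ))
    (h1 : IsVanishingOrder (F.fieldA b) (F.fieldB b) 1) (n : ℕ) :
    IsTangencyOrder (F.fieldA b) (F.fieldB b) n ↔
      IsLeast {k | 1 ≤ k ∧ jet (k + 1) (- F.localCoeff b 0) ≠ 0} n := by
  simp only [IsTangencyOrder, F.jet_field]
  have : ∀ k, (∃ ν, IsVanishingOrder (F.fieldA b) (F.fieldB b) ν ∧ ν ≤ k) ↔ 1 ≤ k := fun k =>
    ⟨fun ⟨ν, hν, hk⟩ => (h1.unique hν).symm ▸ hk, fun hk => ⟨1, h1, hk⟩⟩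
  simp only [this]

/-- By invariance `ω_{p+tx}(p) = ω_{tx}(p) = t^(d+1) ω_x(p)`, whose derivative at `t = 0` vanishes;
by `polar_base_right` that derivative is `-ω_p(x)`. -/
theorem polar_self_right_eq_zero (hd : 1 ≤ d) {p : Fin 3 → ℂ}
    (h : ∀ (x : Fin 3 → ℂ) (t : ℂ), F.form.evalAt (x + t • p) p = F.form.evalAt x p) : F.IsSingularAt p := by
  intro x
  have h1 := F.form.hasDerivAt_evalAt_zero p x p
  have h2 : (fun t : ℂ => F.form.evalAt (p + t • x) p) =
      fun t => t ^ (d + 1) * F.form.evalAt x p := by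
    funext t
    have := h (t • x) 1
    rw [one_smul, F.evalAt_smul_base] at this
    rw [add_comm, this]
  rw [h2] at h1
  have h3 := h1.unique ((hasDerivAt_pow (d + 1) (0 : ℂ)).mul_const _)
  rw [F.polar_base_right, Nat.add_sub_cancel, zero_pow (by omega), mul_zero, zero_mul,
    neg_eq_zero] at h3
  exact h3

/-- Invariance allows `b 0` to be dropped from the base point, leaving a form of degree `d + 1`
evaluated at `u b₁ + v b₂`. -/
theorem localCoeff_zero_isHomogeneous {b : Module.Basis (Fin 3) ℂ (Fin 3 → ℂ)}
    (h : ∀ (x : Fin 3 → ℂ) (t : ℂ), F.form.evalAt (x + t • b 0) (b 0) = F.form.evalAt x (b 0)) :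
    (F.localCoeff b 0).IsHomogeneous (d + 1) := by
  have heq : F.localCoeff b 0 = aeval (fun k => C (b 1 k) * X 0 + C (b 2 k) * X 1)
      (F.form.contraction (b 0)) := by
    refine MvPolynomial.funext fun w => ?_
    have h1 : eval w (aeval (fun k => C (b 1 k) * X 0 + C (b 2 k) * X 1)
        (F.form.contraction (b 0))) =
        eval (w 0 • b 1 + w 1 • b 2) (F.form.contraction (b 0)) := by
      rw [← aeval_eq_eval, ← aeval_eq_eval, ← AlgHom.comp_apply]
      congr 1
      ext k
      simp [mul_comm]
    rw [h1, F.eval_localCoeff, OneForm.eval_contraction,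
      ← h (w 0 • b 1 + w 1 • b 2) 1, chartPoint]
    congr 1
    module
  rw [heq]
  have := (F.contraction_isHomogeneous (b 0)).aeval
    (fun k => C (b 1 k) * X 0 + C (b 2 k) * X 1 : Fin 3 → MvPolynomial (Fin 2) ℂ) (n := 1)
    fun k => (isHomogeneous_C_mul_X _ _).add (isHomogeneous_C_mul_X _ _)
  rwa [one_mul] at this

theorem jet_of_isHomogeneous {f : MvPolynomial (Fin 2) ℂ} {n : ℕ} (hf : f.IsHomogeneous n)
    (k : ℕ) : jet k f = if n ≤ k then f else 0 := by
  ext m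
  rw [coeff_jet]
  by_cases hm : m.degree = n
  · rw [hm]
    split_ifs <;> rfl
  · rw [hf.coeff_eq_zero hm]
    split_ifs
    · rw [hf.coeff_eq_zero hm]
    · rfl
    · rw [hf.coeff_eq_zero hm]
    · rfl

/-- A criterion for a singularity to be radial of the maximal order. -/
theorem isRadialSingularity_of (hd : 2 ≤ d) {p : Fin 3 → ℂ} (hp0 : p ≠ 0)
    (h : ∀ (x : Fin 3 → ℂ) (t : ℂ), F.form.evalAt (x + t • p) p = F.form.evalAt x p)
    (hpol : ∃ x y, F.form.polar p x y ≠ 0) (hne : ∃ x, F.form.evalAt x p ≠ 0) :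
    F.IsRadialSingularity (Projectivization.mk ℂ p hp0) (d - 1) := by
  refine ⟨by omega, fun b hb => ?_⟩
  rw [IsCentredAt, Projectivization.mk_eq_mk_iff'] at hb
  obtain ⟨r, hr⟩ := hb
  have hr0 : r ≠ 0 := by
    rintro rfl
    rw [zero_smul] at hr
    exact b.ne_zero 0 hr.symm
  replace h : ∀ (x : Fin 3 → ℂ) (t : ℂ), F.form.evalAt (x + t • b 0) (b 0) = F.form.evalAt x (b 0) := by
    intro x t
    rw [← hr, OneForm.evalAt_smul, OneForm.evalAt_smul, smul_smul, h]
  replace hpol : ∃ x y, F.form.polar (b 0) x y ≠ 0 := by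
    obtain ⟨x, y, hxy⟩ := hpol
    exact ⟨x, y, by rw [← hr, F.polar_smul_base]; exact mul_ne_zero (pow_ne_zero _ hr0) hxy⟩
  replace hne : ∃ x, F.form.evalAt x (b 0) ≠ 0 := by
    obtain ⟨x, hx⟩ := hne
    exact ⟨x, by rw [← hr, OneForm.evalAt_smul]; exact mul_ne_zero hr0 hx⟩
  have hs := F.polar_self_right_eq_zero (by omega) h
  have hhom := F.localCoeff_zero_isHomogeneous h
  have hP0 : F.localCoeff b 0 ≠ 0 := by
    obtain ⟨x, hx⟩ := hne
    intro h0
    apply hx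
    have := F.eval_localCoeff b 0 ![b.repr x 1, b.repr x 2]
    rw [h0, map_zero] at this
    rw [this, ← h (chartPoint b ![b.repr x 1, b.repr x 2]) (b.repr x 0 - 1), chartPoint]
    congr 1
    conv_lhs => rw [← b.sum_repr x, Fin.sum_univ_three]
    simp
    module
  have hv : IsVanishingOrder (F.fieldA b) (F.fieldB b) 1 := by
    rw [isVanishingOrder_one_iff]
    simp only [fieldA, fieldB, map_neg, F.eval_localCoeff, F.eval_pderiv_localCoeff,
      chartPoint_zero, hs _, neg_zero, neg_eq_zero, Fin.forall_fin_two, Fin.succ_zero_eq_one,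
      Fin.succ_one_eq_two, true_and, and_self]
    rintro ⟨⟨h12, h22⟩, h11, h21⟩
    obtain ⟨x, y, hxy⟩ := hpol
    apply hxy
    rw [hs.polar_basis, h12, h22, h11, h21]
    ring
  refine ⟨hv, ?_⟩
  rw [F.isTangencyOrder_iff b hv, show d - 1 + 1 = d by omega]
  -- The coefficient along `b 0` is homogeneous of degree `d + 1`, so its jet of order `k + 1`
  -- vanishes exactly for `k < d`.
  refine ⟨⟨by omega, ?_⟩, ?_⟩
  · rw [jet_of_isHomogeneous hhom.neg, if_pos le_rfl]
    exact neg_ne_zero.2 hP0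
  · rintro k ⟨-, hk⟩
    rw [jet_of_isHomogeneous hhom.neg] at hk
    by_contra! hlt
    exact hk (if_neg (by omega))

theorem exists_basis_of_ne_zero {p : Fin 3 → ℂ} (hp0 : p ≠ 0) :
    ∃ b : Module.Basis (Fin 3) ℂ (Fin 3 → ℂ), b 0 = p := by
  obtain ⟨w, hw⟩ : ∃ w, crossProduct p w ≠ 0 := by
    by_contra! h
    obtain ⟨i, hi⟩ := Function.ne_iff.1 hp0
    have h0 := h ![0, 1, 0]
    have h1 := h ![0, 0, 1]
    rw [cross_apply] at h0 h1
    simp at h0 h1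
    fin_cases i
    · exact hi h0.2
    · exact hi h1.1
    · exact hi h0.1
  obtain ⟨n, hn⟩ : ∃ n, n ⬝ᵥ crossProduct p w ≠ 0 := by
    by_contra! h
    exact hw (dotProduct_eq_zero_iff.1 fun x => by rw [dotProduct_comm]; exact h x)
  rw [triple_product_eq_det] at hn
  obtain ⟨b, -, hb, -⟩ := exists_basis_of_det_ne_zero (p := n) (n := p) (w := w) hn
  exact ⟨b.reindex (Equiv.swap 0 1), by simp [hb]⟩

/-- The consequences of the definition of the radial singularities of maximal order. -/
theorem IsRadialSingularity.invariance (hd : 2 ≤ d) {p : Fin 3 → ℂ} (hp0 : p ≠ 0) {F : Foliation d}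
    (h : F.IsRadialSingularity (Projectivization.mk ℂ p hp0) (d - 1)) :
    (∀ (x : Fin 3 → ℂ) (t : ℂ), F.form.evalAt (x + t • p) p = F.form.evalAt x p) ∧
      ∃ x y, F.form.polar p x y ≠ 0 := by
  obtain ⟨b, rfl⟩ := exists_basis_of_ne_zero hp0
  obtain ⟨hv, ht⟩ := h.2 b rfl
  constructor
  · rw [F.isTangencyOrder_iff b hv, show d - 1 + 1 = d by omega] at ht
    -- Otherwise `d - 1`, which is at least `1`, would already be admissible, against the minimality
    -- of the tangency order `d`.
    have hjet : jet d (F.localCoeff b 0) = 0 := by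
      by_contra hne
      have h1 : d - 1 ∈ {k | 1 ≤ k ∧ jet (k + 1) (- F.localCoeff b 0) ≠ 0} := by
        refine ⟨by omega, ?_⟩
        rw [show d - 1 + 1 = d by omega, ← zero_sub, jet_sub]
        simpa [jet] using hne
      have := ht.2 h1
      omega
    have hmem : F.localCoeff b 0 ∈ 𝔪 ^ (d + 1) := by
      rw [mem_pow_idealOfVars_iff']
      intro m hm
      have := congrArg (coeff m) hjet
      rwa [coeff_jet, if_pos (by omega), coeff_zero] at this
    -- On the line `b 0 + t y`, the polynomial `ω(b 0)` has degree at most `d + 1` and is divisible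
    -- by `t^(d+1)`, so it is `t^(d+1) ω_y(b 0)`. Homogeneity with `t = 1/s` gives the claim.
    have key : ∀ (u v s : ℂ), F.form.evalAt (s • b 0 + (u • b 1 + v • b 2)) (b 0) =
        F.form.evalAt (u • b 1 + v • b 2) (b 0) := by
      intro u v s
      by_cases hs : s = 0
      · rw [hs, zero_smul, zero_add]
      set y := u • b 1 + v • b 2 with hy
      obtain ⟨hdeg, hcoeff⟩ := restrictToLine_degree (F.contraction_isHomogeneous (b 0)) (b 0) y
      have heq : restrictToLine (b 0) y (F.form.contraction (b 0)) =
          restrictToDirection ![u, v] (F.localCoeff b 0) := by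
        refine Polynomial.funext fun t => ?_
        rw [eval_restrictToLine, eval_restrictToDirection, OneForm.eval_contraction,
          F.eval_localCoeff, chartPoint, hy]
        congr 1
        simp
        module
      obtain ⟨q, hq⟩ := X_pow_dvd_restrictToDirection ![u, v] hmem
      rw [← heq] at hq
      have hqd : q.natDegree = 0 := by
        by_cases hq0 : q = 0
        · rw [hq0, Polynomial.natDegree_zero]
        rw [hq, Polynomial.natDegree_mul (pow_ne_zero _ Polynomial.X_ne_zero) hq0,
          Polynomial.natDegree_X_pow] at hdeg
        omega
      rw [Polynomial.eq_C_of_natDegree_eq_zero hqd] at hq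
      have hc : q.coeff 0 = F.form.evalAt y (b 0) := by
        rw [hq, Polynomial.coeff_mul_C, Polynomial.coeff_X_pow_self, one_mul,
          OneForm.eval_contraction] at hcoeff
        exact hcoeff
      have h1 := congrArg (Polynomial.eval s⁻¹) hq
      rw [eval_restrictToLine, OneForm.eval_contraction, Polynomial.eval_mul, Polynomial.eval_pow,
        Polynomial.eval_X, Polynomial.eval_C, hc] at h1
      have h2 : s • b 0 + y = s • (b 0 + s⁻¹ • y) := by
        rw [smul_add, smul_smul, mul_inv_cancel₀ hs, one_smul]
      rw [h2, F.evalAt_smul_base, h1, ← mul_assoc, ← mul_pow, mul_inv_cancel₀ hs, one_pow, one_mul]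
    intro x t
    rw [← b.sum_repr x, Fin.sum_univ_three]
    have h1 := key (b.repr x 1) (b.repr x 2) (b.repr x 0 + t)
    have h2 := key (b.repr x 1) (b.repr x 2) (b.repr x 0)
    rw [← h2] at h1
    convert h1 using 2 <;> module
  · by_contra! hpol
    rw [isVanishingOrder_one_iff] at hv
    refine hv.2 ⟨fun i => ?_, fun i => ?_⟩
    · rw [fieldA, F.eval_pderiv_localCoeff, chartPoint_zero, hpol]
    · rw [fieldB, map_neg, map_neg, F.eval_pderiv_localCoeff, chartPoint_zero, hpol, neg_zero]

theorem IsArrangement.isRadialSingularity {F : Foliation d}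
    {S : Finset (Submodule ℂ (Fin 3 → ℂ))} {k : ℂ} (hS : F.IsArrangement S k) (hd : 2 ≤ d)
    {p : Fin 3 → ℂ} (hp0 : p ≠ 0) (hm : multiplicity S p = d + 1) :
    F.IsRadialSingularity (Projectivization.mk ℂ p hp0) (d - 1) := by
  have h := hS.evalAt_add_of_multiplicity_eq hp0 hm
  refine F.isRadialSingularity_of hd hp0 h ?_ ?_
  · by_contra! hpol
    obtain ⟨b, rfl⟩ := exists_basis_of_ne_zero hp0
    refine (hS.local_structure b (F.polar_self_right_eq_zero (by omega) h)).2.1 ?_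
    simp only [hpol]
    ring
  · obtain ⟨x, hx⟩ := exists_eval_ne_zero (hS.contraction_ne_zero hp0)
    exact ⟨x, by rwa [OneForm.eval_contraction] at hx⟩

/-- A reduced convex foliation with the same Camacho-Sad set as the Fermat foliation has three
radial singularities of maximal order. -/
theorem IsReducedConvex.exists_radialSingularities {F : Foliation d} (hd : 2 ≤ d)
    (hF : F.IsReducedConvex) (hcs : F.camachoSadSet = {(1 - (d : ℂ)), (1 - (d : ℂ))⁻¹}) :
    ∃ s₁ s₂ s₃ : P2, s₁ ≠ s₂ ∧ s₁ ≠ s₃ ∧ s₂ ≠ s₃ ∧ F.IsRadialSingularity s₁ (d - 1) ∧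
      F.IsRadialSingularity s₂ (d - 1) ∧ F.IsRadialSingularity s₃ (d - 1) := by
  obtain ⟨S, k, hS⟩ := hF.exists_isArrangement (by omega)
  obtain ⟨p₁, p₂, p₃, h12, h13, h23, hm⟩ := hS.exists_three_points hd hcs
  have h1 : p₁ ≠ 0 := by rintro rfl; simp at h12
  have h2 : p₂ ≠ 0 := by rintro rfl; simp at h12
  have h3 : p₃ ≠ 0 := by rintro rfl; simp at h13
  have hne : ∀ {p q : Fin 3 → ℂ} (hp : p ≠ 0) (hq : q ≠ 0), crossProduct p q ≠ 0 →
      Projectivization.mk ℂ p hp ≠ Projectivization.mk ℂ q hq := by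
    intro p q hp hq hpq h
    obtain ⟨a, rfl⟩ := (Projectivization.mk_eq_mk_iff' ℂ p q hp hq).1 h
    simp at hpq
  exact ⟨_, _, _, hne h1 h2 h12, hne h1 h3 h13, hne h2 h3 h23,
    hS.isRadialSingularity hd h1 (hm _ (by simp)), hS.isRadialSingularity hd h2 (hm _ (by simp)),
    hS.isRadialSingularity hd h3 (hm _ (by simp))⟩

end Foliation

/-! ### Radial singularities of maximal order are not aligned. -/

/-- The form does not see, along the direction `p`, the component of the base point along `p`. -/
def OneForm.InvariantAlong (ω : OneForm) (p : Fin 3 → ℂ) : Prop :=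
  ∀ (x : Fin 3 → ℂ) (t : ℂ), ω.evalAt (x + t • p) p = ω.evalAt x p

theorem OneForm.InvariantAlong.smul {ω : OneForm} {p : Fin 3 → ℂ} (h : ω.InvariantAlong p)
    (r : ℂ) : ω.InvariantAlong (r • p) := by
  intro x t
  rw [OneForm.evalAt_smul, OneForm.evalAt_smul, smul_smul, h]

theorem OneForm.InvariantAlong.polar_add {ω : OneForm} {p : Fin 3 → ℂ} (hp : ω.InvariantAlong p) (x n : Fin 3 → ℂ)
    (t : ℂ) :
    ω.polar (x + t • p) n p = ω.polar x n p := by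
  have h1 := ω.hasDerivAt_evalAt_zero (x + t • p) n p
  rw [funext fun z : ℂ => show ω.evalAt (x + t • p + z • n) p = ω.evalAt (x + z • n) p by
    rw [← hp (x + z • n) t]; congr 1; module] at h1
  exact h1.unique (ω.hasDerivAt_evalAt_zero x n p)

theorem two_pow_ne_two {d : ℕ} (hd : 2 ≤ d) : (2 : ℂ) ^ d ≠ 2 := by
  intro h
  have h1 : 2 ^ d = 2 := by exact_mod_cast h
  have h2 : 2 ^ 2 ≤ 2 ^ d := Nat.pow_le_pow_right (by norm_num) hd
  omega

namespace Foliation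

variable {d : ℕ} {F : Foliation d}

section Aligned

variable {p q : Fin 3 → ℂ}

/-- The invariances under `p`, `q` and `p + q` give `ω_{x+tq}(p) - ω_x(p) = ω_x(q) - ω_{x+tp}(q)`,
and the right side is unchanged when `x` moves along `q`. The increment of `ω(p)` along `q` is thus
additive, and the step `2s` gives twice the step `s`. Homogeneity compares the same increments with
the factor `2^(d+1)`. -/
theorem evalAt_smul_add_sub (hp : F.form.InvariantAlong p)
    (hq : F.form.InvariantAlong q) (hpq : F.form.InvariantAlong (p + q)) (n : Fin 3 → ℂ) (s z : ℂ) :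
    F.form.evalAt (s • q + (2 * z) • n) p - F.form.evalAt ((2 * z) • n) p =
      2 ^ d * (F.form.evalAt (s • q + z • n) p - F.form.evalAt (z • n) p) := by
  have hadd : ∀ (x : Fin 3 → ℂ) (t : ℂ), F.form.evalAt (x + t • q) p - F.form.evalAt x p =
      F.form.evalAt x q - F.form.evalAt (x + t • p) q := by
    intro x t
    have h1 := hpq x t
    have h2 := hp (x + t • q) t
    have h3 := hq (x + t • p) t
    rw [show x + t • q + t • p = x + t • (p + q) by module] at h2
    rw [show x + t • p + t • q = x + t • (p + q) by module] at h3
    rw [OneForm.evalAt_add, OneForm.evalAt_add, h2, h3] at h1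
    linear_combination h1
  have h1 := hadd ((2 * z) • n) s
  have h2 := hadd ((2 * z) • n + s • q) s
  have h3 := hq ((2 * z) • n) s
  have h4 := hq ((2 * z) • n + s • p) s
  have h5 := F.evalAt_smul_base (s • q + z • n) p 2
  have h6 := F.evalAt_smul_base (z • n) p 2
  rw [show (2 * z) • n + s • q + s • p = (2 * z) • n + s • p + s • q by module, h3, h4, ← h1,
    show (2 * z) • n + s • q + s • q = (2 : ℂ) • (s • q + z • n) by module, h5,
    add_comm ((2 * z) • n) (s • q)] at h2
  rw [smul_smul] at h6
  rw [h6] at h2 ⊢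
  rw [pow_succ] at h2 ⊢
  linear_combination -h2 / 2

/-- Differentiating the previous relation at `z = 0` multiplies the same number by `2` on one side
and by `2^d` on the other. -/
theorem polar_smul_eq_zero (hd : 2 ≤ d) (hp : F.form.InvariantAlong p)
    (hq : F.form.InvariantAlong q) (hpq : F.form.InvariantAlong (p + q)) (n : Fin 3 → ℂ) (s : ℂ) :
    F.form.polar (s • q) n p = 0 := by
  have h1 := (F.form.hasDerivAt_evalAt_zero (s • q) ((2 : ℂ) • n) p).fun_sub
    (F.form.hasDerivAt_evalAt_zero 0 ((2 : ℂ) • n) p)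
  have h2 := ((F.form.hasDerivAt_evalAt_zero (s • q) n p).fun_sub
    (F.form.hasDerivAt_evalAt_zero 0 n p)).const_mul ((2 : ℂ) ^ d)
  have h0 := F.polar_smul_base 0 n p 0
  rw [zero_pow (by omega), zero_smul, zero_mul] at h0
  rw [funext fun z : ℂ => show F.form.evalAt (s • q + z • (2 : ℂ) • n) p -
    F.form.evalAt (0 + z • (2 : ℂ) • n) p = 2 ^ d * (F.form.evalAt (s • q + z • n) p -
      F.form.evalAt (0 + z • n) p) by
    have := evalAt_smul_add_sub hp hq hpq n s z
    rw [zero_add, zero_add, ← this, smul_smul, mul_comm]] at h1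
  have h3 := h1.unique h2
  rw [OneForm.polar_smul_left, OneForm.polar_smul_left, h0, mul_zero, sub_zero, sub_zero] at h3
  have h4 : ((2 : ℂ) ^ d - 2) * F.form.polar (s • q) n p = 0 := by linear_combination -h3
  exact (mul_eq_zero.1 h4).resolve_left (sub_ne_zero.2 (two_pow_ne_two hd))

/-- A line with three points along which the form is invariant consists of singular points. -/
theorem isSingularAt_of_invariantAlong (hd : 2 ≤ d) (hp : F.form.InvariantAlong p)
    (hq : F.form.InvariantAlong q) (hpq : F.form.InvariantAlong (p + q)) (s t : ℂ) :
    F.IsSingularAt (s • p + t • q) := by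
  intro n
  have hqp : F.form.InvariantAlong (q + p) := by rwa [add_comm]
  have h1 : F.form.polar (s • p + t • q) n p = 0 := by
    rw [add_comm, hp.polar_add, polar_smul_eq_zero hd hp hq hpq]
  have h2 : F.form.polar (s • p + t • q) n q = 0 := by
    rw [hq.polar_add, polar_smul_eq_zero hd hq hp hqp]
  -- By `polar_base_right`, the derivative against the base point itself is minus the value of the
  -- form, and the base point is a combination of `p` and `q`.
  have h3 := F.polar_base_right (s • p + t • q) n
  rw [OneForm.polar_add_right, OneForm.polar_smul_right, OneForm.polar_smul_right, h1, h2] at h3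
  linear_combination h3

end Aligned

/-- Three distinct radial singularities of maximal order are not aligned. -/
theorem not_aligned (hd : 2 ≤ d) {s₁ s₂ s₃ : P2} (h12 : s₁ ≠ s₂) (h13 : s₁ ≠ s₃) (h23 : s₂ ≠ s₃)
    (h1 : F.IsRadialSingularity s₁ (d - 1)) (h2 : F.IsRadialSingularity s₂ (d - 1))
    (h3 : F.IsRadialSingularity s₃ (d - 1)) : ¬ Aligned s₁ s₂ s₃ := by
  induction s₁ using Projectivization.ind with | h p₁ hp₁ => ?_
  induction s₂ using Projectivization.ind with | h p₂ hp₂ => ?_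
  induction s₃ using Projectivization.ind with | h p₃ hp₃ => ?_
  rintro ⟨ℓ, hℓ, m1, m2, m3⟩
  rw [Projectivization.submodule_mk, Submodule.span_singleton_le_iff_mem] at m1 m2 m3
  simp only [ne_eq, Projectivization.mk_eq_mk_iff'] at h12 h13 h23
  have hc : crossProduct p₁ p₂ ≠ 0 := by
    intro h
    obtain ⟨r, hr⟩ := exists_smul_of_cross_eq_zero hp₁ h
    have hr0 : r ≠ 0 := by
      rintro rfl
      exact hp₂ (by rw [hr, zero_smul])
    exact h12 ⟨r⁻¹, by rw [hr, smul_smul, inv_mul_cancel₀ hr0, one_smul]⟩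
  obtain ⟨n, hn⟩ := hℓ.exists_notMem
  obtain ⟨b, rfl, -, rfl⟩ := hℓ.exists_basis m1 m2 hc hn
  have hspan := hℓ.span_pair_eq b m1 m2
  rw [← hspan, Submodule.mem_span_pair] at m3
  obtain ⟨r, s, rfl⟩ := m3
  have hr : r ≠ 0 := by
    rintro rfl
    have hs : s ≠ 0 := by rintro rfl; simp at hp₃
    exact h23 ⟨s⁻¹, by rw [zero_smul, zero_add, smul_smul, inv_mul_cancel₀ hs, one_smul]⟩
  have hs : s ≠ 0 := by
    rintro rfl
    exact h13 ⟨r⁻¹, by rw [zero_smul, add_zero, smul_smul, inv_mul_cancel₀ hr, one_smul]⟩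
  have i1 : F.form.InvariantAlong (b 0) := (h1.invariance hd hp₁).1
  have i2 : F.form.InvariantAlong (b 2) := (h2.invariance hd hp₂).1
  -- Rescaling the first two representatives makes the third one their sum.
  have hsing := isSingularAt_of_invariantAlong hd (i1.smul r) (i2.smul s) (h3.invariance hd hp₃).1
  obtain ⟨x, hx, hns⟩ := F.exists_not_isSingularAt_of_isLine hℓ
  rw [← hspan, Submodule.mem_span_pair] at hx
  obtain ⟨α, β, rfl⟩ := hx
  apply hns
  have := hsing (α / r) (β / s)
  rwa [smul_smul, smul_smul, div_mul_cancel₀ _ hr, div_mul_cancel₀ _ hs] at this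

end Foliation

/-! ### Normal form of a foliation with three independent radial singularities of maximal order. -/

theorem OneForm.evalAt_single (ω : OneForm) (p : Fin 3 → ℂ) (i : Fin 3) :
    ω.evalAt p (Pi.single i 1) = eval p (ω i) := by
  simp [OneForm.evalAt, Pi.single_apply]

theorem OneForm.evalAt_pullback (ω : OneForm) (g : GL (Fin 3) ℂ) (p v : Fin 3 → ℂ) :
    (ω.pullback g).evalAt p v = ω.evalAt (g.val.mulVec p) (g.val.mulVec v) := by
  have h : ∀ f : MvPolynomial (Fin 3) ℂ, eval p (aeval (fun k => ∑ l, C (g.val k l) * X l) f) =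
      eval (g.val.mulVec p) f := by
    intro f
    rw [← aeval_eq_eval, ← aeval_eq_eval, ← AlgHom.comp_apply]
    congr 1
    ext k
    simp [Matrix.mulVec, dotProduct]
  simp only [OneForm.evalAt, OneForm.pullback, map_sum, map_mul, eval_C, h, Matrix.mulVec,
    dotProduct, Finset.sum_mul, Finset.mul_sum]
  rw [Finset.sum_comm]
  exact Finset.sum_congr rfl fun i _ => Finset.sum_congr rfl fun j _ => by ring

/-- `P` and `Q` enter as plain functions. The relation at `y = z = 1` expresses `Q` through `P`.
Comparing the relation for the pairs `(2, z)` and `(z, 2)` then shows that `P z - P 1 * z` is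
proportional to `z^d - z`, with division by `2^d - 2`. -/
theorem exists_coeff_of_homogeneous {d : ℕ} (hd : 2 ≤ d) {P Q : ℂ → ℂ}
    (h : ∀ t y z, (t * y) * P (t * z) + (t * z) * Q (t * y) = t ^ (d + 1) * (y * P z + z * Q y)) :
    ∃ β γ : ℂ, ∀ y z, y * P z + z * Q y = β * (y * z ^ d) + γ * (z * y ^ d) := by
  have h2 : (2 : ℂ) ^ d - 2 ≠ 0 := sub_ne_zero.2 (two_pow_ne_two hd)
  have h1 : (2 : ℂ) ^ d - 1 ≠ 0 := by
    refine sub_ne_zero.2 ?_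
    exact_mod_cast (Nat.one_lt_two_pow (by omega)).ne'
  have hP0 : P 0 = 0 := by
    have := h 2 1 0
    simp only [mul_one, mul_zero, zero_mul, add_zero, one_mul, pow_succ] at this
    exact (mul_eq_zero.1 (show ((2 : ℂ) ^ d - 1) * P 0 = 0 by
      linear_combination -this / 2)).resolve_left h1
  have hQ0 : Q 0 = 0 := by
    have := h 2 0 1
    simp only [mul_one, mul_zero, zero_mul, zero_add, one_mul, pow_succ] at this
    exact (mul_eq_zero.1 (show ((2 : ℂ) ^ d - 1) * Q 0 = 0 by
      linear_combination -this / 2)).resolve_left h1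
  have key : ∀ t z : ℂ, t ≠ 0 → P (t * z) + z * Q t = t ^ d * (P z + z * Q 1) := by
    intro t z ht
    have := h t 1 z
    simp only [mul_one, one_mul, pow_succ] at this
    apply mul_left_cancel₀ ht
    linear_combination this
  have hQ : ∀ t : ℂ, Q t = t ^ d * (P 1 + Q 1) - P t := by
    intro t
    by_cases ht : t = 0
    · rw [ht, hQ0, hP0, zero_pow (by omega)]
      ring
    · have := key t 1 ht
      rw [mul_one] at this
      linear_combination this
  have hP : ∀ z : ℂ, ((2 : ℂ) ^ d - 2) * (P z - P 1 * z) = (z ^ d - z) * (P 2 - P 1 * 2) := by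
    intro z
    by_cases hz : z = 0
    · rw [hz, hP0, zero_pow (by omega)]
      ring
    · have e1 := key 2 z two_ne_zero
      have e2 := key z 2 hz
      rw [mul_comm z 2] at e2
      rw [hQ] at e1 e2
      linear_combination e2 - e1
  refine ⟨(P 2 - P 1 * 2) / (2 ^ d - 2), P 1 + Q 1 - (P 2 - P 1 * 2) / (2 ^ d - 2), fun y z => ?_⟩
  have hP' : ∀ z : ℂ, P z = P 1 * z + (z ^ d - z) * ((P 2 - P 1 * 2) / (2 ^ d - 2)) := by
    intro z
    have := hP z
    field_simp
    linear_combination this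
  rw [hQ, hP' y, hP' z]
  ring

namespace Foliation

variable {d : ℕ} {F : Foliation d}

/-- By invariance `ω(p)` depends only on `y` and `z`. The relation `ω_x(x) = 0` at `p + y q + z r`
writes it as `y P(z) + z Q(y)`, because `ω(q)` does not see `y` and `ω(r)` does not see `z`. -/
theorem exists_evalAt_eq (hd : 2 ≤ d) {p q r : Fin 3 → ℂ} (hp : F.form.InvariantAlong p)
    (hq : F.form.InvariantAlong q) (hr : F.form.InvariantAlong r) :
    ∃ β γ : ℂ, ∀ x y z : ℂ, F.form.evalAt (x • p + y • q + z • r) p =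
      β * (y * z ^ d) + γ * (z * y ^ d) := by
  have hsum : ∀ y z : ℂ, F.form.evalAt (y • q + z • r) p =
      y * - F.form.evalAt (p + z • r) q + z * - F.form.evalAt (p + y • q) r := by
    intro y z
    have h0 := F.evalAt_self (p + y • q + z • r)
    have h1 := hp (y • q + z • r) 1
    have h2 := hq (p + z • r) y
    have h3 := hr (p + y • q) z
    rw [show y • q + z • r + (1 : ℂ) • p = p + y • q + z • r by module] at h1
    rw [show p + z • r + y • q = p + y • q + z • r by module] at h2
    conv at h0 => lhs; arg 3; rw [add_assoc]
    rw [OneForm.evalAt_add, OneForm.evalAt_add, OneForm.evalAt_smul, OneForm.evalAt_smul,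
      h1, h2, h3] at h0
    linear_combination h0
  obtain ⟨β, γ, h⟩ := exists_coeff_of_homogeneous hd
    (P := fun z => - F.form.evalAt (p + z • r) q) (Q := fun y => - F.form.evalAt (p + y • q) r) (by
    intro t y z
    simp only [← hsum]
    rw [← F.evalAt_smul_base]
    congr 1
    module)
  refine ⟨β, γ, fun x y z => ?_⟩
  rw [← h, ← hsum, ← hp (y • q + z • r) x]
  congr 1
  module

theorem hasDerivAt_add_pow_zero (hd : 2 ≤ d) (a c : ℂ) :
    HasDerivAt (fun t : ℂ => a * t + c * t ^ d) a 0 := by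
  have := ((hasDerivAt_id (0 : ℂ)).const_mul a).fun_add ((hasDerivAt_pow d (0 : ℂ)).const_mul c)
  refine this.congr_deriv ?_
  rw [zero_pow (by omega)]
  ring

/-- The entries of the linear part at `b 0` along the other two basis vectors come only from the
coefficients of `x^d`, namely `a` and `c' = -a`; the other terms are of order `d ≥ 2`. -/
theorem coeff_ne_zero_of_polar (hd : 2 ≤ d) (b : Module.Basis (Fin 3) ℂ (Fin 3 → ℂ))
    {a c a' c' : ℂ}
    (h1 : ∀ x y z : ℂ, F.form.evalAt (x • b 0 + y • b 1 + z • b 2) (b 1) =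
      a * (z * x ^ d) + c * (x * z ^ d))
    (h2 : ∀ x y z : ℂ, F.form.evalAt (x • b 0 + y • b 1 + z • b 2) (b 2) =
      a' * (x * y ^ d) + c' * (y * x ^ d))
    (hsum : a + c' = 0) (hpol : ∃ x y, F.form.polar (b 0) x y ≠ 0) : a ≠ 0 := by
  rintro rfl
  obtain rfl : c' = 0 := by simpa using hsum
  have e1 : ∀ t : ℂ, F.form.evalAt (b 0 + t • b 1) (b 1) = 0 := by
    intro t
    have := h1 1 t 0
    rw [show (1 : ℂ) • b 0 + t • b 1 + (0 : ℂ) • b 2 = b 0 + t • b 1 by module] at this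
    rw [this, zero_pow (by omega)]
    ring
  have e2 : ∀ t : ℂ, F.form.evalAt (b 0 + t • b 2) (b 2) = 0 := by
    intro t
    have := h2 1 0 t
    rw [show (1 : ℂ) • b 0 + (0 : ℂ) • b 1 + t • b 2 = b 0 + t • b 2 by module] at this
    rw [this, zero_pow (by omega)]
    ring
  have e3 : ∀ t : ℂ, F.form.evalAt (b 0 + t • b 2) (b 1) = 0 * t + c * t ^ d := by
    intro t
    have := h1 1 0 t
    rw [show (1 : ℂ) • b 0 + (0 : ℂ) • b 1 + t • b 2 = b 0 + t • b 2 by module] at this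
    rw [this]
    ring
  have e4 : ∀ t : ℂ, F.form.evalAt (b 0 + t • b 1) (b 2) = 0 * t + a' * t ^ d := by
    intro t
    have := h2 1 t 0
    rw [show (1 : ℂ) • b 0 + t • b 1 + (0 : ℂ) • b 2 = b 0 + t • b 1 by module] at this
    rw [this]
    ring
  have hs : F.IsSingularAt (b 0) := by
    refine isSingularAt_of_basis ?_ ?_
    · simpa using e1 0
    · simpa using e2 0
  have p11 := F.form.polar_eq_zero_of_evalAt _ _ _ e1
  have p22 := F.form.polar_eq_zero_of_evalAt _ _ _ e2
  have p21 := F.form.hasDerivAt_evalAt_zero (b 0) (b 2) (b 1)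
  have p12 := F.form.hasDerivAt_evalAt_zero (b 0) (b 1) (b 2)
  rw [funext e3] at p21
  rw [funext e4] at p12
  obtain ⟨x, y, hxy⟩ := hpol
  apply hxy
  rw [hs.polar_basis, p11, p22, p21.unique (hasDerivAt_add_pow_zero hd _ _),
    p12.unique (hasDerivAt_add_pow_zero hd _ _)]
  ring

theorem isLinearlyConjugate_of_basis (hd : 2 ≤ d) (b : Module.Basis (Fin 3) ℂ (Fin 3 → ℂ)) {k : ℂ}
    (hk : k ≠ 0) (h : ∀ x i, F.form.evalAt (∑ j, x j • b j) (b i) =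
      k * eval x ((fermat d hd).form i)) : F.IsLinearlyConjugate (fermat d hd) := by
  have hdet : IsUnit (Matrix.of fun i j => b j i).det := by
    rw [isUnit_iff_ne_zero, ← Matrix.det_transpose]
    convert basis_det_ne_zero b using 2
    ext i j
    fin_cases i <;> rfl
  have hg : ∀ x : Fin 3 → ℂ, (Matrix.of fun i j => b j i).mulVec x = ∑ j, x j • b j := by
    intro x
    ext i
    simp [Matrix.mulVec, dotProduct, mul_comm]
  refine ⟨Matrix.GeneralLinearGroup.mk'' _ hdet, k, hk, ?_⟩
  funext i
  refine MvPolynomial.funext fun x => ?_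
  rw [← OneForm.evalAt_single, OneForm.evalAt_pullback, map_mul, eval_C, ← h]
  change F.form.evalAt ((Matrix.of fun i j => b j i).mulVec x)
    ((Matrix.of fun i j => b j i).mulVec (Pi.single i 1)) = _
  rw [hg, hg]
  congr 1
  simp [Pi.single_apply]

theorem isLinearlyConjugate_of_invariantAlong (hd : 2 ≤ d)
    (b : Module.Basis (Fin 3) ℂ (Fin 3 → ℂ))
    (h : ∀ i, F.form.InvariantAlong (b i) ∧ ∃ x y, F.form.polar (b i) x y ≠ 0) :
    F.IsLinearlyConjugate (fermat d hd) := by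
  obtain ⟨A, B, h0⟩ := exists_evalAt_eq hd (h 0).1 (h 1).1 (h 2).1
  obtain ⟨C', D, h1⟩ := exists_evalAt_eq hd (h 1).1 (h 2).1 (h 0).1
  obtain ⟨E, G, h2⟩ := exists_evalAt_eq hd (h 2).1 (h 0).1 (h 1).1
  replace h1 : ∀ x y z : ℂ, F.form.evalAt (x • b 0 + y • b 1 + z • b 2) (b 1) =
      C' * (z * x ^ d) + D * (x * z ^ d) := fun x y z => by
    rw [← h1 y]
    congr 1
    module
  replace h2 : ∀ x y z : ℂ, F.form.evalAt (x • b 0 + y • b 1 + z • b 2) (b 2) =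
      E * (x * y ^ d) + G * (y * x ^ d) := fun x y z => by
    rw [← h2 z]
    congr 1
    module
  have hE : ∀ x y z : ℂ, x * (A * (y * z ^ d) + B * (z * y ^ d)) +
      y * (C' * (z * x ^ d) + D * (x * z ^ d)) + z * (E * (x * y ^ d) + G * (y * x ^ d)) = 0 := by
    intro x y z
    have := F.evalAt_self (x • b 0 + y • b 1 + z • b 2)
    simpa only [OneForm.evalAt_add, OneForm.evalAt_smul, h0, h1, h2] using this
  have h2d : (2 : ℂ) ^ d - 2 ≠ 0 := sub_ne_zero.2 (two_pow_ne_two hd)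
  -- Doubling one coordinate at a time and subtracting twice the value at `(1, 1, 1)` isolates each
  -- sum of two constants, multiplied by `2^d - 2`.
  have e0 := hE 1 1 1
  have e1 := hE 1 1 2
  have e2 := hE 1 2 1
  have e3 := hE 2 1 1
  simp only [one_pow, mul_one, one_mul] at e0 e1 e2 e3
  have s1 : A + D = 0 := (mul_eq_zero.1 (show ((2 : ℂ) ^ d - 2) * (A + D) = 0 by
    linear_combination e1 - 2 * e0)).resolve_left h2d
  have s2 : E + B = 0 := (mul_eq_zero.1 (show ((2 : ℂ) ^ d - 2) * (E + B) = 0 by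
    linear_combination e2 - 2 * e0)).resolve_left h2d
  have s3 : C' + G = 0 := (mul_eq_zero.1 (show ((2 : ℂ) ^ d - 2) * (C' + G) = 0 by
    linear_combination e3 - 2 * e0)).resolve_left h2d
  have n0 : C' ≠ 0 := coeff_ne_zero_of_polar hd b h1 h2 s3 (h 0).2
  -- The same argument at the other two points, after a cyclic permutation of the basis.
  have n1 : E ≠ 0 := by
    obtain ⟨b', e0, e1, e2⟩ : ∃ b' : Module.Basis (Fin 3) ℂ (Fin 3 → ℂ),
        b' 0 = b 1 ∧ b' 1 = b 2 ∧ b' 2 = b 0 :=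
      ⟨b.reindex (finRotate 3).symm, by simp⟩
    refine coeff_ne_zero_of_polar hd b' (c := G) (a' := A) (c' := B) (fun x y z => ?_)
      (fun x y z => ?_) s2 (by rw [e0]; exact (h 1).2)
    · rw [e0, e1, e2, ← h2]
      congr 1
      module
    · rw [e0, e1, e2, ← h0]
      congr 1
      module
  have n2 : A ≠ 0 := by
    obtain ⟨b', e0, e1, e2⟩ : ∃ b' : Module.Basis (Fin 3) ℂ (Fin 3 → ℂ),
        b' 0 = b 2 ∧ b' 1 = b 0 ∧ b' 2 = b 1 :=
      ⟨b.reindex (finRotate 3), by simp; rfl⟩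
    refine coeff_ne_zero_of_polar hd b' (c := B) (a' := C') (c' := D) (fun x y z => ?_)
      (fun x y z => ?_) s1 (by rw [e0]; exact (h 2).2)
    · rw [e0, e1, e2, ← h0]
      congr 1
      module
    · rw [e0, e1, e2, ← h1]
      congr 1
      module
  -- Replacing `b 1`, `b 2` by `c₁ b 1`, `c₂ b 2` makes the three remaining constants equal, up to
  -- the common factor `C' c₁ c₂`.
  obtain ⟨c₁, hc₁⟩ := IsAlgClosed.exists_pow_nat_eq (-C' / B) (show 0 < d - 1 by omega)
  obtain ⟨c₂, hc₂⟩ := IsAlgClosed.exists_pow_nat_eq (C' / A) (show 0 < d - 1 by omega)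
  have nB : B ≠ 0 := by
    rintro rfl
    exact n1 (by simpa using s2)
  have p1 : B * c₁ ^ d = - C' * c₁ := by
    conv_lhs => rw [show d = d - 1 + 1 by omega, pow_succ, hc₁]
    field_simp
  have p2 : A * c₂ ^ d = C' * c₂ := by
    conv_lhs => rw [show d = d - 1 + 1 by omega, pow_succ, hc₂]
    field_simp
  have m1 : c₁ ≠ 0 := by
    rintro rfl
    rw [zero_pow (by omega), eq_comm] at hc₁
    exact div_ne_zero (neg_ne_zero.2 n0) nB hc₁
  have m2 : c₂ ≠ 0 := by
    rintro rfl
    rw [zero_pow (by omega), eq_comm] at hc₂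
    exact div_ne_zero n0 n2 hc₂
  obtain ⟨c, hc0, hc1, hc2⟩ : ∃ c : Fin 3 → ℂˣ, (c 0 : ℂ) = 1 ∧ (c 1 : ℂ) = c₁ ∧ (c 2 : ℂ) = c₂ :=
    ⟨![1, Units.mk0 _ m1, Units.mk0 _ m2], rfl, rfl, rfl⟩
  refine isLinearlyConjugate_of_basis hd (b.unitsSMul c)
    (mul_ne_zero n0 (mul_ne_zero m1 m2)) fun x i => ?_
  have hx : ∑ j, x j • b.unitsSMul c j = x 0 • b 0 + (x 1 * c₁) • b 1 + (x 2 * c₂) • b 2 := by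
    simp only [Fin.sum_univ_three, Module.Basis.unitsSMul_apply, Units.smul_def, smul_smul, hc0,
      hc1, hc2, mul_one]
  rw [hx, Module.Basis.unitsSMul_apply, Units.smul_def, OneForm.evalAt_smul]
  obtain rfl : D = - A := by linear_combination s1
  obtain rfl : E = - B := by linear_combination s2
  obtain rfl : G = - C' := by linear_combination s3
  fin_cases i
  · simp [h0, hc0, fermat, fermatForm, mul_pow]
    linear_combination x 1 * c₁ * x 2 ^ d * p2 + x 2 * c₂ * x 1 ^ d * p1
  · simp [h1, hc1, fermat, fermatForm, mul_pow]
    linear_combination - c₁ * x 0 * x 2 ^ d * p2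
  · simp [h2, hc2, fermat, fermatForm, mul_pow]
    linear_combination - c₂ * x 0 * x 1 ^ d * p1

/-- Three radial singularities of maximal order characterize the Fermat foliation. -/
theorem isLinearlyConjugate_of_isRadialSingularity (hd : 2 ≤ d) {s₁ s₂ s₃ : P2} (h12 : s₁ ≠ s₂)
    (h13 : s₁ ≠ s₃) (h23 : s₂ ≠ s₃) (h1 : F.IsRadialSingularity s₁ (d - 1))
    (h2 : F.IsRadialSingularity s₂ (d - 1)) (h3 : F.IsRadialSingularity s₃ (d - 1)) :
    F.IsLinearlyConjugate (fermat d hd) := by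
  have hna := not_aligned hd h12 h13 h23 h1 h2 h3
  induction s₁ using Projectivization.ind with | h p₁ hp₁ => ?_
  induction s₂ using Projectivization.ind with | h p₂ hp₂ => ?_
  induction s₃ using Projectivization.ind with | h p₃ hp₃ => ?_
  simp only [ne_eq, Projectivization.mk_eq_mk_iff'] at h12
  have hc : LinearIndependent ℂ ![p₁, p₂] := by
    rw [LinearIndependent.pair_iff' hp₁]
    intro r hr
    have hr0 : r ≠ 0 := by
      rintro rfl
      exact hp₂ (by rw [← hr, zero_smul])
    exact h12 ⟨r⁻¹, by rw [← hr, smul_smul, inv_mul_cancel₀ hr0, one_smul]⟩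
  have hℓ : IsLine (Submodule.span ℂ {p₁, p₂}) := by
    have := finrank_span_eq_card hc
    rw [Matrix.range_cons, Matrix.range_cons, Matrix.range_empty, Set.union_empty,
      Set.singleton_union] at this
    rw [IsLine, this]
    rfl
  have m1 : p₁ ∈ Submodule.span ℂ {p₁, p₂} := Submodule.subset_span (by simp)
  have m2 : p₂ ∈ Submodule.span ℂ {p₁, p₂} := Submodule.subset_span (by simp)
  have m3 : p₃ ∉ Submodule.span ℂ {p₁, p₂} := by
    intro h
    refine hna ⟨_, hℓ, ?_, ?_, ?_⟩ <;>
      rwa [Projectivization.submodule_mk, Submodule.span_singleton_le_iff_mem]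
  obtain ⟨b, rfl, rfl, rfl⟩ := hℓ.exists_basis m1 m2
    (crossProduct_ne_zero_iff_linearIndependent.2 hc) m3
  refine isLinearlyConjugate_of_invariantAlong hd b fun i => ?_
  fin_cases i
  · exact h1.invariance hd hp₁
  · exact h3.invariance hd hp₃
  · exact h2.invariance hd hp₂

end Foliation

/-! ### Transport by linear automorphisms. -/

theorem map_isLine (e : (Fin 3 → ℂ) ≃ₗ[ℂ] (Fin 3 → ℂ)) {ℓ : Submodule ℂ (Fin 3 → ℂ)}
    (hℓ : IsLine ℓ) : IsLine (ℓ.map (e : (Fin 3 → ℂ) →ₗ[ℂ] (Fin 3 → ℂ))) :=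
  (LinearEquiv.finrank_map_eq e ℓ).trans hℓ

namespace Foliation

variable {d : ℕ} {F G : Foliation d}

theorem exists_eval_ne_zero_iff (p : Fin 3 → ℂ) :
    (∃ i, eval p (F.form i) ≠ 0) ↔ ¬ F.IsSingularAt p := by
  constructor
  · rintro ⟨i, hi⟩ h
    exact hi (by rw [← OneForm.evalAt_single, h])
  · intro h
    by_contra! h0
    exact h fun v => by simp [OneForm.evalAt, h0]

/-- The linear automorphism `e` maps the foliation `G` to the foliation `F`. -/
def MapsTo (e : (Fin 3 → ℂ) ≃ₗ[ℂ] (Fin 3 → ℂ)) (G F : Foliation d) : Prop :=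
  ∃ c : ℂ, c ≠ 0 ∧ ∀ p v, F.form.evalAt (e p) (e v) = c * G.form.evalAt p v

theorem IsLinearlyConjugate.exists_mapsTo (h : F.IsLinearlyConjugate G) :
    ∃ e, MapsTo e G F := by
  obtain ⟨g, c, hc, hg⟩ := h
  refine ⟨Matrix.toLin'OfInv (M := g⁻¹.val) (M' := g.val) (by simp) (by simp), c, hc, fun p v => ?_⟩
  change F.form.evalAt (g.val.mulVec p) (g.val.mulVec v) = _
  rw [← OneForm.evalAt_pullback, hg]
  simp only [OneForm.evalAt, map_mul, eval_C, Finset.mul_sum, mul_assoc]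

namespace MapsTo

variable {e : (Fin 3 → ℂ) ≃ₗ[ℂ] (Fin 3 → ℂ)}

theorem symm (h : MapsTo e G F) : MapsTo e.symm F G := by
  obtain ⟨c, hc, h⟩ := h
  refine ⟨c⁻¹, inv_ne_zero hc, fun p v => ?_⟩
  have := h (e.symm p) (e.symm v)
  rw [e.apply_symm_apply, e.apply_symm_apply] at this
  rw [this, inv_mul_cancel_left₀ hc]

theorem evalAt_eq_zero_iff (h : MapsTo e G F) (p v : Fin 3 → ℂ) :
    F.form.evalAt (e p) (e v) = 0 ↔ G.form.evalAt p v = 0 := by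
  obtain ⟨c, hc, h⟩ := h
  rw [h, mul_eq_zero, or_iff_right hc]

theorem exists_polar (h : MapsTo e G F) :
    ∃ c : ℂ, c ≠ 0 ∧ ∀ p x y, F.form.polar (e p) (e x) (e y) = c * G.form.polar p x y := by
  obtain ⟨c, hc, h⟩ := h
  refine ⟨c, hc, fun p x y => ?_⟩
  have h1 := F.form.hasDerivAt_evalAt_zero (e p) (e x) (e y)
  rw [funext fun t : ℂ => show F.form.evalAt (e p + t • e x) (e y) =
    c * G.form.evalAt (p + t • x) y by rw [← h, map_add, map_smul]] at h1
  exact h1.unique ((G.form.hasDerivAt_evalAt_zero p x y).const_mul c)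

theorem isSingularAt_iff (h : MapsTo e G F) (p : Fin 3 → ℂ) :
    F.IsSingularAt (e p) ↔ G.IsSingularAt p := by
  constructor
  · exact fun hp v => (h.evalAt_eq_zero_iff p v).1 (hp _)
  · intro hp v
    rw [← e.apply_symm_apply v, h.evalAt_eq_zero_iff]
    exact hp _

theorem map_mem_invariantLines (h : MapsTo e G F) {ℓ : Submodule ℂ (Fin 3 → ℂ)}
    (hℓ : ℓ ∈ G.invariantLines) :
    ℓ.map (e : (Fin 3 → ℂ) →ₗ[ℂ] (Fin 3 → ℂ)) ∈ F.invariantLines := by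
  refine ⟨map_isLine e hℓ.1, ?_⟩
  rintro _ ⟨p, hp, rfl⟩ _ ⟨v, hv, rfl⟩
  exact (h.evalAt_eq_zero_iff p v).2 (hℓ.2 p hp v hv)

theorem encard_invariantLines_le (h : MapsTo e G F) :
    G.invariantLines.encard ≤ F.invariantLines.encard := by
  rw [← (Submodule.map_injective_of_injective e.injective).encard_image]
  refine Set.encard_le_encard ?_
  rintro _ ⟨ℓ, hℓ, rfl⟩
  exact h.map_mem_invariantLines hℓ

theorem isConvex (h : MapsTo e G F) (hG : G.IsConvex) : F.IsConvex := by
  intro p hp hinf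
  rw [F.isInflectionAt_iff_forall hp] at hinf
  rw [exists_eval_ne_zero_iff] at hp
  obtain ⟨p, rfl⟩ := e.surjective p
  rw [h.isSingularAt_iff] at hp
  rw [← exists_eval_ne_zero_iff] at hp
  obtain ⟨c, hc, hpol⟩ := h.exists_polar
  obtain ⟨ℓ, hℓ, hpℓ⟩ := hG p hp ((G.isInflectionAt_iff_forall hp).2 fun v hv => by
    have := hinf (e v) ((h.evalAt_eq_zero_iff p v).2 hv)
    rw [hpol, mul_eq_zero] at this
    exact this.resolve_left hc)
  exact ⟨_, h.map_mem_invariantLines hℓ, Submodule.mem_map_of_mem hpℓ⟩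

theorem isReducedConvex (h : MapsTo e G F) (hG : G.IsReducedConvex) : F.IsReducedConvex :=
  ⟨h.isConvex hG.1, by
    rw [← hG.2]
    exact le_antisymm h.symm.encard_invariantLines_le h.encard_invariantLines_le⟩

end MapsTo

/-- Both the line and the point are determined by the basis, so an index becomes a condition on a
basis alone, which a linear automorphism maps to another basis. -/
theorem mem_camachoSadSet_iff (lam : ℂ) : lam ∈ F.camachoSadSet ↔ lam ≠ 0 ∧ lam ≠ 1 ∧
    ∃ b : Module.Basis (Fin 3) ℂ (Fin 3 → ℂ), Submodule.span ℂ {b 0, b 2} ∈ F.invariantLines ∧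
      F.IsSingularAt (b 0) ∧
      F.form.polar (b 0) (b 1) (b 1) * F.form.polar (b 0) (b 2) (b 2)
      - F.form.polar (b 0) (b 2) (b 1) * F.form.polar (b 0) (b 1) (b 2) ≠ 0 ∧
      lam = - (F.form.polar (b 0) (b 1) (b 2) / F.form.polar (b 0) (b 2) (b 1)) := by
  simp only [camachoSadSet, hasCamachoSadIndex_iff, Set.mem_ofPred_eq]
  refine and_congr_right fun _ => and_congr_right fun _ => ?_
  constructor
  · rintro ⟨_, hℓ, s, -, b, -, rfl, h⟩
    exact ⟨b, hℓ, h⟩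
  · rintro ⟨b, hℓ, h⟩
    refine ⟨_, hℓ, _, ?_, b, rfl, rfl, h⟩
    rw [Projectivization.submodule_mk, Submodule.span_singleton_le_iff_mem]
    exact Submodule.subset_span (by simp)

theorem MapsTo.camachoSadSet_subset {e : (Fin 3 → ℂ) ≃ₗ[ℂ] (Fin 3 → ℂ)} (h : MapsTo e G F) :
    G.camachoSadSet ⊆ F.camachoSadSet := by
  intro lam
  rw [mem_camachoSadSet_iff, mem_camachoSadSet_iff]
  rintro ⟨h0, h1, b, hℓ, hs, hdet, hlam⟩
  obtain ⟨c, hc, hpol⟩ := h.exists_polar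
  refine ⟨h0, h1, b.map e, ?_⟩
  simp only [Module.Basis.map_apply, hpol, h.isSingularAt_iff]
  refine ⟨?_, hs, ?_, ?_⟩
  · have := h.map_mem_invariantLines hℓ
    rwa [Submodule.map_span, Set.image_pair] at this
  · have := mul_ne_zero (pow_ne_zero 2 hc) hdet
    intro h
    apply this
    linear_combination h
  · rw [hlam, mul_div_mul_left _ _ hc]

theorem MapsTo.camachoSadSet_eq {e : (Fin 3 → ℂ) ≃ₗ[ℂ] (Fin 3 → ℂ)} (h : MapsTo e G F) :
    F.camachoSadSet = G.camachoSadSet :=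
  h.symm.camachoSadSet_subset.antisymm h.camachoSadSet_subset

end Foliation

/-! ### The Fermat foliation: invariant lines, convexity and indices. -/

section Fermat

variable {d : ℕ}

theorem fermat_evalAt (hd : 2 ≤ d) (p v : Fin 3 → ℂ) : (fermat d hd).form.evalAt p v =
    (p 1 * p 2 ^ d - p 2 * p 1 ^ d) * v 0 + (p 2 * p 0 ^ d - p 0 * p 2 ^ d) * v 1 +
      (p 0 * p 1 ^ d - p 1 * p 0 ^ d) * v 2 := by
  simp [OneForm.evalAt, fermat, fermatForm, Fin.sum_univ_three]

theorem fermat_polar (hd : 2 ≤ d) (p x y : Fin 3 → ℂ) : (fermat d hd).form.polar p x y =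
    (x 1 * p 2 ^ d + d * p 1 * p 2 ^ (d - 1) * x 2 - x 2 * p 1 ^ d
      - d * p 2 * p 1 ^ (d - 1) * x 1) * y 0 +
    (x 2 * p 0 ^ d + d * p 2 * p 0 ^ (d - 1) * x 0 - x 0 * p 2 ^ d
      - d * p 0 * p 2 ^ (d - 1) * x 2) * y 1 +
    (x 0 * p 1 ^ d + d * p 0 * p 1 ^ (d - 1) * x 1 - x 1 * p 0 ^ d
      - d * p 1 * p 0 ^ (d - 1) * x 0) * y 2 := by
  simp [OneForm.polar, fermat, fermatForm, Fin.sum_univ_three, pderiv_X]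
  ring

/-- The line `x i = ζ * x (i + 1)`. -/
def coordLine (a : Fin 3 × ℂ) : Submodule ℂ (Fin 3 → ℂ) :=
  LinearMap.ker (LinearMap.proj a.1 - a.2 • LinearMap.proj (a.1 + 1) :
    (Fin 3 → ℂ) →ₗ[ℂ] ℂ)

theorem mem_coordLine {a : Fin 3 × ℂ} {x : Fin 3 → ℂ} :
    x ∈ coordLine a ↔ x a.1 = a.2 * x (a.1 + 1) := by
  simp [coordLine, sub_eq_zero]

theorem coordLine_isLine (a : Fin 3 × ℂ) : IsLine (coordLine a) := by
  have h : LinearMap.range (LinearMap.proj a.1 - a.2 • LinearMap.proj (a.1 + 1) :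
    (Fin 3 → ℂ) →ₗ[ℂ] ℂ) = ⊤ := by
    refine LinearMap.range_eq_top.2 (LinearMap.surjective fun h => ?_)
    have := LinearMap.congr_fun h (Pi.single a.1 1)
    simp at this
  have h1 := (LinearMap.proj a.1 - a.2 • LinearMap.proj (a.1 + 1) :
    (Fin 3 → ℂ) →ₗ[ℂ] ℂ).finrank_range_add_finrank_ker
  rw [h] at h1
  simp at h1
  change Module.finrank ℂ (coordLine a) = 2
  rw [coordLine]
  omega

theorem coordLine_injective : Function.Injective coordLine := by
  have key : ∀ a b : Fin 3 × ℂ, (∀ x : Fin 3 → ℂ, x a.1 = a.2 * x (a.1 + 1) →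
      x b.1 = b.2 * x (b.1 + 1)) → a = b := by
    rintro ⟨i, ζ⟩ ⟨j, ξ⟩ h
    -- The two test vectors span the first line.
    have h1 := h (Pi.single (i + 1) 1 + Pi.single i ζ)
    have h2 := h (Pi.single (i + 2) 1)
    fin_cases i <;> fin_cases j <;> simp at h1 h2 ⊢ <;> exact h1
  intro a b h
  refine key a b fun x hx => ?_
  rw [← mem_coordLine] at hx ⊢
  rwa [← h]

theorem coordLine_mem_invariantLines (hd : 2 ≤ d) {a : Fin 3 × ℂ} (ha : a.2 ^ d = a.2) :
    coordLine a ∈ (fermat d hd).invariantLines := by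
  obtain ⟨i, ζ⟩ := a
  refine ⟨coordLine_isLine _, fun p hp v hv => ?_⟩
  rw [mem_coordLine] at hp hv
  rw [fermat_evalAt]
  simp only at ha hp hv
  fin_cases i <;> simp at hp hv <;> rw [hp, hv, mul_pow, ha] <;> ring

theorem exists_coordLine_of_mul_pow {p : Fin 3 → ℂ} (i : Fin 3)
    (h : p i * p (i + 1) ^ d = p (i + 1) * p i ^ d) (hd : 2 ≤ d) :
    ∃ a : Fin 3 × ℂ, a.2 ^ d = a.2 ∧ p ∈ coordLine a := by
  by_cases h0 : p (i + 1) = 0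
  -- The infinite slope for the index `i` is the slope `0` for `i + 1`, so each coordinate axis
  -- occurs once.
  · exact ⟨(i + 1, 0), zero_pow (by omega), by simp [mem_coordLine, h0]⟩
  · refine ⟨(i, p i / p (i + 1)), ?_, by simp [mem_coordLine, h0]⟩
    simp only [div_pow]
    field_simp
    linear_combination -h

/-- The field with components `x_i^d` is tangent to the foliation. Its curvature is, up to sign, `d`
times the product of the coordinates and of the differences of their powers of exponent `d - 1`. At
a singular point a single coefficient of the form already gives a line. -/
theorem exists_coordLine_of_eval_inflection (hd : 2 ≤ d) {p : Fin 3 → ℂ}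
    (h : eval p (fermat d hd).inflection = 0) :
    ∃ a : Fin 3 × ℂ, a.2 ^ d = a.2 ∧ p ∈ coordLine a := by
  have hp : ∀ i, p i ^ d = p i * p i ^ (d - 1) := fun i => by
    rw [← pow_succ', Nat.sub_add_cancel (by omega)]
  by_cases hs : (fermat d hd).IsSingularAt p
  · refine exists_coordLine_of_mul_pow 0 ?_ hd
    have := hs (Pi.single 2 1)
    rw [fermat_evalAt] at this
    simp at this
    simp
    linear_combination this
  · rw [← Foliation.exists_eval_ne_zero_iff] at hs
    rw [← Foliation.isInflectionAt_iff, Foliation.isInflectionAt_iff_forall _ hs] at h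
    have h1 := h (fun i => p i ^ d) (by rw [fermat_evalAt]; ring)
    rw [fermat_polar] at h1
    have h2 : (d : ℂ) * (p 0 * p 1 * p 2 * ((p 0 ^ (d - 1) - p 1 ^ (d - 1)) *
        ((p 1 ^ (d - 1) - p 2 ^ (d - 1)) * (p 2 ^ (d - 1) - p 0 ^ (d - 1))))) = 0 := by
      simp only [hp] at h1
      generalize p 0 ^ (d - 1) = u at *
      generalize p 1 ^ (d - 1) = v at *
      generalize p 2 ^ (d - 1) = w at *
      linear_combination -h1
    have hd0 : (d : ℂ) ≠ 0 := by exact_mod_cast (by omega : d ≠ 0)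
    simp only [mul_eq_zero, hd0, false_or, sub_eq_zero] at h2
    have hz : ∀ i, p i = 0 → ∃ a : Fin 3 × ℂ, a.2 ^ d = a.2 ∧ p ∈ coordLine a := fun i hi =>
      exists_coordLine_of_mul_pow i (by rw [hi, zero_pow (by omega)]; ring) hd
    have he : ∀ i, p i ^ (d - 1) = p (i + 1) ^ (d - 1) →
        ∃ a : Fin 3 × ℂ, a.2 ^ d = a.2 ∧ p ∈ coordLine a := fun i hi =>
      exists_coordLine_of_mul_pow i (by rw [hp, hp, hi]; ring) hd
    rcases h2 with ((h2 | h2) | h2) | h2 | h2 | h2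
    · exact hz 0 h2
    · exact hz 1 h2
    · exact hz 2 h2
    · exact he 0 h2
    · exact he 1 h2
    · exact he 2 h2

/-- The `d` solutions of `ζ ^ d = ζ`. -/
def fermatRoots (d : ℕ) : Finset ℂ := insert 0 (Polynomial.nthRootsFinset (d - 1) (1 : ℂ))

theorem mem_fermatRoots (hd : 2 ≤ d) {ζ : ℂ} : ζ ∈ fermatRoots d ↔ ζ ^ d = ζ := by
  rw [fermatRoots, Finset.mem_insert, Polynomial.mem_nthRootsFinset (by omega)]
  constructor
  · rintro (rfl | h)
    · exact zero_pow (by omega)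
    · rw [← Nat.sub_add_cancel (show 1 ≤ d by omega), pow_succ, h, one_mul]
  · intro h
    by_cases h0 : ζ = 0
    · exact Or.inl h0
    · right
      apply mul_right_cancel₀ h0
      rw [← pow_succ, Nat.sub_add_cancel (by omega), h, one_mul]

theorem card_fermatRoots (hd : 2 ≤ d) : (fermatRoots d).card = d := by
  rw [fermatRoots, Finset.card_insert_of_notMem,
    (Complex.isPrimitiveRoot_exp (d - 1) (by omega)).card_nthRootsFinset]
  · omega
  · rw [Polynomial.mem_nthRootsFinset (by omega), zero_pow (by omega)]
    exact zero_ne_one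

/-- An invariant line lies in the zero set of the inflection polynomial, hence in a finite union of
known lines. Over an infinite field it must be contained in one of them. -/
theorem fermat_invariantLines (hd : 2 ≤ d) :
    (fermat d hd).invariantLines = coordLine '' {a | a.2 ^ d = a.2} := by
  classical
  apply subset_antisymm
  · intro ℓ hℓ
    have hcov : ⋃ q ∈ (Finset.univ ×ˢ fermatRoots d).image fun a =>
        (coordLine a).comap ℓ.subtype, (q : Set ℓ) = Set.univ := by
      refine Set.eq_univ_of_forall fun x => ?_
      obtain ⟨a, ha, hx⟩ := exists_coordLine_of_eval_inflection hd
        ((fermat d hd).eval_inflection_of_mem (by omega) hℓ x.2)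
      simp only [Set.mem_iUnion, Finset.mem_image, Finset.mem_product, Finset.mem_univ, true_and]
      exact ⟨_, ⟨a, (mem_fermatRoots hd).2 ha, rfl⟩, hx⟩
    have htop := Subspace.top_mem_of_biUnion_eq_univ hcov
    simp only [Finset.mem_image, Finset.mem_product, Finset.mem_univ, true_and] at htop
    obtain ⟨a, ha, h⟩ := htop
    refine ⟨a, (mem_fermatRoots hd).1 ha, ?_⟩
    rw [Submodule.comap_subtype_eq_top] at h
    exact (hℓ.1.eq_of_le (coordLine_isLine a) h).symm
  · rintro _ ⟨a, ha, rfl⟩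
    exact coordLine_mem_invariantLines hd ha

theorem fermat_isReducedConvex (hd : 2 ≤ d) : (fermat d hd).IsReducedConvex := by
  constructor
  · intro p hp hinf
    rw [Foliation.isInflectionAt_iff] at hinf
    obtain ⟨a, ha, hpa⟩ := exists_coordLine_of_eval_inflection hd hinf
    exact ⟨_, coordLine_mem_invariantLines hd ha, hpa⟩
  · have h : {a : Fin 3 × ℂ | a.2 ^ d = a.2} =
        ((Finset.univ ×ˢ fermatRoots d : Finset (Fin 3 × ℂ)) : Set (Fin 3 × ℂ)) := by
      ext a
      simp [mem_fermatRoots hd]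
    rw [fermat_invariantLines, coordLine_injective.encard_image, h, Set.encard_coe_eq_coe_finsetCard,
      Finset.card_product, card_fermatRoots hd]
    simp

theorem sum_det_diagonal (t p w n : Fin 3 → ℂ) :
    Matrix.det (Matrix.of ![t * p, w, n]) + Matrix.det (Matrix.of ![p, t * w, n]) +
      Matrix.det (Matrix.of ![p, w, t * n]) =
      (t 0 + t 1 + t 2) * Matrix.det (Matrix.of ![p, w, n]) := by
  simp [Matrix.det_fin_three]
  ring

theorem det_diagonal (t p w n : Fin 3 → ℂ) :
    Matrix.det (Matrix.of ![t * p, t * w, t * n]) =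
      t 0 * t 1 * t 2 * Matrix.det (Matrix.of ![p, w, n]) := by
  simp [Matrix.det_fin_three]
  ring

theorem det_mul_det (p w n x y : Fin 3 → ℂ) :
    Matrix.det (Matrix.of ![p, x, y]) * Matrix.det (Matrix.of ![p, w, n]) =
      Matrix.det (Matrix.of ![p, x, n]) * Matrix.det (Matrix.of ![p, w, y]) -
        Matrix.det (Matrix.of ![p, x, w]) * Matrix.det (Matrix.of ![p, n, y]) := by
  simp [Matrix.det_fin_three]
  ring

theorem det_smul_first (c : ℂ) (p x y : Fin 3 → ℂ) :
    Matrix.det (Matrix.of ![c • p, x, y]) = c * Matrix.det (Matrix.of ![p, x, y]) := by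
  simp [Matrix.det_fin_three]
  ring

/-- The form is `ω_p(y) = det(p, p^d, y)` with powers taken by coordinates. In its derivative, `p^d
= μ p` turns the term `det(x, p^d, y)` into `-μ det(p, x, y)`. -/
theorem fermat_polar_eq_det (hd : 2 ≤ d) {p : Fin 3 → ℂ} {μ : ℂ} (hp : ∀ i, p i ^ d = μ * p i)
    (x y : Fin 3 → ℂ) : (fermat d hd).form.polar p x y =
      Matrix.det (Matrix.of ![p, (fun i => d * p i ^ (d - 1) - μ) * x, y]) := by
  rw [fermat_polar, hp, hp, hp]
  simp [Matrix.det_fin_three]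
  ring

/-- The Camacho-Sad indices of the Fermat foliation. -/
theorem fermat_index_eq (hd : 2 ≤ d) {p w n : Fin 3 → ℂ} (hp0 : p ≠ 0)
    (hs : (fermat d hd).IsSingularAt p) (hw : (fermat d hd).form.polar p w w = 0) (hwn : (fermat d hd).form.polar p w n ≠ 0) {lam : ℂ}
    (hlam : lam = - ((fermat d hd).form.polar p n w / (fermat d hd).form.polar p w n)) :
    lam = 1 ∨ lam = 1 - d ∨ lam = (1 - (d : ℂ))⁻¹ := by
  obtain ⟨μ, hμ⟩ : ∃ μ : ℂ, (fun i => p i ^ d) = μ • p := by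
    refine exists_smul_of_cross_eq_zero hp0 ?_
    have h0 := hs (Pi.single 0 1)
    have h1 := hs (Pi.single 1 1)
    have h2 := hs (Pi.single 2 1)
    rw [fermat_evalAt] at h0 h1 h2
    simp at h0 h1 h2
    rw [cross_apply, h0, h1, h2]
    ext i
    fin_cases i <;> rfl
  replace hμ : ∀ i, p i ^ d = μ * p i := congrFun hμ
  have hcase : ∀ i, p i = 0 ∨ p i ^ (d - 1) = μ := fun i => by
    by_cases h : p i = 0
    · exact Or.inl h
    · right
      apply mul_right_cancel₀ h
      rw [← pow_succ, Nat.sub_add_cancel (by omega), hμ]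
  have hμ0 : μ ≠ 0 := by
    obtain ⟨i, hi⟩ := Function.ne_iff.1 hp0
    rw [← (hcase i).resolve_left hi]
    exact pow_ne_zero _ hi
  have hd1 : (d : ℂ) - 1 ≠ 0 := by
    rw [sub_ne_zero]
    exact_mod_cast (by omega : d ≠ 1)
  rw [fermat_polar_eq_det hd hμ] at hw hwn
  rw [fermat_polar_eq_det hd hμ, fermat_polar_eq_det hd hμ] at hlam
  set t : Fin 3 → ℂ := fun i => d * p i ^ (d - 1) - μ with ht
  have htp : t * p = ((d - 1) * μ) • p := by
    ext i
    simp only [ht, Pi.mul_apply, Pi.smul_apply, smul_eq_mul]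
    rcases hcase i with h | h
    · rw [h]; ring
    · rw [h]; ring
  have htc : ∀ i, (p i = 0 ∧ t i = - μ) ∨ t i = (d - 1) * μ := fun i => by
    rcases hcase i with h | h
    · left
      refine ⟨h, ?_⟩
      simp only [ht, h, zero_pow (show d - 1 ≠ 0 by omega)]
      ring
    · right
      simp only [ht, h]
      ring
  have e1 := sum_det_diagonal t p w n
  have e2 := det_diagonal t p w n
  have e3 := det_mul_det p w n (t * w) (t * n)
  have e4 : Matrix.det (Matrix.of ![p, t * n, w]) = - Matrix.det (Matrix.of ![p, w, t * n]) := by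
    simp [Matrix.det_fin_three]
    ring
  rw [htp, det_smul_first] at e1 e2
  rw [hw, zero_mul, sub_zero] at e3
  rw [e4] at hlam
  set D := Matrix.det (Matrix.of ![p, w, n])
  set W := Matrix.det (Matrix.of ![p, t * w, n])
  set N := Matrix.det (Matrix.of ![p, w, t * n])
  -- As `p` is an eigenvector of the diagonal map `t` with eigenvalue `(d - 1) μ`, the numbers `W`
  -- and `N` play the part of `D` times the eigenvalues of `t` on the quotient by `p`. Their sum and
  -- product follow from the trace and determinant of `t`, and the index is `N / W`.
  have hsum : N = (t 0 + t 1 + t 2 - (d - 1) * μ) * D - W := by linear_combination e1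
  have hprod : (d - 1) * μ * (W * N) = t 0 * t 1 * t 2 * D ^ 2 := by
    rw [← e3]
    linear_combination D * e2
  have hμd : ((d : ℂ) - 1) * μ ≠ 0 := mul_ne_zero hd1 hμ0
  have hl : lam * W = N := by
    rw [hlam]
    field_simp
  have one : (W - N) ^ 2 = 0 → lam = 1 ∨ lam = 1 - d ∨ lam = (1 - (d : ℂ))⁻¹ := fun h => by
    left
    apply mul_right_cancel₀ hwn
    rw [hl, one_mul]
    exact (sub_eq_zero.1 (pow_eq_zero_iff two_ne_zero |>.1 h)).symm
  have two : t 0 + t 1 + t 2 = (2 * d - 3) * μ → t 0 * t 1 * t 2 = - (d - 1) ^ 2 * μ ^ 3 →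
      lam = 1 ∨ lam = 1 - d ∨ lam = (1 - (d : ℂ))⁻¹ := fun h1 h2 => by
    right
    rw [h1] at hsum
    rw [h2, hsum] at hprod
    have h3 : (W + μ * D) * (W - (d - 1) * μ * D) = 0 := by
      apply mul_left_cancel₀ hμd
      linear_combination -hprod
    rcases mul_eq_zero.1 h3 with h | h
    · left
      apply mul_right_cancel₀ hwn
      rw [hl, hsum]
      linear_combination (d - 2) * h
    · right
      have hd1' : 1 - (d : ℂ) ≠ 0 := by rwa [← neg_sub, neg_ne_zero]
      apply mul_right_cancel₀ hwn
      rw [hl, hsum]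
      field_simp
      linear_combination (d - 2) * h
  have hsq : ∀ c : ℂ, N + W = 2 * c * D → W * N = c ^ 2 * D ^ 2 → (W - N) ^ 2 = 0 :=
    fun c h1 h2 => by linear_combination (N + W + 2 * c * D) * h1 - 4 * h2
  -- With no or two zero coordinates the quotient has a double eigenvalue and the index is `1`. With
  -- one, the eigenvalues are `-μ` and `(d - 1) μ`. Three zeros are excluded.
  rcases htc 0 with ⟨z0, h0⟩ | h0 <;> rcases htc 1 with ⟨z1, h1⟩ | h1 <;>
    rcases htc 2 with ⟨z2, h2⟩ | h2 <;> rw [h0, h1, h2] at two hsum hprod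
  · refine absurd ?_ hp0
    ext i
    fin_cases i
    · exact z0
    · exact z1
    · exact z2
  · exact one (hsq (-μ) (by rw [hsum]; ring)
      (mul_left_cancel₀ hμd (by rw [hprod]; ring)))
  · exact one (hsq (-μ) (by rw [hsum]; ring)
      (mul_left_cancel₀ hμd (by rw [hprod]; ring)))
  · exact two (by ring) (by ring)
  · exact one (hsq (-μ) (by rw [hsum]; ring)
      (mul_left_cancel₀ hμd (by rw [hprod]; ring)))
  · exact two (by ring) (by ring)
  · exact two (by ring) (by ring)
  · exact one (hsq ((d - 1) * μ) (by rw [hsum]; ring)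
      (mul_left_cancel₀ hμd (by rw [hprod]; ring)))

theorem fermat_camachoSadSet (hd : 2 ≤ d) :
    (fermat d hd).camachoSadSet = {(1 - (d : ℂ)), (1 - (d : ℂ))⁻¹} := by
  have hd0 : (d : ℂ) ≠ 0 := by exact_mod_cast (by omega : d ≠ 0)
  have hd1 : 1 - (d : ℂ) ≠ 0 := by
    rw [sub_ne_zero]
    exact_mod_cast (by omega : 1 ≠ d)
  have hne : 1 - (d : ℂ) ≠ 1 := by simpa using hd0
  ext lam
  simp only [Set.mem_insert_iff, Set.mem_singleton_iff]
  constructor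
  · rw [Foliation.mem_camachoSadSet_iff]
    rintro ⟨-, h1, b, hℓ, hs, hdet, hlam⟩
    have h2 : b 2 ∈ Submodule.span ℂ {b 0, b 2} := Submodule.subset_span (by simp)
    have hw := Foliation.polar_eq_zero_of_mem hℓ (p := b 0) (Submodule.subset_span (by simp)) h2 h2
    rw [hw, mul_zero, zero_sub, neg_ne_zero] at hdet
    exact (fermat_index_eq hd (b.ne_zero 0) hs hw (left_ne_zero_of_mul hdet) hlam).resolve_left h1
  -- Both values occur at `[1 : 1 : 0]`: `1 - d` along `x₀ = x₁`, and its inverse along `x₂ = 0`.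
  · set p : Fin 3 → ℂ := ![1, 1, 0] with hp
    have hp0 : p ≠ 0 := fun h => by simpa [hp] using congrFun h 0
    have hs : (fermat d hd).IsSingularAt p := fun v => by
      rw [fermat_evalAt]
      simp [hp, show d ≠ 0 by omega]
    have e1 : (fermat d hd).form.polar p ![1, 0, 0] ![0, 0, 1] = 1 - d := by
      simp [fermat_polar, hp]
    have e2 : (fermat d hd).form.polar p ![0, 0, 1] ![1, 0, 0] = -1 := by
      simp [fermat_polar, hp, show d ≠ 0 by omega, show d - 1 ≠ 0 by omega]
    rintro (rfl | rfl)
    · have hℓ := coordLine_mem_invariantLines hd (a := (0, 1)) (one_pow d)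
      have hpℓ : p ∈ coordLine (0, 1) := by simp [mem_coordLine, hp]
      refine ⟨hd1, hne, _, hℓ, _, ?_, Foliation.hasCamachoSadIndex_of_polar hℓ hs hp0
        hpℓ (w := ![0, 0, 1]) (n := ![1, 0, 0]) (by simp [mem_coordLine]) ?_
        (by simp [mem_coordLine]) ?_ ?_⟩
      · rwa [Projectivization.submodule_mk, Submodule.span_singleton_le_iff_mem]
      · intro h
        simpa [hp, cross_apply] using congrFun h 0
      · rw [e1, e2]
        exact mul_ne_zero (neg_ne_zero.2 one_ne_zero) hd1
      · rw [e1, e2]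
        ring
    · have hℓ := coordLine_mem_invariantLines hd (a := (2, 0)) (zero_pow (by omega))
      have hpℓ : p ∈ coordLine (2, 0) := by simp [mem_coordLine, hp]
      refine ⟨inv_ne_zero hd1, by simpa using hd0, _, hℓ, _, ?_,
        Foliation.hasCamachoSadIndex_of_polar hℓ hs hp0
        hpℓ (w := ![1, 0, 0]) (n := ![0, 0, 1]) (by simp [mem_coordLine]) ?_
        (by simp [mem_coordLine]) ?_ ?_⟩
      · rwa [Projectivization.submodule_mk, Submodule.span_singleton_le_iff_mem]
      · intro h
        simpa [hp, cross_apply] using congrFun h 2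
      · rw [e1, e2]
        exact mul_ne_zero hd1 (neg_ne_zero.2 one_ne_zero)
      · rw [e1, e2]
        field_simp

end Fermat

end PlaneFoliation

end

/-! ### The equivalence. -/

theorem mainTheorem4 (d : ℕ) (hd : 2 ≤ d) (F : PlaneFoliation.Foliation d) :
    List.TFAE [
      F.IsLinearlyConjugate (PlaneFoliation.fermat d hd),
      F.IsReducedConvex ∧ F.camachoSadSet = {(1 - (d : ℂ)), (1 - (d : ℂ))⁻¹},
      ∃ s₁ s₂ s₃ : PlaneFoliation.P2, s₁ ≠ s₂ ∧ s₁ ≠ s₃ ∧ s₂ ≠ s₃ ∧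
        F.IsRadialSingularity s₁ (d - 1) ∧ F.IsRadialSingularity s₂ (d - 1) ∧
        F.IsRadialSingularity s₃ (d - 1)] ∧
    ∀ s₁ s₂ s₃ : PlaneFoliation.P2, s₁ ≠ s₂ → s₁ ≠ s₃ → s₂ ≠ s₃ →
      F.IsRadialSingularity s₁ (d - 1) → F.IsRadialSingularity s₂ (d - 1) →
      F.IsRadialSingularity s₃ (d - 1) → ¬ PlaneFoliation.Aligned s₁ s₂ s₃ := by
  refine ⟨?_, fun s₁ s₂ s₃ h12 h13 h23 h1 h2 h3 =>
    PlaneFoliation.Foliation.not_aligned hd h12 h13 h23 h1 h2 h3⟩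
  tfae_have 1 → 2 := fun h => by
    obtain ⟨e, he⟩ := h.exists_mapsTo
    exact ⟨he.isReducedConvex (PlaneFoliation.fermat_isReducedConvex hd), by
      rw [he.camachoSadSet_eq, PlaneFoliation.fermat_camachoSadSet hd]⟩
  tfae_have 2 → 3 := fun h => h.1.exists_radialSingularities hd h.2
  tfae_have 3 → 1 := fun ⟨s₁, s₂, s₃, h12, h13, h23, h1, h2, h3⟩ =>
    PlaneFoliation.Foliation.isLinearlyConjugate_of_isRadialSingularity hd h12 h13 h23 h1 h2 h3
  tfae_finish
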